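/- Let $M$ be a connected smooth manifold of dimension $D\ge 3$ and $g$ a smooth pseudo-Riemannian metric on $M$ of any signature, with Levi-Civita connection $\nabla$. Conventions: $\nabla_a\nabla_b\omega_c-\nabla_b\nabla_a\omega_c=R_{abc}{}^d\omega_d$, $R_{ac}=R_{abc}{}^b$, Schouten tensor $L_{ab}=\frac{R_{ab}}{D-2}-\frac{R\,g_{ab}}{2(D-1)(D-2)}$, Weyl tensor $C_{abc}{}^d=R_{abc}{}^d-2L_{[b}{}^dg_{a]c}-2\delta_{[b}{}^dL_{a]c}$. The Weyl endomorphism of the bundle of bivectors is $\psi^{be}\mapsto C^{ac}{}_{be}\psi^{be}$. Fix on each fibre of the bundle of bivectors a positive definite inner product (equivalently, say which frames are orthonormal), and let $W^+$ be the fibrewise Moore–Penrose pseudo-inverse of the Weyl endomorphism with respect to it; $(W^+)^{rs}{}_{pq}$, skew in $rs$ and in $pq$, denotes its components, $(W^+\psi)^{rs}=(W^+)^{rs}{}_{pq}\psi^{pq}$. Suppose that the Weyl endomorphism is not invertible (i.e. there is at least one point of $M$ at which it is not invertible) and that the compatibility condition $$C^{qp}{}_{be}\,(W^+)^{rs}{}_{qp}\,\nabla_{[r}L_{s]a}=\nabla_{[b}L_{e]a}$$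 holds. For a smooth tensor field $\xi^a{}_{bc}=\xi^a{}_{[bc]}$ put $$\Lambda^\xi_q=\frac{4}{1-D}\,\nabla_{[b}L_{e]p}\,g^{pr}\,(W^+)^{be}{}_{rq}+\frac{2}{1-D}\Big(\delta^m{}_{[p}\delta^n{}_{q]}-C^{mn}{}_{rs}\,(W^+)^{rs}{}_{pq}\Big)\xi^p{}_{mn},$$ let $\mathcal C^\xi$ be the torsion-free connection $$\mathcal C^\xi_av^c=\nabla_av^c+\big(-\Lambda^\xi_a\delta^c{}_b-\Lambda^\xi_b\delta^c{}_a+g_{ab}g^{cd}\Lambda^\xi_d\big)v^b,$$ let $\mathcal R^\xi_{ab}$ be its Ricci tensor and $\mathcal R^\xi=g^{ab}\mathcal R^\xi_{ab}$. Consider the following condition on $\xi$. $(\ast)$ The 1-form $\Lambda^\xi$ is smooth and closed, and $\mathcal R^\xi_{[ab]}=0$, $\ \mathcal R^\xi_{(ab)}-\frac1D g_{ab}\mathcal R^\xi=0$. An Einstein metric is a pseudo-Riemannian metric whose Ricci tensor is a constant multiple of it. Then: 1. If $g$ is conformal to an Einstein metric (there is a smooth $\Omega>0$ on $M$ with $\Omega^{-2}g$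 Einstein), then some smooth $\xi^a{}_{bc}=\xi^a{}_{[bc]}$ satisfies $(\ast)$. 2. Conversely, if $\xi$ satisfies $(\ast)$, then every point of $M$ has an open neighbourhood $U$ with a smooth function $\Omega>0$ on $U$ such that $d\Omega=\Omega\,\Lambda^\xi$ on $U$ and $\Omega^{-2}g$ is an Einstein metric on $U$. 3. If every smooth closed 1-form on $M$ is exact, then $g$ is conformal to an Einstein metric on all of $M$ if and only if some smooth $\xi^a{}_{bc}=\xi^a{}_{[bc]}$ satisfies $(\ast)$. -/

import Mathlib

open scoped Manifold ContDiff
open Module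

namespace ConfEinstein

noncomputable section

/-! ### The Moore–Penrose pseudo-inverse -/

/-- `P` is the Moore–Penrose pseudo-inverse of `A` with respect to the inner product `B`: the four
Penrose equations, the adjoint being the one of `B`.  In a `B`-orthonormal basis these are the
Penrose equations for real matrices. -/
structure IsMoorePenrose {V : Type*} [AddCommGroup V] [Module ℝ V]
    (B : LinearMap.BilinForm ℝ V) (A P : V →ₗ[ℝ] V) : Prop where
  mul_inv_mul : A ∘ₗ P ∘ₗ A = A
  inv_mul_inv : P ∘ₗ A ∘ₗ P = P
  selfAdjoint_left : ∀ u v, B (A (P u)) v = B u (A (P v))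
  selfAdjoint_right : ∀ u v, B (P (A u)) v = B u (P (A v))

/-- Existence and uniqueness of the Moore–Penrose pseudo-inverse for a positive definite `B`. -/
theorem existsUnique_isMoorePenrose {V : Type*} [AddCommGroup V] [Module ℝ V]
    [FiniteDimensional ℝ V] (B : LinearMap.BilinForm ℝ V) (hs : ∀ u v, B u v = B v u)
    (hp : ∀ u, u ≠ 0 → 0 < B u u) (A : V →ₗ[ℝ] V) : ∃! P, IsMoorePenrose B A P := by
  have hrefl : B.IsRefl := fun u v h => by rw [hs, h]
  have hcompl : ∀ S : Submodule ℝ V, IsCompl S (B.orthogonal S) := by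
    intro S
    refine (LinearMap.BilinForm.isCompl_orthogonal_iff_disjoint hrefl).2 ?_
    rw [Submodule.disjoint_def]
    intro u hu hu'
    by_contra hne
    have := hp u hne
    rw [LinearMap.BilinForm.mem_orthogonal_iff] at hu'
    have h0 : B u u = 0 := hu' u hu
    linarith
  have hK := hcompl (LinearMap.ker A)
  have hR := hcompl (LinearMap.range A)
  set C := B.orthogonal (LinearMap.ker A) with hC
  set Q := B.orthogonal (LinearMap.range A) with hQ
  let eqv := A.kerComplementEquivRange hK.symm
  let P : V →ₗ[ℝ] V := C.subtype ∘ₗ eqv.symm.toLinearMap ∘ₗ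
    (LinearMap.range A).projectionOnto Q hR
  -- `A P` fixes the range of `A`, kills its complement; `P` takes values in `C`
  have hPC : ∀ u, P u ∈ C := fun u => (eqv.symm _).2
  have hAP : ∀ u, A (P u) = ((LinearMap.range A).projectionOnto Q hR u : V) := by
    intro u
    have h := eqv.apply_symm_apply ((LinearMap.range A).projectionOnto Q hR u)
    have h2 := congrArg (Subtype.val) h
    rw [← h2]
    rfl
  have hAPA : ∀ u, A (P (A u)) = A u := by
    intro u
    rw [hAP]
    have := Submodule.projectionOnto_apply_left hR ⟨A u, LinearMap.mem_range_self A u⟩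
    exact congrArg Subtype.val this
  have hinj : ∀ u ∈ C, ∀ v ∈ C, A u = A v → u = v := by
    intro u hu v hv h
    have h1 : u - v ∈ LinearMap.ker A := by simp [h]
    have h2 : u - v ∈ C := C.sub_mem hu hv
    have := (Submodule.disjoint_def.1 hK.disjoint) _ h1 h2
    exact sub_eq_zero.1 this
  have hdiffQ : ∀ u, u - A (P u) ∈ Q := by
    intro u
    rw [hAP]
    have := Submodule.sub_projection_mem hR u
    simpa using this
  have hdiffK : ∀ u, u - P (A u) ∈ LinearMap.ker A := by
    intro u
    simp [hAPA]
  have horthR : ∀ w, ∀ u ∈ Q, B (A w) u = 0 := by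
    intro w u hu
    exact (LinearMap.BilinForm.mem_orthogonal_iff.1 hu) _ (LinearMap.mem_range_self A w)
  have horthK : ∀ k ∈ LinearMap.ker A, ∀ u ∈ C, B k u = 0 := by
    intro k hk u hu
    exact (LinearMap.BilinForm.mem_orthogonal_iff.1 hu) _ hk
  have hMP : IsMoorePenrose B A P := by
    refine ⟨?_, ?_, ?_, ?_⟩
    · ext u; exact hAPA u
    · ext u
      exact hinj _ (hPC _) _ (hPC _) (hAPA (P u))
    · intro u v
      have h1 := horthR (P u) _ (hdiffQ v)
      have h2 := horthR (P v) _ (hdiffQ u)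
      rw [map_sub] at h1 h2
      rw [hs u]
      rw [hs (A (P v)) (A (P u))] at h2
      linarith
    · intro u v
      have h1 := horthK _ (hdiffK v) _ (hPC (A u))
      have h2 := horthK _ (hdiffK u) _ (hPC (A v))
      rw [map_sub, LinearMap.sub_apply] at h1 h2
      rw [hs (P (A u)) v]
      rw [hs (P (A v)) (P (A u))] at h1
      linarith
  refine ⟨P, hMP, ?_⟩
  intro P' h'
  -- the standard uniqueness argument
  have nondeg : ∀ u w, (∀ v, B u v = B w v) → u = w := by
    intro u w h
    by_contra hne
    have := hp (u - w) (sub_ne_zero.2 hne)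
    rw [map_sub B, LinearMap.sub_apply, h, sub_self] at this
    exact lt_irrefl _ this
  have e1 : ∀ u, A (P' (A u)) = A u := fun u => LinearMap.congr_fun h'.mul_inv_mul u
  have e2 : ∀ u, P' (A (P' u)) = P' u := fun u => LinearMap.congr_fun h'.inv_mul_inv u
  have f2 : ∀ u, P (A (P u)) = P u := fun u => LinearMap.congr_fun hMP.inv_mul_inv u
  have hL : ∀ u, A (P' u) = A (P u) := by
    intro u
    apply nondeg
    intro v
    rw [h'.selfAdjoint_left, ← hAPA (P' v), ← hMP.selfAdjoint_left, ← h'.selfAdjoint_left, e1]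
  have hRt : ∀ u, P' (A u) = P (A u) := by
    intro u
    apply nondeg
    intro v
    calc B (P' (A u)) v = B (P' (A (P (A u)))) v := by rw [hAPA]
      _ = B (P (A u)) v := by
        rw [h'.selfAdjoint_right, hMP.selfAdjoint_right, e1, ← hMP.selfAdjoint_right]
  ext u
  rw [← e2, hL, hRt, f2]

open Classical in
/-- The Moore–Penrose pseudo-inverse of `A` with respect to the inner product `B`. -/
def moorePenrose {V : Type*} [AddCommGroup V] [Module ℝ V]
    (B : LinearMap.BilinForm ℝ V) (A : V →ₗ[ℝ] V) : V →ₗ[ℝ] V :=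
  if h : ∃ P, IsMoorePenrose B A P then h.choose else 0

/-! ### Tensor calculus in a coordinate chart

All index ranges are `Fin D`; `E D` is the model space, whose points are written `y`. -/

/-- The model space `ℝ^D`. -/
abbrev E (D : ℕ) : Type := EuclideanSpace ℝ (Fin D)

/-- Partial derivative `∂_i f` at `y`. -/
def pd {D : ℕ} (i : Fin D) (f : E D → ℝ) (y : E D) : ℝ :=
  fderiv ℝ f y (EuclideanSpace.single i 1)

/-- Components of a covariant two-tensor in a chart, as functions of the point. -/
abbrev Comp₂ (D : ℕ) : Type := E D → Matrix (Fin D) (Fin D) ℝ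

/-- Components of a one-form in a chart. -/
abbrev Comp₁ (D : ℕ) : Type := E D → Fin D → ℝ

/-- Coefficients of a linear connection in a chart: `G y c a b` is `G^c_{ab}`, with
`∇_a v^c = ∂_a v^c + G^c_{ab} v^b`. -/
abbrev ConnCoeff (D : ℕ) : Type := E D → Fin D → Fin D → Fin D → ℝ

/-- Christoffel symbols `Γ^c_{ab}` of the Levi-Civita connection of `g`. -/
def christoffel {D : ℕ} (g : Comp₂ D) : ConnCoeff D := fun y c a b =>
  1 / 2 * ∑ d, (g y)⁻¹ c d *
    (pd a (fun z => g z b d) y + pd b (fun z => g z a d) y - pd d (fun z => g z a b) y)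

/-- Curvature `R_{abc}{}^d` of a torsion-free connection, in the convention
`∇_a ∇_b ω_c - ∇_b ∇_a ω_c = R_{abc}{}^d ω_d`. -/
def riemann {D : ℕ} (G : ConnCoeff D) (y : E D) (a b c d : Fin D) : ℝ :=
  pd b (fun z => G z d a c) y - pd a (fun z => G z d b c) y
    + ∑ k, (G y k a c * G y d b k - G y k b c * G y d a k)

/-- Ricci tensor `R_{ac} = R_{abc}{}^b` of a connection. -/
def ricci {D : ℕ} (G : ConnCoeff D) : Comp₂ D := fun y =>
  Matrix.of fun a c => ∑ b, riemann G y a b c b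

/-- Trace `g^{ab} T_{ab}`. -/
def traceWith {D : ℕ} (g T : Comp₂ D) (y : E D) : ℝ := ∑ a, ∑ b, (g y)⁻¹ a b * T y a b

/-- Schouten tensor `L_{ab} = R_{ab} / (D-2) - R g_{ab} / (2 (D-1) (D-2))`. -/
def schouten {D : ℕ} (g : Comp₂ D) : Comp₂ D := fun y => Matrix.of fun a b =>
  ricci (christoffel g) y a b / ((D : ℝ) - 2)
    - g y a b * traceWith g (ricci (christoffel g)) y / (2 * ((D : ℝ) - 1) * ((D : ℝ) - 2))

/-- Kronecker delta. -/
def kd {D : ℕ} (a b : Fin D) : ℝ := if a = b then 1 else 0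

/-- `L_a{}^b = g^{bd} L_{ad}`. -/
def schoutenUp {D : ℕ} (g : Comp₂ D) (y : E D) (a b : Fin D) : ℝ :=
  ∑ d, (g y)⁻¹ b d * schouten g y a d

/-- Weyl tensor
`C_{abc}{}^d = R_{abc}{}^d - 2 L_{[b}{}^d g_{a]c} - 2 δ_{[b}{}^d L_{a]c}`. -/
def weyl {D : ℕ} (g : Comp₂ D) (y : E D) (a b c d : Fin D) : ℝ :=
  riemann (christoffel g) y a b c d
    - (schoutenUp g y b d * g y a c - schoutenUp g y a d * g y b c)
    - (kd b d * schouten g y a c - kd a d * schouten g y b c)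

/-- `C^{ac}{}_{be}`: the Weyl tensor with its last index lowered and its first pair raised. -/
def weylUp {D : ℕ} (g : Comp₂ D) (y : E D) (a c b e : Fin D) : ℝ :=
  ∑ k, ∑ l, ∑ d, (g y)⁻¹ a k * (g y)⁻¹ c l * weyl g y k l b d * g y d e

/-- `∇_b L_{ep}`. -/
def schoutenCov {D : ℕ} (g : Comp₂ D) (y : E D) (b e p : Fin D) : ℝ :=
  pd b (fun z => schouten g z e p) y
    - ∑ d, (christoffel g y d b e * schouten g y d p + christoffel g y d b p * schouten g y e d)

/-- `∇_{[b} L_{e]p} = (∇_b L_{ep} - ∇_e L_{bp}) / 2`. -/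
def cotton {D : ℕ} (g : Comp₂ D) (y : E D) (b e p : Fin D) : ℝ :=
  1 / 2 * (schoutenCov g y b e p - schoutenCov g y e b p)

/-! ### The Weyl endomorphism and its pseudo-inverse -/

/-- Components of bivectors: skew-symmetric arrays `ψ^{ab}`. -/
def Bivec (D : ℕ) : Submodule ℝ (Matrix (Fin D) (Fin D) ℝ) where
  carrier := {ψ | ∀ a b, ψ a b = -ψ b a}
  add_mem' := by
    intro φ ψ hφ hψ a b
    have h1 := hφ a b
    have h2 := hψ a b
    simp only [Matrix.add_apply]
    linarith
  zero_mem' := by intro a b; simp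
  smul_mem' := by
    intro r ψ hψ a b
    have h1 := hψ a b
    simp only [Matrix.smul_apply, smul_eq_mul]
    rw [h1]
    ring

theorem weyl_antisymm {D : ℕ} (g : Comp₂ D) (y : E D) (a b c d : Fin D) :
    weyl g y a b c d = -weyl g y b a c d := by
  simp only [weyl, riemann, Finset.sum_sub_distrib]
  ring

theorem weylUp_antisymm {D : ℕ} (g : Comp₂ D) (y : E D) (a c b e : Fin D) :
    weylUp g y a c b e = -weylUp g y c a b e := by
  simp only [weylUp]
  rw [Finset.sum_comm, ← Finset.sum_neg_distrib]
  refine Finset.sum_congr rfl fun k _ => ?_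
  rw [← Finset.sum_neg_distrib]
  refine Finset.sum_congr rfl fun l _ => ?_
  rw [← Finset.sum_neg_distrib]
  refine Finset.sum_congr rfl fun d _ => ?_
  rw [weyl_antisymm]
  ring

/-- The Weyl endomorphism `ψ^{be} ↦ C^{ac}{}_{be} ψ^{be}` of the space of bivectors. -/
def weylEnd {D : ℕ} (g : Comp₂ D) (y : E D) : Bivec D →ₗ[ℝ] Bivec D where
  toFun ψ := ⟨Matrix.of fun a c => ∑ b, ∑ e, weylUp g y a c b e * ψ.1 b e, by
    intro a c
    simp only [Matrix.of_apply]
    rw [← Finset.sum_neg_distrib]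
    refine Finset.sum_congr rfl fun b _ => ?_
    rw [← Finset.sum_neg_distrib]
    refine Finset.sum_congr rfl fun e _ => ?_
    rw [weylUp_antisymm]
    ring⟩
  map_add' φ ψ := by
    ext a c
    simp [mul_add, Finset.sum_add_distrib]
  map_smul' r ψ := by
    ext a c
    simp [Finset.mul_sum, mul_left_comm]

/-- Components `H_{abcd}` of a bilinear form on bivectors, acting by
`(φ, ψ) ↦ H_{abcd} φ^{ab} ψ^{cd}`. -/
def bivForm {D : ℕ} (H : Fin D → Fin D → Fin D → Fin D → ℝ) :
    LinearMap.BilinForm ℝ (Bivec D) :=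
  LinearMap.mk₂ ℝ (fun φ ψ => ∑ a, ∑ b, ∑ c, ∑ d, H a b c d * φ.1 a b * ψ.1 c d)
    (by intro φ φ' ψ; simp [mul_add, add_mul, Finset.sum_add_distrib])
    (by intro r φ ψ; simp [Finset.mul_sum, mul_left_comm, mul_assoc])
    (by intro φ ψ ψ'; simp [mul_add, Finset.sum_add_distrib])
    (by intro r φ ψ; simp [Finset.mul_sum, mul_left_comm])

/-- The bivector `(E_{pq} - E_{qp}) / 2`, with components `δ^a_{[p} δ^b_{q]}`. -/
def bivBasis {D : ℕ} (p q : Fin D) : Bivec D :=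
  ⟨Matrix.of fun a b => 1 / 2 * (kd a p * kd b q - kd b p * kd a q), by
    intro a b
    simp only [Matrix.of_apply]
    ring⟩

/-- Components `(W⁺)^{rs}{}_{pq}` (skew in both pairs) of the Moore–Penrose pseudo-inverse of the
Weyl endomorphism, i.e. `(W⁺ ψ)^{rs} = (W⁺)^{rs}{}_{pq} ψ^{pq}`.  The inner product on bivectors has
components `H`. -/
def weylPinv {D : ℕ} (g : Comp₂ D) (H : E D → Fin D → Fin D → Fin D → Fin D → ℝ) (y : E D)
    (r s p q : Fin D) : ℝ :=
  (moorePenrose (bivForm (H y)) (weylEnd g y) (bivBasis p q)).1 r s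

/-! ### The one-form `Λ^ξ` and the `𝒞^ξ`-connection in a chart -/

/-- `Λ^ξ_q = 4/(1-D) ∇_{[b} L_{e]p} g^{pr} (W⁺)^{be}{}_{rq}
  + 2/(1-D) (δ^m_{[p} δ^n_{q]} - C^{mn}{}_{rs} (W⁺)^{rs}{}_{pq}) ξ^p{}_{mn}`;
here `ξ y p m n` is `ξ^p{}_{mn}`. -/
def lambdaComp {D : ℕ} (g : Comp₂ D) (H : E D → Fin D → Fin D → Fin D → Fin D → ℝ)
    (ξ : E D → Fin D → Fin D → Fin D → ℝ) : Comp₁ D := fun y q =>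
  4 / (1 - (D : ℝ)) *
      ∑ b, ∑ e, ∑ p, ∑ r, cotton g y b e p * (g y)⁻¹ p r * weylPinv g H y b e r q
    + 2 / (1 - (D : ℝ)) *
      ∑ p, ∑ m, ∑ n,
        (1 / 2 * (kd m p * kd n q - kd m q * kd n p)
          - ∑ r, ∑ s, weylUp g y m n r s * weylPinv g H y r s p q) * ξ y p m n

/-- Coefficients of the connection
`𝒞_a v^c = ∇_a v^c + (-Λ_a δ^c_b - Λ_b δ^c_a + g_{ab} g^{cd} Λ_d) v^b`. -/
def cConn {D : ℕ} (g : Comp₂ D) (Λ : Comp₁ D) : ConnCoeff D := fun y c a b =>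
  christoffel g y c a b - Λ y a * kd c b - Λ y b * kd c a + g y a b * ∑ d, (g y)⁻¹ c d * Λ y d

/-! ### Tensor fields on a manifold and their components -/

section Manifold

/-- A (not necessarily smooth) field of covariant two-tensors. -/
abbrev Field₂ (D : ℕ) (M : Type*) [TopologicalSpace M] [ChartedSpace (E D) M] : Type _ :=
  ∀ x : M, TangentSpace 𝓘(ℝ, E D) x →L[ℝ] TangentSpace 𝓘(ℝ, E D) x →L[ℝ] ℝ

/-- A (not necessarily smooth) one-form. -/
abbrev Field₁ (D : ℕ) (M : Type*) [TopologicalSpace M] [ChartedSpace (E D) M] : Type _ :=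
  ∀ x : M, TangentSpace 𝓘(ℝ, E D) x →L[ℝ] ℝ

/-- The smooth charts of `M`. -/
abbrev charts (D : ℕ) (M : Type*) [TopologicalSpace M] [ChartedSpace (E D) M] :
    Set (OpenPartialHomeomorph M (E D)) :=
  IsManifold.maximalAtlas 𝓘(ℝ, E D) ∞ M

variable {D : ℕ} {M : Type*} [TopologicalSpace M] [ChartedSpace (E D) M]

/-- The coordinate vector field `∂_i` of the chart `e` at the point with coordinates `y`. -/
def coordVec (e : OpenPartialHomeomorph M (E D)) (y : E D) (i : Fin D) :
    TangentSpace 𝓘(ℝ, E D) (e.symm y) :=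
  mfderiv 𝓘(ℝ, E D) 𝓘(ℝ, E D) e.symm y (EuclideanSpace.single i (1 : ℝ) : E D)

/-- The coordinate differential `dx^k` of the chart `e` at the point `x`. -/
def coordCovec (e : OpenPartialHomeomorph M (E D)) (x : M) (k : Fin D) :
    TangentSpace 𝓘(ℝ, E D) x →L[ℝ] ℝ :=
  (EuclideanSpace.proj k : E D →L[ℝ] ℝ).comp (mfderiv 𝓘(ℝ, E D) 𝓘(ℝ, E D) e x)

/-- Components of a one-form in the chart `e`. -/
def comp₁ (η : Field₁ D M) (e : OpenPartialHomeomorph M (E D)) : Comp₁ D := fun y i =>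
  η (e.symm y) (coordVec e y i)

/-- Components of a covariant two-tensor in the chart `e`. -/
def comp₂ (T : Field₂ D M) (e : OpenPartialHomeomorph M (E D)) : Comp₂ D := fun y =>
  Matrix.of fun i j => T (e.symm y) (coordVec e y i) (coordVec e y j)

/-- A smooth pseudo-Riemannian metric (of any signature). -/
structure PseudoRiemannianMetric (D : ℕ) (M : Type*) [TopologicalSpace M] [ChartedSpace (E D) M] where
  val : Field₂ D M
  symm : ∀ x u v, val x u v = val x v u
  nondegenerate : ∀ x u, (∀ v, val x u v = 0) → u = 0
  smooth : ∀ e ∈ charts D M, ∀ i j, ContDiffOn ℝ ∞ (fun y => comp₂ val e y i j) e.target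

/-- A smooth tensor field `ξ^a{}_{bc} = ξ^a{}_{[bc]}`, as a vector-valued two-form. -/
structure VectorTwoForm (D : ℕ) (M : Type*) [TopologicalSpace M] [ChartedSpace (E D) M] where
  val : ∀ x : M, TangentSpace 𝓘(ℝ, E D) x →L[ℝ] TangentSpace 𝓘(ℝ, E D) x →L[ℝ]
    TangentSpace 𝓘(ℝ, E D) x
  skew : ∀ x u v, val x u v = -val x v u
  smooth : ∀ e ∈ charts D M, ∀ p m n, ContDiffOn ℝ ∞
    (fun y => coordCovec e (e.symm y) p (val (e.symm y) (coordVec e y m) (coordVec e y n)))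
    e.target

/-- Components `ξ^p{}_{mn}` in the chart `e`. -/
def VectorTwoForm.comp (ξ : VectorTwoForm D M) (e : OpenPartialHomeomorph M (E D)) (y : E D)
    (p m n : Fin D) : ℝ :=
  coordCovec e (e.symm y) p (ξ.val (e.symm y) (coordVec e y m) (coordVec e y n))

/-- A field of positive definite inner products on bivectors;
`val x u v w z` is the inner product of `u ∧ v` and `w ∧ z`.  It records which frames of the bundle
of bivectors count as orthonormal when the matrix pseudo-inverse is taken. -/
structure BivectorMetric (D : ℕ) (M : Type*) [TopologicalSpace M] [ChartedSpace (E D) M] where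
  val : ∀ x : M, TangentSpace 𝓘(ℝ, E D) x →ₗ[ℝ] TangentSpace 𝓘(ℝ, E D) x →ₗ[ℝ]
    TangentSpace 𝓘(ℝ, E D) x →ₗ[ℝ] TangentSpace 𝓘(ℝ, E D) x →ₗ[ℝ] ℝ
  skew : ∀ x u v w z, val x u v w z = -val x v u w z
  symm : ∀ x u v w z, val x u v w z = val x w z u v
  pos : ∀ (x : M) (b : Basis (Fin D) ℝ (TangentSpace 𝓘(ℝ, E D) x)) (ψ : Bivec D), ψ ≠ 0 →
    0 < bivForm (fun i j k l => val x (b i) (b j) (b k) (b l)) ψ ψ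

/-- Components of a bivector metric in the chart `e`. -/
def BivectorMetric.comp (h : BivectorMetric D M) (e : OpenPartialHomeomorph M (E D)) (y : E D)
    (i j k l : Fin D) : ℝ :=
  h.val (e.symm y) (coordVec e y i) (coordVec e y j) (coordVec e y k) (coordVec e y l)

/-- A one-form is smooth. -/
def SmoothForm (η : Field₁ D M) : Prop :=
  ∀ e ∈ charts D M, ∀ i, ContDiffOn ℝ ∞ (fun y => comp₁ η e y i) e.target

/-- A one-form is closed: `∂_i η_j = ∂_j η_i` in every chart. -/
def ClosedForm (η : Field₁ D M) : Prop :=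
  ∀ e ∈ charts D M, ∀ y ∈ e.target, ∀ i j,
    pd i (fun z => comp₁ η e z j) y = pd j (fun z => comp₁ η e z i) y

/-- The first de Rham cohomology of `M` vanishes: smooth closed one-forms are exact. -/
def TrivialH1 (D : ℕ) (M : Type*) [TopologicalSpace M] [ChartedSpace (E D) M] : Prop :=
  ∀ η : Field₁ D M, SmoothForm η → ClosedForm η →
    ∃ f : M → ℝ, ContMDiff 𝓘(ℝ, E D) 𝓘(ℝ) ∞ f ∧
      ∀ x v, η x v = mfderiv 𝓘(ℝ, E D) 𝓘(ℝ) f x v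

/-- The Weyl endomorphism of `g` is invertible (at every point). -/
def WeylInvertible (g : PseudoRiemannianMetric D M) : Prop :=
  ∀ e ∈ charts D M, ∀ y ∈ e.target, Function.Bijective (weylEnd (comp₂ g.val e) y)

/-- The compatibility condition
`C_{be}{}^{qp} (W⁺)_{qp}{}^{rs} ∇_{[r} L_{s]a} = ∇_{[b} L_{e]a}`, where
`C_{be}{}^{qp} = C^{qp}{}_{be}`, and `(W⁺)_{qp}{}^{rs}` stands for the entry `(W⁺)^{rs}{}_{qp}`. -/
def Compatible (g : PseudoRiemannianMetric D M) (h : BivectorMetric D M) : Prop :=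
  ∀ e ∈ charts D M, ∀ y ∈ e.target, ∀ b c a,
    ∑ q, ∑ p, ∑ r, ∑ s, weylUp (comp₂ g.val e) y q p b c *
        weylPinv (comp₂ g.val e) (h.comp e) y r s q p * cotton (comp₂ g.val e) y r s a
      = cotton (comp₂ g.val e) y b c a

/-- The one-form `Λ^ξ` on `M`.  Its value at `x` is computed in the preferred chart at `x`; any
other chart gives the same value, as `lambdaComp` is a tensorial expression. -/
def lambdaXi (g : PseudoRiemannianMetric D M) (h : BivectorMetric D M) (ξ : VectorTwoForm D M) :
    Field₁ D M := fun x =>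
  ∑ q, lambdaComp (comp₂ g.val (chartAt (E D) x)) (h.comp (chartAt (E D) x))
    (ξ.comp (chartAt (E D) x)) (chartAt (E D) x x) q • coordCovec (chartAt (E D) x) x q

/-- The Ricci tensor `ℛ` of the connection `𝒞` determined by `g` and `Λ` satisfies `ℛ_{[ab]} = 0`
and `ℛ_{(ab)} - (1/D) g_{ab} ℛ = 0`, where `ℛ = g^{ab} ℛ_{ab}`. -/
def CRicciSymmTraceFree (g : PseudoRiemannianMetric D M) (Λ : Field₁ D M) : Prop :=
  ∀ e ∈ charts D M, ∀ y ∈ e.target, ∀ a b,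
    1 / 2 * (ricci (cConn (comp₂ g.val e) (comp₁ Λ e)) y a b
        - ricci (cConn (comp₂ g.val e) (comp₁ Λ e)) y b a) = 0 ∧
    1 / 2 * (ricci (cConn (comp₂ g.val e) (comp₁ Λ e)) y a b
        + ricci (cConn (comp₂ g.val e) (comp₁ Λ e)) y b a)
      - 1 / (D : ℝ) * comp₂ g.val e y a b *
        traceWith (comp₂ g.val e) (ricci (cConn (comp₂ g.val e) (comp₁ Λ e))) y = 0

/-- The condition on `ξ`: the one-form `Λ^ξ` is smooth and closed, and the Ricci tensor of the
`𝒞^ξ`-connection is symmetric with vanishing trace-free part. -/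
def XiCondition (g : PseudoRiemannianMetric D M) (h : BivectorMetric D M) (ξ : VectorTwoForm D M) : Prop :=
  SmoothForm (lambdaXi g h ξ) ∧ ClosedForm (lambdaXi g h ξ) ∧
    CRicciSymmTraceFree g (lambdaXi g h ξ)

/-- On the open set `U`, `Ω` is smooth and positive and the metric `g̃ = Ω⁻² g` (so `g = Ω² g̃`) is an
Einstein metric: `Ric(g̃) = κ g̃` for a constant `κ`. -/
def IsEinsteinFactorOn (g : PseudoRiemannianMetric D M) (U : Set M) (Ω : M → ℝ) : Prop :=
  ContMDiffOn 𝓘(ℝ, E D) 𝓘(ℝ) ∞ Ω U ∧ (∀ x ∈ U, 0 < Ω x) ∧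
    ∃ κ : ℝ, ∀ e ∈ charts D M, ∀ y ∈ e.target, e.symm y ∈ U →
      ricci (christoffel (comp₂ (fun x => (Ω x ^ 2)⁻¹ • g.val x) e)) y
        = κ • comp₂ (fun x => (Ω x ^ 2)⁻¹ • g.val x) e y

/-- `g` is (globally) conformal to an Einstein metric. -/
def ConformallyEinstein (g : PseudoRiemannianMetric D M) : Prop :=
  ∃ Ω : M → ℝ, IsEinsteinFactorOn g Set.univ Ω

end Manifold

end

end ConfEinstein

open ConfEinstein

/-!
The theorem compares two one-forms: the form `Λ^ξ`, which is built from `g` and `ξ` alone, and the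
logarithmic derivative `Υ = d log Ω` of a conformal factor for which `Ω⁻² g` is Einstein.

The `𝒞`-connection of `d log Ω` is torsion-free and parallelizes `Ω⁻² g`, so it is the Levi-Civita
connection of that metric (`MetricOn.christoffel_conformal`).  Hence the condition on the Ricci
tensor of the `𝒞`-connection says that `Ric(Ω⁻² g)` is pointwise proportional to `Ω⁻² g`.

*From an Einstein scale to `ξ`.*  Tracing the formula for the Ricci tensor of the `𝒞`-connection
(`MetricOn.ricci_cConn`) turns the Einstein equation into
`L_{ab} = -∇_a Υ_b - Υ_a Υ_b + σ g_{ab}` with an explicit function `σ`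
(`MetricOn.schouten_of_einstein`).  Skew-symmetrizing one more derivative of this equation gives
`∇_{[b} L_{e]p} = -½ C_{bep}{}^d Υ_d` (`MetricOn.cotton_of_einstein`).  For
`ξ^p{}_{mn} = -δ^p{}_{[m} Υ_{n]}` the identity part of the second summand of `Λ^ξ` contributes
exactly `Υ`, and its part `C W⁺` cancels the first summand by the pair symmetry of the Weyl tensor;
so `Λ^ξ = Υ` (`MetricOn.lambdaComp_of_einstein`).  This cancellation holds with any endomorphism in
place of `W⁺`.

*From `ξ` to an Einstein scale.*  A closed form `Λ^ξ` is locally `df` by the Poincaré lemma, and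
`Ω = exp f` makes `Ric(Ω⁻² g)` proportional to `Ω⁻² g` in a chart.  Schur's lemma
(`MetricOn.schur`), obtained from the twice contracted differential Bianchi identity, shows that
the factor is constant on a coordinate ball.  Since the Ricci tensor is natural under changes of
coordinates (`ricci_pullback`), the Einstein equation with this constant holds in every chart.  If
`f` exists globally, the constants of overlapping neighbourhoods agree because the metric does not
vanish, and connectedness of `M` makes them one constant
(`conformallyEinstein_of_primitive`).

Curvature is handled as the curvature `F_{ab} = ∂_a A_b - ∂_b A_a + [A_a, A_b]` of the matrix-valued
one-form of Christoffel symbols: the differential Bianchi identity, the skew symmetry with respect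
to the metric, and the behaviour under a change of coordinates (a pullback followed by a gauge
transformation) become identities of matrices.
-/

namespace ConfEinstein

open Matrix Topology

/-! ### Partial derivatives -/

section Calculus

variable {D : ℕ} {S : Set (E D)} {y : E D} {f f₁ f₂ : E D → ℝ}

theorem differentiableAt_of_contDiffOn (hS : IsOpen S) (hf : ContDiffOn ℝ ∞ f S) (hy : y ∈ S) :
    DifferentiableAt ℝ f y :=
  (hf.contDiffAt (hS.mem_nhds hy)).differentiableAt (by simp)

theorem contDiffOn_pd (hS : IsOpen S) (i : Fin D) (hf : ContDiffOn ℝ ∞ f S) :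
    ContDiffOn ℝ ∞ (pd i f) S :=
  (hf.fderiv_of_isOpen hS (m := ∞) (by simp)).clm_apply contDiffOn_const

theorem pd_congr (hS : IsOpen S) (hy : y ∈ S) (h : ∀ z ∈ S, f₁ z = f₂ z) (i : Fin D) :
    pd i f₁ y = pd i f₂ y := by
  have : f₁ =ᶠ[𝓝 y] f₂ := Filter.eventuallyEq_of_mem (hS.mem_nhds hy) h
  simp only [pd, this.fderiv_eq]

@[simp] theorem pd_const (i : Fin D) (c : ℝ) : pd i (fun _ => c) y = 0 := by
  simp [pd]

theorem pd_add (h₁ : DifferentiableAt ℝ f₁ y) (h₂ : DifferentiableAt ℝ f₂ y) (i : Fin D) :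
    pd i (fun z => f₁ z + f₂ z) y = pd i f₁ y + pd i f₂ y := by
  simp [pd, fderiv_fun_add h₁ h₂]

theorem pd_sub (h₁ : DifferentiableAt ℝ f₁ y) (h₂ : DifferentiableAt ℝ f₂ y) (i : Fin D) :
    pd i (fun z => f₁ z - f₂ z) y = pd i f₁ y - pd i f₂ y := by
  simp [pd, fderiv_fun_sub h₁ h₂]

theorem pd_mul (h₁ : DifferentiableAt ℝ f₁ y) (h₂ : DifferentiableAt ℝ f₂ y) (i : Fin D) :
    pd i (fun z => f₁ z * f₂ z) y = pd i f₁ y * f₂ y + f₁ y * pd i f₂ y := by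
  simp [pd, fderiv_fun_mul h₁ h₂]
  ring

theorem pd_const_mul (h₁ : DifferentiableAt ℝ f y) (c : ℝ) (i : Fin D) :
    pd i (fun z => c * f z) y = c * pd i f y := by
  rw [pd_mul (differentiableAt_const c) h₁]; simp

theorem pd_neg (i : Fin D) :
    pd i (fun z => -f z) y = -pd i f y := by
  simp [pd, fderiv_fun_neg]

theorem pd_sum {ι : Type*} {s : Finset ι} {F : ι → E D → ℝ}
    (h : ∀ k ∈ s, DifferentiableAt ℝ (F k) y) (i : Fin D) :
    pd i (fun z => ∑ k ∈ s, F k z) y = ∑ k ∈ s, pd i (F k) y := by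
  simp [pd, fderiv_fun_sum h]

theorem pd_comm (hS : IsOpen S) (hf : ContDiffOn ℝ ∞ f S) (hy : y ∈ S) (i j : Fin D) :
    pd i (pd j f) y = pd j (pd i f) y := by
  have hc := hf.contDiffAt (hS.mem_nhds hy)
  have hd : DifferentiableAt ℝ (fderiv ℝ f) y :=
    (hc.fderiv_right (m := ∞) (by simp)).differentiableAt (by simp)
  have hsym := hc.isSymmSndFDerivAt (by simpa using ENat.LEInfty.out)
  have key : ∀ a b : Fin D, pd a (pd b f) y
      = fderiv ℝ (fderiv ℝ f) y (EuclideanSpace.single a 1) (EuclideanSpace.single b 1) := by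
    intro a b
    change fderiv ℝ (fun z => fderiv ℝ f z (EuclideanSpace.single b 1)) y _ = _
    rw [fderiv_clm_apply hd (differentiableAt_const _)]
    simp
  rw [key, key]
  exact hsym.eq _ _

/-- The chain rule in coordinates. -/
theorem pd_comp {φ : E D → E D} (hf : DifferentiableAt ℝ f (φ y)) (hφ : DifferentiableAt ℝ φ y)
    (i : Fin D) :
    pd i (fun z => f (φ z)) y = ∑ k, pd k f (φ y) * pd i (fun z => φ z k) y := by
  have h1 : fderiv ℝ (fun z => f (φ z)) y = (fderiv ℝ f (φ y)).comp (fderiv ℝ φ y) :=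
    fderiv_comp y hf hφ
  have h2 : ∀ k, pd i (fun z => φ z k) y = fderiv ℝ φ y (EuclideanSpace.single i 1) k := by
    intro k
    have : fderiv ℝ (fun z => φ z k) y
        = (EuclideanSpace.proj k : E D →L[ℝ] ℝ).comp (fderiv ℝ φ y) :=
      ((EuclideanSpace.proj k : E D →L[ℝ] ℝ).hasFDerivAt.comp y hφ.hasFDerivAt).fderiv
    simp [pd, this]
  have h3 : ∀ v : E D, v = ∑ k, v k • EuclideanSpace.single k (1 : ℝ) := by
    intro v
    ext j
    simp [Finset.sum_apply, Pi.single_apply]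
  simp only [h2]
  simp only [pd, h1, ContinuousLinearMap.comp_apply]
  conv_lhs => rw [h3 (fderiv ℝ φ y _)]
  simp [map_sum, mul_comm]

end Calculus

/-! ### Matrix-valued functions -/

section MatrixCalculus

variable {D : ℕ} {S : Set (E D)} {y : E D} {N N₁ N₂ : E D → Matrix (Fin D) (Fin D) ℝ}

/-- Smoothness of a matrix-valued function, entry by entry. -/
def SmoothMat (S : Set (E D)) (N : E D → Matrix (Fin D) (Fin D) ℝ) : Prop :=
  ∀ i j, ContDiffOn ℝ ∞ (fun z => N z i j) S

/-- Entrywise partial derivative of a matrix-valued function. -/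
noncomputable def pdMat (a : Fin D) (N : E D → Matrix (Fin D) (Fin D) ℝ) (y : E D) :
    Matrix (Fin D) (Fin D) ℝ :=
  Matrix.of fun i j => pd a (fun z => N z i j) y

theorem pdMat_apply (a i j : Fin D) : pdMat a N y i j = pd a (fun z => N z i j) y := rfl

theorem SmoothMat.mul (h₁ : SmoothMat S N₁) (h₂ : SmoothMat S N₂) :
    SmoothMat S (fun z => N₁ z * N₂ z) := by
  intro i j
  simp only [Matrix.mul_apply]
  exact ContDiffOn.sum fun k _ => (h₁ i k).mul (h₂ k j)

theorem SmoothMat.add (h₁ : SmoothMat S N₁) (h₂ : SmoothMat S N₂) :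
    SmoothMat S (fun z => N₁ z + N₂ z) := fun i j => (h₁ i j).add (h₂ i j)

theorem SmoothMat.sub (h₁ : SmoothMat S N₁) (h₂ : SmoothMat S N₂) :
    SmoothMat S (fun z => N₁ z - N₂ z) := fun i j => (h₁ i j).sub (h₂ i j)

theorem SmoothMat.transpose (h : SmoothMat S N) : SmoothMat S (fun z => (N z)ᵀ) :=
  fun i j => h j i

theorem SmoothMat.pdMat (hS : IsOpen S) (h : SmoothMat S N) (a : Fin D) :
    SmoothMat S (pdMat a N) := fun i j => contDiffOn_pd hS a (h i j)

theorem SmoothMat.differentiableAt (h : SmoothMat S N) (hS : IsOpen S) (hy : y ∈ S)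
    (i j : Fin D) : DifferentiableAt ℝ (fun z => N z i j) y :=
  differentiableAt_of_contDiffOn hS (h i j) hy

theorem SmoothMat.det (h : SmoothMat S N) : ContDiffOn ℝ ∞ (fun z => (N z).det) S := by
  simp only [Matrix.det_apply']
  refine ContDiffOn.sum fun σ _ => contDiffOn_const.mul ?_
  exact contDiffOn_prod fun i _ => h _ _

theorem SmoothMat.inv (h : SmoothMat S N) (hdet : ∀ z ∈ S, (N z).det ≠ 0) :
    SmoothMat S (fun z => (N z)⁻¹) := by
  intro i j
  simp only [Matrix.inv_def, Ring.inverse_eq_inv', Matrix.smul_apply, smul_eq_mul]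
  refine (h.det.inv hdet).mul ?_
  simp only [Matrix.adjugate_apply]
  refine SmoothMat.det (N := fun z => (N z).updateRow j (Pi.single i 1)) ?_
  intro k l
  by_cases hk : k = j
  · subst hk
    simpa using contDiffOn_const
  · simpa [Matrix.updateRow_ne hk] using h k l

theorem pdMat_congr (hS : IsOpen S) (hy : y ∈ S) (h : ∀ z ∈ S, N₁ z = N₂ z) (a : Fin D) :
    pdMat a N₁ y = pdMat a N₂ y := by
  ext i j
  exact pd_congr hS hy (fun z hz => by rw [h z hz]) a

theorem pdMat_add (h₁ : SmoothMat S N₁) (h₂ : SmoothMat S N₂) (hS : IsOpen S) (hy : y ∈ S)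
    (a : Fin D) : pdMat a (fun z => N₁ z + N₂ z) y = pdMat a N₁ y + pdMat a N₂ y := by
  ext i j
  exact pd_add (h₁.differentiableAt hS hy i j) (h₂.differentiableAt hS hy i j) a

theorem pdMat_sub (h₁ : SmoothMat S N₁) (h₂ : SmoothMat S N₂) (hS : IsOpen S) (hy : y ∈ S)
    (a : Fin D) : pdMat a (fun z => N₁ z - N₂ z) y = pdMat a N₁ y - pdMat a N₂ y := by
  ext i j
  exact pd_sub (h₁.differentiableAt hS hy i j) (h₂.differentiableAt hS hy i j) a

theorem pdMat_mul (h₁ : SmoothMat S N₁) (h₂ : SmoothMat S N₂) (hS : IsOpen S) (hy : y ∈ S)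
    (a : Fin D) :
    pdMat a (fun z => N₁ z * N₂ z) y = pdMat a N₁ y * N₂ y + N₁ y * pdMat a N₂ y := by
  ext i j
  simp only [pdMat_apply, Matrix.mul_apply, Matrix.add_apply]
  rw [pd_sum fun k _ => (h₁.differentiableAt hS hy i k).fun_mul (h₂.differentiableAt hS hy k j),
    ← Finset.sum_add_distrib]
  refine Finset.sum_congr rfl fun k _ => ?_
  exact pd_mul (h₁.differentiableAt hS hy i k) (h₂.differentiableAt hS hy k j) a

theorem pdMat_transpose (a : Fin D) : pdMat a (fun z => (N z)ᵀ) y = (pdMat a N y)ᵀ := rfl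

theorem pdMat_comm (hS : IsOpen S) (h : SmoothMat S N) (hy : y ∈ S) (a b : Fin D) :
    pdMat a (pdMat b N) y = pdMat b (pdMat a N) y := by
  ext i j
  exact pd_comm hS (h i j) hy a b

end MatrixCalculus

/-! ### Curvature as a matrix-valued two-form -/

section Curvature

variable {D : ℕ} {S : Set (E D)} {y : E D}

/-- The matrices `(A_a)^d{}_c = G^d_{ac}` of a connection. -/
def connMat (G : ConnCoeff D) (a : Fin D) (y : E D) : Matrix (Fin D) (Fin D) ℝ :=
  Matrix.of fun d c => G y d a c

/-- The curvature `F_{ab} = ∂_a A_b - ∂_b A_a + A_a A_b - A_b A_a` of a matrix-valued one-form. -/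
noncomputable def curvMat (A : Fin D → E D → Matrix (Fin D) (Fin D) ℝ) (a b : Fin D) (y : E D) :
    Matrix (Fin D) (Fin D) ℝ :=
  pdMat a (A b) y - pdMat b (A a) y + A a y * A b y - A b y * A a y

/-- In the convention of `riemann` the form indices are reversed: `R_{abc}{}^d = (F_{ba})^d{}_c`. -/
theorem riemann_eq_curvMat (G : ConnCoeff D) (y : E D) (a b c d : Fin D) :
    riemann G y a b c d = curvMat (connMat G) b a y d c := by
  simp only [riemann, curvMat, Matrix.sub_apply, Matrix.add_apply, Matrix.mul_apply, pdMat_apply,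
    connMat, Matrix.of_apply, Finset.sum_sub_distrib]
  simp only [mul_comm (G y _ a c), mul_comm (G y _ b c)]
  ring

theorem curvMat_skew (A : Fin D → E D → Matrix (Fin D) (Fin D) ℝ) (a b : Fin D) (y : E D) :
    curvMat A a b y = -curvMat A b a y := by
  simp only [curvMat]; abel

variable {A : Fin D → E D → Matrix (Fin D) (Fin D) ℝ}

theorem smoothMat_curvMat (hS : IsOpen S) (hA : ∀ a, SmoothMat S (A a)) (a b : Fin D) :
    SmoothMat S (curvMat A a b) :=
  ((((hA b).pdMat hS a).sub ((hA a).pdMat hS b)).add ((hA a).mul (hA b))).sub ((hA b).mul (hA a))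

theorem pdMat_curvMat (hS : IsOpen S) (hA : ∀ a, SmoothMat S (A a)) (hy : y ∈ S) (e a b : Fin D) :
    pdMat e (curvMat A a b) y = pdMat e (pdMat a (A b)) y - pdMat e (pdMat b (A a)) y
      + (pdMat e (A a) y * A b y + A a y * pdMat e (A b) y)
      - (pdMat e (A b) y * A a y + A b y * pdMat e (A a) y) := by
  have s1 := ((hA b).pdMat hS a)
  have s2 := ((hA a).pdMat hS b)
  have h := pdMat_sub ((s1.sub s2).add ((hA a).mul (hA b))) ((hA b).mul (hA a)) hS hy e
  rw [pdMat_add (s1.sub s2) ((hA a).mul (hA b)) hS hy, pdMat_sub s1 s2 hS hy,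
    pdMat_mul (hA a) (hA b) hS hy, pdMat_mul (hA b) (hA a) hS hy] at h
  exact h

/-- The differential Bianchi identity `∇_{[e} F_{ba]} = 0`.  Only the matrix indices are
differentiated covariantly, so it holds for any matrix-valued one-form. -/
theorem bianchi_differential (hS : IsOpen S) (hA : ∀ a, SmoothMat S (A a)) (hy : y ∈ S)
    (e a b : Fin D) :
    (pdMat e (curvMat A b a) y + (A e y * curvMat A b a y - curvMat A b a y * A e y))
    + (pdMat b (curvMat A a e) y + (A b y * curvMat A a e y - curvMat A a e y * A b y))
    + (pdMat a (curvMat A e b) y + (A a y * curvMat A e b y - curvMat A e b y * A a y)) = 0 := by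
  rw [pdMat_curvMat hS hA hy, pdMat_curvMat hS hA hy, pdMat_curvMat hS hA hy,
    pdMat_comm hS (hA a) hy e b, pdMat_comm hS (hA b) hy e a, pdMat_comm hS (hA e) hy b a]
  simp only [curvMat]
  noncomm_ring

/-- The algebraic Bianchi identity `F_{[ab}{}^d{}_{c]} = 0` for a torsion-free connection. -/
theorem bianchi_algebraic (G : ConnCoeff D) (hS : IsOpen S) (hy : y ∈ S)
    (hG : ∀ z ∈ S, ∀ c a b, G z c a b = G z c b a) (a b c d : Fin D) :
    curvMat (connMat G) a b y d c + curvMat (connMat G) b c y d a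
      + curvMat (connMat G) c a y d b = 0 := by
  have h : ∀ i d k l : Fin D, pd i (fun z => G z d k l) y = pd i (fun z => G z d l k) y :=
    fun i d k l => pd_congr hS hy (fun z hz => hG z hz d k l) i
  simp only [curvMat, Matrix.sub_apply, Matrix.add_apply, Matrix.mul_apply, pdMat_apply,
    connMat, Matrix.of_apply]
  rw [h a d c b, h b d c a, h c d b a]
  simp only [hG y hy _ c b, hG y hy _ c a, hG y hy _ b a]
  ring

end Curvature

/-! ### The Levi-Civita connection in a chart -/

section LeviCivita

variable {D : ℕ} {S : Set (E D)} {y : E D} {g : Comp₂ D} {G : ConnCoeff D}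

/-- `g` restricts to the components of a smooth pseudo-Riemannian metric on the open set `S`. -/
structure MetricOn (S : Set (E D)) (g : Comp₂ D) : Prop where
  isOpen : IsOpen S
  smooth : SmoothMat S g
  symm : ∀ z ∈ S, (g z)ᵀ = g z
  det_ne : ∀ z ∈ S, (g z).det ≠ 0

/-- `G` is torsion-free and parallelizes `g` on `S`: it is the Levi-Civita connection. -/
structure IsLeviCivitaOn (S : Set (E D)) (g : Comp₂ D) (G : ConnCoeff D) : Prop where
  torsionFree : ∀ z ∈ S, ∀ c a b, G z c a b = G z c b a
  compat : ∀ z ∈ S, ∀ a, pdMat a g z = (connMat G a z)ᵀ * g z + g z * connMat G a z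

namespace MetricOn

theorem symm' (hg : MetricOn S g) (hy : y ∈ S) (a b : Fin D) : g y a b = g y b a :=
  congrFun (congrFun (hg.symm y hy) b) a

theorem mul_inv (hg : MetricOn S g) (hy : y ∈ S) : g y * (g y)⁻¹ = 1 :=
  Matrix.mul_nonsing_inv _ (hg.det_ne y hy).isUnit

theorem inv_mul (hg : MetricOn S g) (hy : y ∈ S) : (g y)⁻¹ * g y = 1 :=
  Matrix.nonsing_inv_mul _ (hg.det_ne y hy).isUnit

theorem inv_transpose (hg : MetricOn S g) (hy : y ∈ S) : ((g y)⁻¹)ᵀ = (g y)⁻¹ := by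
  rw [Matrix.transpose_nonsing_inv, hg.symm y hy]

theorem inv_symm (hg : MetricOn S g) (hy : y ∈ S) (a b : Fin D) :
    (g y)⁻¹ a b = (g y)⁻¹ b a :=
  congrFun (congrFun (hg.inv_transpose hy) b) a

theorem sum_inv_mul (hg : MetricOn S g) (hy : y ∈ S) (a c : Fin D) :
    ∑ b, (g y)⁻¹ a b * g y b c = kd a c := by
  rw [← Matrix.mul_apply, hg.inv_mul hy]
  simp [Matrix.one_apply, kd]

theorem sum_mul_inv (hg : MetricOn S g) (hy : y ∈ S) (a c : Fin D) :
    ∑ b, g y a b * (g y)⁻¹ b c = kd a c := by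
  rw [← Matrix.mul_apply, hg.mul_inv hy]
  simp [Matrix.one_apply, kd]

theorem smooth_inv (hg : MetricOn S g) : SmoothMat S (fun z => (g z)⁻¹) :=
  hg.smooth.inv hg.det_ne

theorem mono (hg : MetricOn S g) {T : Set (E D)} (hT : IsOpen T) (h : T ⊆ S) : MetricOn T g where
  isOpen := hT
  smooth i j := (hg.smooth i j).mono h
  symm z hz := hg.symm z (h hz)
  det_ne z hz := hg.det_ne z (h hz)

theorem smooth_christoffel (hg : MetricOn S g) (a : Fin D) :
    SmoothMat S (connMat (christoffel g) a) := by
  intro d c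
  have h := fun i k l => contDiffOn_pd hg.isOpen i (hg.smooth k l)
  have h' := hg.smooth_inv
  simp only [connMat, christoffel, Matrix.of_apply]
  exact contDiffOn_const.mul (ContDiffOn.sum fun k _ => (h' d k).mul
    (((h a c k).add (h c a k)).sub (h k a c)))

theorem isLeviCivitaOn_christoffel (hg : MetricOn S g) : IsLeviCivitaOn S g (christoffel g) := by
  have hsym : ∀ z ∈ S, ∀ i a b, pd i (fun x => g x a b) z = pd i (fun x => g x b a) z :=
    fun z hz i a b => pd_congr hg.isOpen hz (fun x hx => hg.symm' hx a b) i
  -- the Christoffel symbols of the first kind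
  have low : ∀ z ∈ S, ∀ d a b, ∑ c, g z d c * christoffel g z c a b =
      1 / 2 * (pd a (fun x => g x b d) z + pd b (fun x => g x a d) z
        - pd d (fun x => g x a b) z) := by
    intro z hz d a b
    set X : Fin D → ℝ := fun k => pd a (fun x => g x b k) z + pd b (fun x => g x a k) z
        - pd k (fun x => g x a b) z
    have h1 : ∀ c, christoffel g z c a b = 1 / 2 * ((g z)⁻¹ *ᵥ X) c := fun c => rfl
    have h2 : g z *ᵥ ((g z)⁻¹ *ᵥ X) = X := by
      rw [Matrix.mulVec_mulVec, hg.mul_inv hz, Matrix.one_mulVec]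
    have h3 := congrFun h2 d
    simp only [h1]
    change _ = 1 / 2 * X d
    rw [← h3, Matrix.mulVec, dotProduct, Finset.mul_sum]
    exact Finset.sum_congr rfl fun c _ => by ring
  refine ⟨?_, ?_⟩
  · intro z hz c a b
    simp only [christoffel]
    congr 1
    refine Finset.sum_congr rfl fun d _ => ?_
    rw [hsym z hz d a b]
    ring
  · intro z hz a
    ext b c
    rw [Matrix.add_apply, Matrix.mul_apply, Matrix.mul_apply]
    simp only [connMat, Matrix.transpose_apply, Matrix.of_apply]
    rw [low z hz b a c]
    have : ∑ x, christoffel g z x a b * g z x c = ∑ x, g z c x * christoffel g z x a b :=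
      Finset.sum_congr rfl fun x _ => by rw [hg.symm' hz x c]; ring
    rw [this, low z hz c a b, pdMat_apply, hsym z hz a c b, hsym z hz c a b]
    rw [hsym z hz b a c]
    ring

end MetricOn

/-- Uniqueness of the Levi-Civita connection, at a point. -/
theorem IsLeviCivitaOn.eq_christoffel (hG : IsLeviCivitaOn S g G) (hg : MetricOn S g) (hy : y ∈ S)
    (c a b : Fin D) : G y c a b = christoffel g y c a b := by
  have hc : ∀ a b c, pd a (fun x => g x b c) y
      = ∑ x, G y x a b * g y x c + ∑ x, g y b x * G y x a c := by
    intro a b c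
    have h := congrFun (congrFun (hG.compat y hy a) b) c
    rw [Matrix.add_apply, Matrix.mul_apply, Matrix.mul_apply] at h
    exact h
  have hX : ∀ k, pd a (fun x => g x b k) y + pd b (fun x => g x a k) y
        - pd k (fun x => g x a b) y = 2 * (g y *ᵥ fun x => G y x a b) k := by
    intro k
    rw [hc, hc, hc, Matrix.mulVec, dotProduct, two_mul]
    simp only [hG.torsionFree y hy _ b a, hG.torsionFree y hy _ k a, hG.torsionFree y hy _ k b,
      hg.symm' hy _ k, hg.symm' hy _ b, mul_comm (G y _ a b), mul_comm (G y _ a k)]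
    ring
  simp only [christoffel, hX]
  have h2 : (g y)⁻¹ *ᵥ (g y *ᵥ fun x => G y x a b) = fun x => G y x a b := by
    rw [Matrix.mulVec_mulVec, hg.inv_mul hy, Matrix.one_mulVec]
  have h3 := congrFun h2 c
  rw [← h3, Matrix.mulVec, dotProduct, Finset.mul_sum]
  exact Finset.sum_congr rfl fun x _ => by ring

end LeviCivita

/-! ### Symmetries of the curvature tensor -/

section Symmetries

variable {D : ℕ} {S : Set (E D)} {y : E D} {g : Comp₂ D}

/-- The curvature matrices of the Levi-Civita connection. -/
noncomputable abbrev lcCurv (g : Comp₂ D) (a b : Fin D) (y : E D) : Matrix (Fin D) (Fin D) ℝ :=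
  curvMat (connMat (christoffel g)) a b y

namespace MetricOn

/-- The curvature is skew with respect to the metric: differentiate `∂g = Aᵀ g + g A` once more. -/
theorem curv_skew_metric (hg : MetricOn S g) (hy : y ∈ S) (a b : Fin D) :
    (lcCurv g a b y)ᵀ * g y + g y * lcCurv g a b y = 0 := by
  have hS := hg.isOpen
  have hA := hg.smooth_christoffel
  have hc := hg.isLeviCivitaOn_christoffel.compat
  set A := connMat (christoffel g) with hAdef
  -- the second derivatives of `g`, which commute
  have second : ∀ a b, pdMat a (pdMat b g) y =
      ((pdMat a (A b) y)ᵀ * g y + (A b y)ᵀ * ((A a y)ᵀ * g y + g y * A a y))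
        + (((A a y)ᵀ * g y + g y * A a y) * A b y + g y * pdMat a (A b) y) := by
    intro a b
    rw [pdMat_congr hS hy (fun z hz => hc z hz b) a,
      pdMat_add ((hA b).transpose.mul hg.smooth) (hg.smooth.mul (hA b)) hS hy,
      pdMat_mul (hA b).transpose hg.smooth hS hy, pdMat_mul hg.smooth (hA b) hS hy,
      pdMat_transpose, hc y hy a]
  have h := pdMat_comm hS hg.smooth hy a b
  rw [second, second] at h
  rw [← sub_eq_zero] at h
  rw [← h]
  simp only [lcCurv, curvMat, ← hAdef, Matrix.transpose_sub, Matrix.transpose_add,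
    Matrix.transpose_mul]
  noncomm_ring

theorem pdMat_inv (hg : MetricOn S g) (hy : y ∈ S) (a : Fin D) :
    pdMat a (fun z => (g z)⁻¹) y = -(connMat (christoffel g) a y * (g y)⁻¹
      + (g y)⁻¹ * (connMat (christoffel g) a y)ᵀ) := by
  have h1 : pdMat a (fun z => (g z)⁻¹ * g z) y = 0 := by
    rw [pdMat_congr hg.isOpen hy (N₂ := fun _ => 1) (fun z hz => hg.inv_mul hz)]
    ext i j
    simp [pdMat_apply]
  rw [pdMat_mul hg.smooth_inv hg.smooth hg.isOpen hy,
    hg.isLeviCivitaOn_christoffel.compat y hy a] at h1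
  have h2 := congrArg (· * (g y)⁻¹) h1
  simp only [add_mul, mul_add, zero_mul, Matrix.mul_assoc] at h2
  rw [hg.mul_inv hy, ← Matrix.mul_assoc (g y)⁻¹ (g y), hg.inv_mul hy] at h2
  simp only [mul_one, one_mul] at h2
  rw [eq_neg_iff_add_eq_zero, ← h2]
  abel

end MetricOn

/-- The curvature tensor `R_{abcd}` with its last index lowered. -/
noncomputable def riemLow (g : Comp₂ D) (y : E D) (a b c d : Fin D) : ℝ :=
  (g y * lcCurv g b a y) d c

/-- A tensor with the skew symmetries and the first Bianchi identity is symmetric in pairs. -/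
theorem pair_symm {ι : Type*} (R : ι → ι → ι → ι → ℝ) (h1 : ∀ a b c d, R a b c d = -R b a c d)
    (h2 : ∀ a b c d, R a b c d = -R a b d c)
    (h3 : ∀ a b c d, R a b c d + R b c a d + R c a b d = 0) (a b c d : ι) :
    R a b c d = R c d a b := by
  linarith [h3 a b c d, h3 b c d a, h3 c d a b, h3 d a b c, h2 b c d a, h2 c d b a, h2 d a c b,
    h2 a b d c, h1 c a b d, h2 a c b d, h1 d b c a, h2 b d c a]

namespace MetricOn

theorem riemLow_eq (hg : MetricOn S g) (hy : y ∈ S) (a b c d : Fin D) :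
    riemLow g y a b c d = ∑ k, riemann (christoffel g) y a b c k * g y k d := by
  rw [riemLow, Matrix.mul_apply]
  refine Finset.sum_congr rfl fun k _ => ?_
  rw [riemann_eq_curvMat, hg.symm' hy d k, mul_comm]

theorem riemLow_skew_left (g : Comp₂ D) (y : E D) (a b c d : Fin D) :
    riemLow g y a b c d = -riemLow g y b a c d := by
  rw [riemLow, riemLow, lcCurv, lcCurv, curvMat_skew]
  simp

theorem riemLow_skew_right (hg : MetricOn S g) (hy : y ∈ S) (a b c d : Fin D) :
    riemLow g y a b c d = -riemLow g y a b d c := by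
  have h := congrFun (congrFun (hg.curv_skew_metric hy b a) d) c
  have h2 : ((lcCurv g b a y)ᵀ * g y) d c = (g y * lcCurv g b a y) c d := by
    conv_lhs => rw [← hg.symm y hy]
    rw [← Matrix.transpose_mul, Matrix.transpose_apply]
  rw [Matrix.add_apply, h2] at h
  simp only [riemLow]
  simp only [Matrix.zero_apply] at h
  linarith

theorem riemLow_cyclic (hg : MetricOn S g) (hy : y ∈ S) (a b c d : Fin D) :
    riemLow g y a b c d + riemLow g y b c a d + riemLow g y c a b d = 0 := by
  simp only [riemLow, Matrix.mul_apply]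
  rw [← Finset.sum_add_distrib, ← Finset.sum_add_distrib]
  refine Finset.sum_eq_zero fun k _ => ?_
  have h := bianchi_algebraic (christoffel g) hg.isOpen hy
    (hg.isLeviCivitaOn_christoffel.torsionFree) b a c k
  rw [← mul_add, ← mul_add]
  have : lcCurv g b a y k c + lcCurv g c b y k a + lcCurv g a c y k b = 0 := by
    linarith
  rw [this, mul_zero]

theorem riemLow_pair (hg : MetricOn S g) (hy : y ∈ S) (a b c d : Fin D) :
    riemLow g y a b c d = riemLow g y c d a b :=
  pair_symm (riemLow g y) (riemLow_skew_left g y) (hg.riemLow_skew_right hy)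
    (hg.riemLow_cyclic hy) a b c d

theorem riemann_eq_riemLow (hg : MetricOn S g) (hy : y ∈ S) (a b c d : Fin D) :
    riemann (christoffel g) y a b c d = ∑ k, (g y)⁻¹ d k * riemLow g y a b c k := by
  have h : ∀ k, riemLow g y a b c k = (g y * lcCurv g b a y) k c := fun k => rfl
  simp only [h]
  rw [← Matrix.mul_apply, ← Matrix.mul_assoc, hg.inv_mul hy, one_mul, riemann_eq_curvMat]

theorem ricci_eq_riemLow (hg : MetricOn S g) (hy : y ∈ S) (a c : Fin D) :
    ricci (christoffel g) y a c = ∑ b, ∑ d, (g y)⁻¹ b d * riemLow g y a b c d := by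
  simp only [ricci, Matrix.of_apply, hg.riemann_eq_riemLow hy]

theorem ricci_symm (hg : MetricOn S g) (hy : y ∈ S) (a c : Fin D) :
    ricci (christoffel g) y a c = ricci (christoffel g) y c a := by
  rw [hg.ricci_eq_riemLow hy, hg.ricci_eq_riemLow hy, Finset.sum_comm]
  refine Finset.sum_congr rfl fun b _ => Finset.sum_congr rfl fun d _ => ?_
  rw [hg.inv_symm hy, hg.riemLow_pair hy]

theorem schouten_symm (hg : MetricOn S g) (hy : y ∈ S) (a c : Fin D) :
    schouten g y a c = schouten g y c a := by
  simp only [schouten, Matrix.of_apply]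
  rw [hg.ricci_symm hy, hg.symm' hy]

end MetricOn

/-- The Weyl tensor `C_{abcd}` with its last index lowered. -/
noncomputable def weylLow (g : Comp₂ D) (y : E D) (a b c d : Fin D) : ℝ :=
  ∑ k, weyl g y a b c k * g y k d

namespace MetricOn

theorem sum_schoutenUp_mul (hg : MetricOn S g) (hy : y ∈ S) (a d : Fin D) :
    ∑ k, schoutenUp g y a k * g y k d = schouten g y a d := by
  have h : ∀ k, schoutenUp g y a k = ((g y)⁻¹ *ᵥ schouten g y a) k := fun k => rfl
  have h2 : g y *ᵥ ((g y)⁻¹ *ᵥ schouten g y a) = schouten g y a := by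
    rw [Matrix.mulVec_mulVec, hg.mul_inv hy, Matrix.one_mulVec]
  rw [← congrFun h2 d, Matrix.mulVec, dotProduct]
  refine Finset.sum_congr rfl fun k _ => ?_
  rw [h, hg.symm' hy, mul_comm]

theorem weylLow_eq (hg : MetricOn S g) (hy : y ∈ S) (a b c d : Fin D) :
    weylLow g y a b c d = riemLow g y a b c d
      - (schouten g y b d * g y a c - schouten g y a d * g y b c)
      - (g y b d * schouten g y a c - g y a d * schouten g y b c) := by
  have hk : ∀ a, ∑ k, kd a k * g y k d = g y a d := by
    intro a; simp [kd]
  rw [hg.riemLow_eq hy, ← hg.sum_schoutenUp_mul hy b d, ← hg.sum_schoutenUp_mul hy a d,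
    ← hk a, ← hk b]
  simp only [weylLow, weyl, Finset.sum_mul, ← Finset.sum_sub_distrib]
  exact Finset.sum_congr rfl fun k _ => by ring

theorem weylLow_pair (hg : MetricOn S g) (hy : y ∈ S) (a b c d : Fin D) :
    weylLow g y a b c d = weylLow g y c d a b := by
  rw [hg.weylLow_eq hy, hg.weylLow_eq hy, hg.riemLow_pair hy, hg.symm' hy c a, hg.symm' hy d b,
    hg.symm' hy d a, hg.symm' hy c b, hg.schouten_symm hy c a, hg.schouten_symm hy d b,
    hg.schouten_symm hy d a, hg.schouten_symm hy c b]
  ring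

end MetricOn

theorem weylUp_eq (g : Comp₂ D) (y : E D) (a c b e : Fin D) :
    weylUp g y a c b e = ∑ k, ∑ l, (g y)⁻¹ a k * (g y)⁻¹ c l * weylLow g y k l b e := by
  simp only [weylUp, weylLow, Finset.mul_sum]
  exact Finset.sum_congr rfl fun k _ => Finset.sum_congr rfl fun l _ =>
    Finset.sum_congr rfl fun d _ => by ring

end Symmetries

/-! ### Conformal change of the metric -/

section Conformal

variable {D : ℕ} {S : Set (E D)} {y : E D} {g : Comp₂ D} {Υ : Comp₁ D} {w : E D → ℝ}

/-- The vector `Υ^c = g^{cd} Υ_d`. -/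
noncomputable def raise (g : Comp₂ D) (Υ : Comp₁ D) (y : E D) (c : Fin D) : ℝ :=
  ∑ d, (g y)⁻¹ c d * Υ y d

/-- `∇_a Υ_b`, with respect to the Levi-Civita connection of `g`. -/
noncomputable def covDeriv (g : Comp₂ D) (Υ : Comp₁ D) (y : E D) (a b : Fin D) : ℝ :=
  pd a (fun z => Υ z b) y - ∑ k, christoffel g y k a b * Υ y k

/-- `|Υ|² = g^{ab} Υ_a Υ_b`. -/
noncomputable def normSq (g : Comp₂ D) (Υ : Comp₁ D) (y : E D) : ℝ :=
  ∑ c, raise g Υ y c * Υ y c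

theorem MetricOn.smul (hg : MetricOn S g) (hw : ContDiffOn ℝ ∞ w S) (hw0 : ∀ z ∈ S, w z ≠ 0) :
    MetricOn S (fun z => w z • g z) where
  isOpen := hg.isOpen
  smooth i j := hw.mul (hg.smooth i j)
  symm z hz := by rw [Matrix.transpose_smul, hg.symm z hz]
  det_ne z hz := by
    rw [Matrix.det_smul]
    exact mul_ne_zero (pow_ne_zero _ (hw0 z hz)) (hg.det_ne z hz)

namespace MetricOn

theorem sum_mul_raise (hg : MetricOn S g) (hy : y ∈ S) (Υ : Comp₁ D) (a : Fin D) :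
    ∑ c, g y a c * raise g Υ y c = Υ y a := by
  have h2 : g y *ᵥ ((g y)⁻¹ *ᵥ Υ y) = Υ y := by
    rw [Matrix.mulVec_mulVec, hg.mul_inv hy, Matrix.one_mulVec]
  exact congrFun h2 a

theorem pd_metric (hg : MetricOn S g) (hy : y ∈ S) (a b c : Fin D) :
    pd a (fun x => g x b c) y = ∑ x, christoffel g y x a b * g y x c
      + ∑ x, g y b x * christoffel g y x a c := by
  have h := congrFun (congrFun (hg.isLeviCivitaOn_christoffel.compat y hy a) b) c
  rw [Matrix.add_apply, Matrix.mul_apply, Matrix.mul_apply] at h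
  exact h

theorem christoffel_symm (hg : MetricOn S g) (hy : y ∈ S) (c a b : Fin D) :
    christoffel g y c a b = christoffel g y c b a :=
  hg.isLeviCivitaOn_christoffel.torsionFree y hy c a b

theorem smooth_raise (hg : MetricOn S g) (hΥ : ∀ i, ContDiffOn ℝ ∞ (fun z => Υ z i) S)
    (c : Fin D) : ContDiffOn ℝ ∞ (fun z => raise g Υ z c) S :=
  ContDiffOn.sum fun d _ => (hg.smooth_inv c d).mul (hΥ d)

theorem pd_raise (hg : MetricOn S g) (hy : y ∈ S) (hΥ : ∀ i, ContDiffOn ℝ ∞ (fun z => Υ z i) S)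
    (b c : Fin D) : pd b (fun z => raise g Υ z c) y
      = ∑ d, (g y)⁻¹ c d * covDeriv g Υ y b d - ∑ k, christoffel g y c b k * raise g Υ y k := by
  have hd := fun d => differentiableAt_of_contDiffOn hg.isOpen (hΥ d) hy
  have hi := fun d => hg.smooth_inv.differentiableAt hg.isOpen hy c d
  have hpi : ∀ d, pd b (fun z => (g z)⁻¹ c d) y = -(∑ k, christoffel g y c b k * (g y)⁻¹ k d
      + ∑ k, (g y)⁻¹ c k * christoffel g y d b k) := by
    intro d
    have h := congrFun (congrFun (hg.pdMat_inv hy b) c) d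
    rw [Matrix.neg_apply, Matrix.add_apply, Matrix.mul_apply, Matrix.mul_apply] at h
    exact h
  simp only [raise, covDeriv]
  rw [pd_sum fun d _ => (hi d).fun_mul (hd d)]
  simp only [pd_mul (hi _) (hd _), hpi, neg_mul, add_mul, mul_sub, Finset.sum_add_distrib,
    Finset.sum_neg_distrib, Finset.sum_sub_distrib]
  have e1 : ∑ x, (∑ k, christoffel g y c b k * (g y)⁻¹ k x) * Υ y x
      = ∑ k, christoffel g y c b k * ∑ d, (g y)⁻¹ k d * Υ y d := by
    simp only [Finset.sum_mul, Finset.mul_sum]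
    rw [Finset.sum_comm]
    exact Finset.sum_congr rfl fun _ _ => Finset.sum_congr rfl fun _ _ => by ring
  have e2 : ∑ x, (∑ k, (g y)⁻¹ c k * christoffel g y x b k) * Υ y x
      = ∑ d, (g y)⁻¹ c d * ∑ k, christoffel g y k b d * Υ y k := by
    simp only [Finset.sum_mul, Finset.mul_sum]
    rw [Finset.sum_comm]
    exact Finset.sum_congr rfl fun _ _ => Finset.sum_congr rfl fun _ _ => by ring
  rw [e1, e2]
  ring

theorem sum_inv_mul_covDeriv (hg : MetricOn S g) (hy : y ∈ S) (v : Fin D → ℝ) :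
    ∑ c, (∑ d, (g y)⁻¹ c d * v d) * Υ y c = ∑ d, raise g Υ y d * v d := by
  simp only [raise, Finset.sum_mul]
  rw [Finset.sum_comm]
  refine Finset.sum_congr rfl fun d _ => Finset.sum_congr rfl fun c _ => ?_
  rw [hg.inv_symm hy c d]
  ring

theorem pd_normSq (hg : MetricOn S g) (hy : y ∈ S) (hΥ : ∀ i, ContDiffOn ℝ ∞ (fun z => Υ z i) S)
    (b : Fin D) :
    pd b (fun z => normSq g Υ z) y = 2 * ∑ d, raise g Υ y d * covDeriv g Υ y b d := by
  have hd := fun d => differentiableAt_of_contDiffOn hg.isOpen (hΥ d) hy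
  have hr := fun d => differentiableAt_of_contDiffOn hg.isOpen (hg.smooth_raise hΥ d) hy
  simp only [normSq]
  rw [pd_sum fun d _ => (hr d).fun_mul (hd d)]
  simp only [pd_mul (hr _) (hd _), hg.pd_raise hy hΥ, Finset.sum_add_distrib, sub_mul,
    Finset.sum_sub_distrib]
  rw [hg.sum_inv_mul_covDeriv hy]
  have e : ∑ c, raise g Υ y c * pd b (fun z => Υ z c) y
      - ∑ c, (∑ k, christoffel g y c b k * raise g Υ y k) * Υ y c
      = ∑ c, raise g Υ y c * covDeriv g Υ y b c := by
    simp only [covDeriv, mul_sub, Finset.sum_sub_distrib, Finset.sum_mul, Finset.mul_sum]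
    congr 1
    rw [Finset.sum_comm]
    exact Finset.sum_congr rfl fun _ _ => Finset.sum_congr rfl fun _ _ => by ring
  linarith

/-- The `𝒞`-connection of `Υ = d log Ω` is the Levi-Civita connection of `Ω⁻² g`;
here `w = Ω⁻²`, so that `dw = -2 w Υ`. -/
theorem isLeviCivitaOn_cConn (hg : MetricOn S g) (hw : ContDiffOn ℝ ∞ w S)
    (hwΥ : ∀ z ∈ S, ∀ a, pd a w z = -2 * w z * Υ z a) :
    IsLeviCivitaOn S (fun z => w z • g z) (cConn g Υ) := by
  refine ⟨?_, ?_⟩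
  · intro z hz c a b
    simp only [cConn]
    rw [hg.christoffel_symm hz c a b, hg.symm' hz a b]
    ring
  · intro z hz a
    ext b c
    rw [Matrix.add_apply, Matrix.mul_apply, Matrix.mul_apply, pdMat_apply]
    simp only [Matrix.transpose_apply, connMat, Matrix.of_apply, Matrix.smul_apply, smul_eq_mul]
    rw [pd_mul (differentiableAt_of_contDiffOn hg.isOpen hw hz)
      (hg.smooth.differentiableAt hg.isOpen hz b c), hwΥ z hz, hg.pd_metric hz]
    have e1 : ∑ x, cConn g Υ z x a b * (w z * g z x c)
        = w z * (∑ x, christoffel g z x a b * g z x c - Υ z a * g z b c - Υ z b * g z a c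
          + g z a b * Υ z c) := by
      have h1 : ∑ x, kd x b * g z x c = g z b c := by simp [kd]
      have h2 : ∑ x, kd x a * g z x c = g z a c := by simp [kd]
      have h3 : ∑ x, raise g Υ z x * g z x c = Υ z c := by
        rw [← hg.sum_mul_raise hz Υ c]
        exact Finset.sum_congr rfl fun x _ => by rw [hg.symm' hz c x, mul_comm]
      rw [← h1, ← h2, ← h3]
      simp only [Finset.mul_sum, ← Finset.sum_sub_distrib, ← Finset.sum_add_distrib]
      refine Finset.sum_congr rfl fun x _ => ?_
      simp only [cConn, raise]
      ring
    have e2 : ∑ x, w z * g z b x * cConn g Υ z x a c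
        = w z * (∑ x, g z b x * christoffel g z x a c - Υ z a * g z b c - Υ z c * g z b a
          + g z a c * Υ z b) := by
      have h1 : ∑ x, kd x c * g z b x = g z b c := by simp [kd]
      have h2 : ∑ x, kd x a * g z b x = g z b a := by simp [kd]
      rw [← h1, ← h2, ← hg.sum_mul_raise hz Υ b]
      simp only [Finset.mul_sum, ← Finset.sum_sub_distrib, ← Finset.sum_add_distrib]
      refine Finset.sum_congr rfl fun x _ => ?_
      simp only [cConn, raise]
      ring
    rw [e1, e2, hg.symm' hz b a]
    ring

theorem christoffel_conformal (hg : MetricOn S g) (hy : y ∈ S) (hw : ContDiffOn ℝ ∞ w S)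
    (hw0 : ∀ z ∈ S, w z ≠ 0) (hwΥ : ∀ z ∈ S, ∀ a, pd a w z = -2 * w z * Υ z a) (c a b : Fin D) :
    cConn g Υ y c a b = christoffel (fun z => w z • g z) y c a b :=
  (hg.isLeviCivitaOn_cConn hw hwΥ).eq_christoffel (hg.smul hw hw0) hy c a b

end MetricOn

theorem ricci_congr {G₁ G₂ : ConnCoeff D} (hS : IsOpen S) (hy : y ∈ S)
    (h : ∀ z ∈ S, ∀ c a b, G₁ z c a b = G₂ z c a b) : ricci G₁ y = ricci G₂ y := by
  ext a c
  simp only [ricci, Matrix.of_apply, riemann]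
  refine Finset.sum_congr rfl fun b _ => ?_
  rw [pd_congr hS hy (fun z hz => h z hz b a c) b, pd_congr hS hy (fun z hz => h z hz b b c) a]
  simp only [h y hy]

/-- The Ricci tensor of `Ω⁻² g` is the one of the `𝒞`-connection. -/
theorem MetricOn.ricci_conformal (hg : MetricOn S g) (hy : y ∈ S) (hw : ContDiffOn ℝ ∞ w S)
    (hw0 : ∀ z ∈ S, w z ≠ 0) (hwΥ : ∀ z ∈ S, ∀ a, pd a w z = -2 * w z * Υ z a) :
    ricci (christoffel (fun z => w z • g z)) y = ricci (cConn g Υ) y :=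
  (ricci_congr hg.isOpen hy fun _ hz c a b =>
    hg.christoffel_conformal hz hw hw0 hwΥ c a b).symm

/-- The difference `-Υ_a δ^c_b - Υ_b δ^c_a + g_{ab} Υ^c` of the `𝒞`-connection and the Levi-Civita
connection. -/
noncomputable def cDiff (g : Comp₂ D) (Υ : Comp₁ D) (y : E D) (c a b : Fin D) : ℝ :=
  -(Υ y a * kd c b) - Υ y b * kd c a + g y a b * raise g Υ y c

theorem cConn_eq_add (g : Comp₂ D) (Υ : Comp₁ D) (y : E D) (c a b : Fin D) :
    cConn g Υ y c a b = christoffel g y c a b + cDiff g Υ y c a b := by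
  simp only [cConn, cDiff, raise]
  ring

namespace MetricOn

theorem smooth_cDiff (hg : MetricOn S g) (hΥ : ∀ i, ContDiffOn ℝ ∞ (fun z => Υ z i) S)
    (c a b : Fin D) : ContDiffOn ℝ ∞ (fun z => cDiff g Υ z c a b) S :=
  ((((hΥ a).mul contDiffOn_const).neg).sub ((hΥ b).mul contDiffOn_const)).add
    ((hg.smooth a b).mul (hg.smooth_raise hΥ c))

theorem sum_cDiff (hg : MetricOn S g) (hy : y ∈ S) (Υ : Comp₁ D) (c : Fin D) :
    ∑ b, cDiff g Υ y b b c = -(D : ℝ) * Υ y c := by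
  have h3 : ∑ x, g y x c * raise g Υ y x = Υ y c := by
    rw [← hg.sum_mul_raise hy Υ c]
    exact Finset.sum_congr rfl fun x _ => by rw [hg.symm' hy c x]
  simp only [cDiff, Finset.sum_add_distrib, Finset.sum_sub_distrib, h3]
  simp [kd]
  ring

theorem sum_pd_cDiff (hg : MetricOn S g) (hy : y ∈ S)
    (hΥ : ∀ i, ContDiffOn ℝ ∞ (fun z => Υ z i) S) (a c : Fin D) :
    ∑ b, pd b (fun z => cDiff g Υ z b a c) y = -pd c (fun z => Υ z a) y - pd a (fun z => Υ z c) y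
      + ∑ b, pd b (fun z => g z a c) y * raise g Υ y b
      + g y a c * ∑ b, pd b (fun z => raise g Υ z b) y := by
  have hd := fun d => differentiableAt_of_contDiffOn hg.isOpen (hΥ d) hy
  have hr := fun d => differentiableAt_of_contDiffOn hg.isOpen (hg.smooth_raise hΥ d) hy
  have hg' := fun i j => hg.smooth.differentiableAt hg.isOpen hy i j
  have e : ∀ b, pd b (fun z => cDiff g Υ z b a c) y
      = -(pd b (fun z => Υ z a) y * kd b c) - pd b (fun z => Υ z c) y * kd b a
        + (pd b (fun z => g z a c) y * raise g Υ y b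
          + g y a c * pd b (fun z => raise g Υ z b) y) := by
    intro b
    simp only [cDiff]
    have d1 : DifferentiableAt ℝ (fun z => -(Υ z a * kd b c)) y :=
      ((hd a).fun_mul (differentiableAt_const _)).fun_neg
    have d2 : DifferentiableAt ℝ (fun z => Υ z c * kd b a) y :=
      (hd c).fun_mul (differentiableAt_const _)
    rw [pd_add (d1.fun_sub d2) ((hg' a c).fun_mul (hr b)), pd_sub d1 d2, pd_neg,
      pd_mul (hd a) (differentiableAt_const _), pd_mul (hd c) (differentiableAt_const _),
      pd_mul (hg' a c) (hr b)]
    simp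
  simp only [e, Finset.sum_add_distrib, Finset.sum_sub_distrib, Finset.mul_sum]
  have h1 : ∑ x, -(pd x (fun z => Υ z a) y * kd x c) = -pd c (fun z => Υ z a) y := by simp [kd]
  have h2 : ∑ x, pd x (fun z => Υ z c) y * kd x a = pd a (fun z => Υ z c) y := by simp [kd]
  rw [h1, h2]
  ring

/-- The Ricci tensor of the `𝒞`-connection of a closed one-form:
`Ric + (D-2) (∇_a Υ_c + Υ_a Υ_c) + (g^{bd} ∇_b Υ_d - (D-2) |Υ|²) g_{ac}`. -/
theorem ricci_cConn (hg : MetricOn S g) (hy : y ∈ S)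
    (hΥ : ∀ i, ContDiffOn ℝ ∞ (fun z => Υ z i) S)
    (hcl : ∀ i j, pd i (fun z => Υ z j) y = pd j (fun z => Υ z i) y) (a c : Fin D) :
    ricci (cConn g Υ) y a c = ricci (christoffel g) y a c
      + ((D : ℝ) - 2) * (covDeriv g Υ y a c + Υ y a * Υ y c)
      + (∑ b, ∑ d, (g y)⁻¹ b d * covDeriv g Υ y b d - ((D : ℝ) - 2) * normSq g Υ y)
        * g y a c := by
  set Γ := christoffel g y with hΓ
  set B := cDiff g Υ y with hB
  set U := raise g Υ y
  have hdΓ : ∀ c a b, DifferentiableAt ℝ (fun z => christoffel g z c a b) y := fun c a b =>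
    (hg.smooth_christoffel a).differentiableAt hg.isOpen hy c b
  have hdB : ∀ c a b, DifferentiableAt ℝ (fun z => cDiff g Υ z c a b) y := fun c a b =>
    differentiableAt_of_contDiffOn hg.isOpen (hg.smooth_cDiff hΥ c a b) hy
  have hgU : ∀ a, ∑ c, g y a c * U c = Υ y a := hg.sum_mul_raise hy Υ
  have hUΥ : ∑ k, U k * Υ y k = normSq g Υ y := rfl
  have hBe : ∀ c a b, B c a b = -(Υ y a * kd c b) - Υ y b * kd c a + g y a b * U c :=
    fun _ _ _ => rfl
  -- with `Γ' = Γ + B`, the curvature splits into `∂B`, the mixed terms `ΓB` and the terms `BB`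
  have split : ricci (cConn g Υ) y a c = ricci (christoffel g) y a c
      + ∑ b, pd b (fun z => cDiff g Υ z b a c) y - ∑ b, pd a (fun z => cDiff g Υ z b b c) y
      + ∑ b, ∑ k, Γ k a c * B b b k + ∑ b, ∑ k, B k a c * Γ b b k + ∑ b, ∑ k, B k a c * B b b k
      - ∑ b, ∑ k, Γ k b c * B b a k - ∑ b, ∑ k, B k b c * Γ b a k
      - ∑ b, ∑ k, B k b c * B b a k := by
    simp only [ricci, Matrix.of_apply, ← Finset.sum_add_distrib, ← Finset.sum_sub_distrib]
    refine Finset.sum_congr rfl fun b _ => ?_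
    simp only [riemann, cConn_eq_add, pd_add (hdΓ _ _ _) (hdB _ _ _), ← hΓ, ← hB]
    simp only [add_mul, mul_add, Finset.sum_add_distrib, Finset.sum_sub_distrib]
    ring
  have s2 : ∑ b, pd a (fun z => cDiff g Υ z b b c) y = -(D : ℝ) * pd a (fun z => Υ z c) y := by
    rw [← pd_sum fun b _ => hdB b b c,
      pd_congr hg.isOpen hy (fun z hz => hg.sum_cDiff hz Υ c),
      pd_const_mul (differentiableAt_of_contDiffOn hg.isOpen (hΥ c) hy)]
  have s3 : ∑ b, pd b (fun z => raise g Υ z b) y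
      = ∑ b, ∑ d, (g y)⁻¹ b d * covDeriv g Υ y b d - ∑ b, ∑ k, Γ b b k * U k := by
    rw [← Finset.sum_sub_distrib]
    exact Finset.sum_congr rfl fun b _ => hg.pd_raise hy hΥ b b
  have s4 : ∑ b, pd b (fun z => g z a c) y * U b
      = ∑ b, ∑ k, Γ k a b * g y k c * U b + ∑ b, ∑ k, Γ k b c * g y a k * U b := by
    rw [← Finset.sum_add_distrib]
    refine Finset.sum_congr rfl fun b _ => ?_
    rw [hg.pd_metric hy, add_mul, Finset.sum_mul, Finset.sum_mul]
    congr 1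
    · exact Finset.sum_congr rfl fun k _ => by rw [hg.christoffel_symm hy k b a]
    · exact Finset.sum_congr rfl fun k _ => by rw [mul_comm (g y a k)]
  have trB : ∀ k, ∑ b, B b b k = -(D : ℝ) * Υ y k := hg.sum_cDiff hy Υ
  have contr : ∀ X : Fin D → ℝ, ∑ k, B k a c * X k
      = -Υ y a * X c - Υ y c * X a + g y a c * ∑ k, U k * X k := by
    intro X
    simp only [hBe, add_mul, sub_mul, neg_mul, Finset.sum_add_distrib, Finset.sum_sub_distrib,
      Finset.sum_neg_distrib, mul_assoc, ← Finset.mul_sum]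
    simp [kd]
  have q1 : ∑ b, ∑ k, Γ k a c * B b b k = -(D : ℝ) * ∑ k, Γ k a c * Υ y k := by
    rw [Finset.sum_comm, Finset.mul_sum]
    refine Finset.sum_congr rfl fun k _ => ?_
    rw [← Finset.mul_sum, trB]
    ring
  have q2 : ∑ b, ∑ k, B k a c * Γ b b k = -Υ y a * ∑ b, Γ b b c - Υ y c * ∑ b, Γ b b a
      + g y a c * ∑ b, ∑ k, Γ b b k * U k := by
    simp only [contr, Finset.sum_add_distrib, Finset.sum_sub_distrib, ← Finset.mul_sum,
      mul_comm (U _)]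
  have q3 : ∑ b, ∑ k, B k a c * B b b k
      = (D : ℝ) * (2 * (Υ y a * Υ y c) - normSq g Υ y * g y a c) := by
    rw [Finset.sum_comm]
    simp only [← Finset.mul_sum, trB, contr]
    have : ∑ k, U k * (-(D : ℝ) * Υ y k) = -(D : ℝ) * normSq g Υ y := by
      rw [← hUΥ, Finset.mul_sum]
      exact Finset.sum_congr rfl fun k _ => by ring
    rw [this]
    ring
  have q4 : ∑ b, ∑ k, Γ k b c * B b a k = -Υ y a * ∑ b, Γ b b c - ∑ k, Γ k a c * Υ y k
      + ∑ b, ∑ k, Γ k b c * g y a k * U b := by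
    have h1 : ∑ b, ∑ k, Γ k b c * (Υ y a * kd b k) = Υ y a * ∑ b, Γ b b c := by
      simp [kd, Finset.mul_sum, mul_comm]
    have h2 : ∑ b, ∑ k, Γ k b c * (Υ y k * kd b a) = ∑ k, Γ k a c * Υ y k := by
      rw [Finset.sum_comm]; simp [kd]
    rw [← h2, neg_mul, ← h1]
    simp only [← Finset.sum_neg_distrib, ← Finset.sum_sub_distrib, ← Finset.sum_add_distrib, hBe]
    exact Finset.sum_congr rfl fun b _ => Finset.sum_congr rfl fun k _ => by ring
  have q5 : ∑ b, ∑ k, B k b c * Γ b a k = -∑ k, Γ k a c * Υ y k - Υ y c * ∑ b, Γ b b a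
      + ∑ b, ∑ k, Γ k a b * g y k c * U b := by
    have h1 : ∑ b, ∑ k, Υ y b * kd k c * Γ b a k = ∑ k, Γ k a c * Υ y k := by
      simp [kd, mul_comm]
    have h2 : ∑ b, ∑ k, Υ y c * kd k b * Γ b a k = Υ y c * ∑ b, Γ b b a := by
      simp only [Finset.mul_sum]
      refine Finset.sum_congr rfl fun b _ => ?_
      rw [show Γ b b a = Γ b a b from hg.christoffel_symm hy b b a]
      simp [kd]
    have h3 : ∑ b, ∑ k, Γ k a b * g y k c * U b = ∑ b, ∑ k, g y b c * U k * Γ b a k := by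
      rw [Finset.sum_comm]
      exact Finset.sum_congr rfl fun b _ => Finset.sum_congr rfl fun k _ => by ring
    rw [← h1, ← h2, h3]
    simp only [← Finset.sum_neg_distrib, ← Finset.sum_sub_distrib, ← Finset.sum_add_distrib, hBe]
    exact Finset.sum_congr rfl fun b _ => Finset.sum_congr rfl fun k _ => by ring
  have q6 : ∑ b, ∑ k, B k b c * B b a k
      = ((D : ℝ) + 2) * (Υ y a * Υ y c) - 2 * normSq g Υ y * g y a c := by
    have inner : ∀ b, ∑ k, B k b c * B b a k
        = -Υ y b * B b a c - Υ y c * B b a b + g y b c * ∑ k, U k * B b a k := by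
      intro b
      simp only [hBe, add_mul, sub_mul, neg_mul, Finset.sum_add_distrib, Finset.sum_sub_distrib,
        Finset.sum_neg_distrib, mul_assoc, ← Finset.mul_sum]
      simp [kd]
    have hUB : ∀ b, ∑ k, U k * B b a k = -(kd b a * normSq g Υ y) := by
      intro b
      have h1 : ∑ k, U k * kd b k = U b := by simp [kd]
      have h2 : ∑ k, U k * B b a k = -(Υ y a * ∑ k, U k * kd b k) - kd b a * ∑ k, U k * Υ y k
          + U b * ∑ k, g y a k * U k := by
        simp only [Finset.mul_sum, ← Finset.sum_neg_distrib, ← Finset.sum_sub_distrib,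
          ← Finset.sum_add_distrib, hBe]
        exact Finset.sum_congr rfl fun k _ => by ring
      rw [h2, h1, hUΥ, hgU]
      ring
    have trB' : ∑ b, B b a b = -(D : ℝ) * Υ y a := by
      rw [← trB]
      refine Finset.sum_congr rfl fun b _ => ?_
      rw [hBe, hBe, hg.symm' hy a b]
      ring
    have h1 : ∑ b, Υ y b * B b a c = -2 * (Υ y a * Υ y c) + g y a c * normSq g Υ y := by
      rw [← hUΥ, ← sub_eq_zero]
      simp only [mul_comm (Υ y _) (B _ a c), contr]
      ring
    have h2 : ∑ b, g y b c * (kd b a * normSq g Υ y) = g y a c * normSq g Υ y := by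
      simp [kd]
    simp only [inner, hUB, mul_neg, neg_mul, Finset.sum_add_distrib, Finset.sum_sub_distrib,
      Finset.sum_neg_distrib, ← Finset.mul_sum, h1, h2, trB']
    ring
  rw [split, hg.sum_pd_cDiff hy hΥ, s2, s3, s4, q1, q2, q3, q4, q5, q6, hcl c a]
  simp only [covDeriv, ← hΓ]
  ring

end MetricOn
end Conformal

/-! ### Einstein scales and the Cotton tensor -/

section EinsteinScale

variable {D : ℕ} {S : Set (E D)} {y : E D} {g : Comp₂ D} {Υ : Comp₁ D} {w : E D → ℝ} {κ : ℝ}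

namespace MetricOn

theorem sum_inv_metric (hg : MetricOn S g) (hy : y ∈ S) :
    ∑ a, ∑ b, (g y)⁻¹ a b * g y a b = D := by
  have : ∀ a, ∑ b, (g y)⁻¹ a b * g y a b = 1 := by
    intro a
    have h := hg.sum_inv_mul hy a a
    simp only [hg.symm' hy a, h]
    simp [kd]
  simp [this]

/-- The Schouten tensor of `g` when `Ω⁻² g` is Einstein, in terms of `Υ = d log Ω` and `w = Ω⁻²`.
The hypothesis is the Einstein equation `Ric(Ω⁻² g) = κ Ω⁻² g`, by `ricci_conformal`. -/
theorem schouten_of_einstein (hD : 3 ≤ D) (hg : MetricOn S g) (hy : y ∈ S)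
    (hΥ : ∀ i, ContDiffOn ℝ ∞ (fun z => Υ z i) S)
    (hcl : ∀ i j, pd i (fun z => Υ z j) y = pd j (fun z => Υ z i) y)
    (hE : ricci (cConn g Υ) y = (κ * w y) • g y) (a c : Fin D) :
    schouten g y a c = -covDeriv g Υ y a c - Υ y a * Υ y c
      + (κ / (2 * ((D : ℝ) - 1)) * w y + 1 / 2 * normSq g Υ y) * g y a c := by
  have hD3 : (3 : ℝ) ≤ D := by exact_mod_cast hD
  have h2 : (D : ℝ) - 2 ≠ 0 := by linarith
  have h1 : (D : ℝ) - 1 ≠ 0 := by linarith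
  set Δ := ∑ b, ∑ d, (g y)⁻¹ b d * covDeriv g Υ y b d with hΔ
  set N := normSq g Υ y with hN
  have ric : ∀ a c, ricci (christoffel g) y a c = (κ * w y - (Δ - ((D : ℝ) - 2) * N)) * g y a c
      - ((D : ℝ) - 2) * (covDeriv g Υ y a c + Υ y a * Υ y c) := by
    intro a c
    have h := hg.ricci_cConn hy hΥ hcl a c
    rw [hE, Matrix.smul_apply, smul_eq_mul] at h
    rw [← hΔ, ← hN] at h
    linarith
  have tr : traceWith g (ricci (christoffel g)) y
      = (κ * w y - (Δ - ((D : ℝ) - 2) * N)) * D - ((D : ℝ) - 2) * (Δ + N) := by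
    have hN' : N = ∑ a, ∑ b, (g y)⁻¹ a b * (Υ y a * Υ y b) := by
      rw [hN, normSq]
      refine Finset.sum_congr rfl fun a _ => ?_
      rw [raise, Finset.sum_mul]
      exact Finset.sum_congr rfl fun b _ => by ring
    have e : ∀ a b, (g y)⁻¹ a b * ricci (christoffel g) y a b
        = (κ * w y - (Δ - ((D : ℝ) - 2) * N)) * ((g y)⁻¹ a b * g y a b)
          - ((D : ℝ) - 2) * ((g y)⁻¹ a b * covDeriv g Υ y a b
            + (g y)⁻¹ a b * (Υ y a * Υ y b)) := by
      intro a b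
      rw [ric]
      ring
    simp only [traceWith, e, Finset.sum_sub_distrib, Finset.sum_add_distrib, ← Finset.mul_sum]
    rw [hg.sum_inv_metric hy, ← hΔ, ← hN']
  simp only [schouten, Matrix.of_apply]
  rw [tr, ric]
  field_simp
  ring

/-- For a metric conformal to an Einstein metric the Cotton tensor is `-½ C_{bep}{}^d Υ_d`.  The
terms in the trace part cancel because `2 σ = |Υ|² + κ w / (D - 1)` for the factor `σ` of
`schouten_of_einstein`. -/
theorem cotton_of_einstein (hD : 3 ≤ D) (hg : MetricOn S g) (hy : y ∈ S)
    (hΥ : ∀ i, ContDiffOn ℝ ∞ (fun z => Υ z i) S)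
    (hcl : ∀ z ∈ S, ∀ i j, pd i (fun z => Υ z j) z = pd j (fun z => Υ z i) z)
    (hw : ContDiffOn ℝ ∞ w S) (hwΥ : ∀ z ∈ S, ∀ a, pd a w z = -2 * w z * Υ z a)
    (hE : ∀ z ∈ S, ricci (cConn g Υ) z = (κ * w z) • g z) (b e p : Fin D) :
    cotton g y b e p = -(1 / 2) * ∑ d, weyl g y b e p d * Υ y d := by
  have hD3 : (3 : ℝ) ≤ D := by exact_mod_cast hD
  have h1 : (D : ℝ) - 1 ≠ 0 := by linarith
  set Γ := christoffel g y with hΓ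
  set σ : E D → ℝ := fun z => κ / (2 * ((D : ℝ) - 1)) * w z + 1 / 2 * normSq g Υ z with hσ
  have hL : ∀ z ∈ S, ∀ a c, schouten g z a c = -covDeriv g Υ z a c - Υ z a * Υ z c
      + σ z * g z a c := fun z hz a c =>
    hg.schouten_of_einstein hD hz hΥ (hcl z hz) (hE z hz) a c
  have hSo := hg.isOpen
  have dΥ := fun d => differentiableAt_of_contDiffOn hSo (hΥ d) hy
  have ddΥ := fun a d => differentiableAt_of_contDiffOn hSo (contDiffOn_pd hSo a (hΥ d)) hy
  have dΓ : ∀ c a b, DifferentiableAt ℝ (fun z => christoffel g z c a b) y := fun c a b =>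
    (hg.smooth_christoffel a).differentiableAt hSo hy c b
  have dg := fun i j => hg.smooth.differentiableAt hSo hy i j
  have dw := differentiableAt_of_contDiffOn hSo hw hy
  have dN : DifferentiableAt ℝ (fun z => normSq g Υ z) y :=
    differentiableAt_of_contDiffOn hSo
      (ContDiffOn.sum fun c _ => (hg.smooth_raise hΥ c).mul (hΥ c)) hy
  have dσ : DifferentiableAt ℝ σ y :=
    (dw.const_mul _).fun_add (dN.const_mul _)
  -- the derivative of the factor `σ`
  have pσ : ∀ b, pd b σ y = -(κ / ((D : ℝ) - 1)) * w y * Υ y b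
      + ∑ d, raise g Υ y d * covDeriv g Υ y b d := by
    intro b
    rw [hσ, pd_add (dw.const_mul _) (dN.const_mul _), pd_const_mul dw, pd_const_mul dN,
      hwΥ y hy, hg.pd_normSq hy hΥ]
    field_simp
  have pL : ∀ b e, pd b (fun z => schouten g z e p) y
      = -(pd b (pd e (fun z => Υ z p)) y
          - ∑ k, (pd b (fun z => christoffel g z k e p) y * Υ y k
            + Γ k e p * pd b (fun z => Υ z k) y))
        - (pd b (fun z => Υ z e) y * Υ y p + Υ y e * pd b (fun z => Υ z p) y)
        + (pd b σ y * g y e p + σ y * pd b (fun z => g z e p) y) := by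
    intro b e
    rw [pd_congr hSo hy (fun z hz => hL z hz e p)]
    have d1 : ∀ k, DifferentiableAt ℝ (fun z => christoffel g z k e p * Υ z k) y :=
      fun k => (dΓ k e p).fun_mul (dΥ k)
    have d2 : DifferentiableAt ℝ (fun z => ∑ k, christoffel g z k e p * Υ z k) y :=
      DifferentiableAt.fun_sum fun k _ => d1 k
    have d3 : DifferentiableAt ℝ (fun z => covDeriv g Υ z e p) y := (ddΥ e p).fun_sub d2
    have d4 := (dΥ e).fun_mul (dΥ p)
    rw [pd_add (d3.fun_neg.fun_sub d4) (dσ.fun_mul (dg e p)), pd_sub d3.fun_neg d4, pd_neg,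
      pd_mul (dΥ e) (dΥ p), pd_mul dσ (dg e p)]
    simp only [covDeriv]
    rw [pd_sub (ddΥ e p) d2, pd_sum fun k _ => d1 k]
    simp only [pd_mul (dΓ _ e p) (dΥ _), ← hΓ]
  have hcomm := pd_comm hSo (hΥ p) hy b e
  -- contraction of the Schouten tensor with a Christoffel symbol
  have gL : ∀ b e, ∑ d, Γ d b p * schouten g y e d
      = -∑ d, Γ d b p * pd e (fun z => Υ z d) y + ∑ k, (∑ d, Γ d b p * Γ k e d) * Υ y k
        - Υ y e * ∑ d, Γ d b p * Υ y d + σ y * ∑ d, g y e d * Γ d b p := by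
    intro b e
    have hs : ∑ k, (∑ d, Γ d b p * Γ k e d) * Υ y k
        = ∑ d, Γ d b p * ∑ k, Γ k e d * Υ y k := by
      simp only [Finset.sum_mul, Finset.mul_sum]
      rw [Finset.sum_comm]
      exact Finset.sum_congr rfl fun _ _ => Finset.sum_congr rfl fun _ _ => by ring
    rw [hs]
    simp only [hL y hy, covDeriv, ← hΓ]
    rw [Finset.mul_sum, Finset.mul_sum, ← Finset.sum_neg_distrib, ← Finset.sum_add_distrib,
      ← Finset.sum_sub_distrib, ← Finset.sum_add_distrib]
    exact Finset.sum_congr rfl fun _ _ => by ring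
  -- the commutator of covariant derivatives of `Υ`
  have hR : ∑ k, riemann (christoffel g) y b e p k * Υ y k
      = ∑ k, pd e (fun z => christoffel g z k b p) y * Υ y k
        - ∑ k, pd b (fun z => christoffel g z k e p) y * Υ y k
        + ∑ k, (∑ d, Γ d b p * Γ k e d) * Υ y k - ∑ k, (∑ d, Γ d e p * Γ k b d) * Υ y k := by
    rw [← Finset.sum_sub_distrib, ← Finset.sum_add_distrib, ← Finset.sum_sub_distrib]
    refine Finset.sum_congr rfl fun k _ => ?_
    simp only [riemann, ← hΓ, Finset.sum_sub_distrib]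
    ring
  have hLU : ∀ e, ∑ d, schoutenUp g y e d * Υ y d
      = -∑ d, raise g Υ y d * covDeriv g Υ y e d - normSq g Υ y * Υ y e + σ y * Υ y e := by
    intro e
    have h1 : ∑ d, schoutenUp g y e d * Υ y d = ∑ d, raise g Υ y d * schouten g y e d := by
      simp only [schoutenUp]
      exact hg.sum_inv_mul_covDeriv hy _
    have h2 : ∑ d, g y e d * raise g Υ y d = Υ y e := hg.sum_mul_raise hy Υ e
    rw [h1]
    have h3 : ∑ d, raise g Υ y d * schouten g y e d
        = -∑ d, raise g Υ y d * covDeriv g Υ y e d - (∑ d, raise g Υ y d * Υ y d) * Υ y e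
          + σ y * ∑ d, g y e d * raise g Υ y d := by
      simp only [hL y hy, Finset.sum_mul, Finset.mul_sum]
      rw [← Finset.sum_neg_distrib, ← Finset.sum_sub_distrib, ← Finset.sum_add_distrib]
      exact Finset.sum_congr rfl fun _ _ => by ring
    rw [h3, h2]
    rfl
  have hC : ∑ d, weyl g y b e p d * Υ y d
      = ∑ k, riemann (christoffel g) y b e p k * Υ y k
        - ((∑ d, schoutenUp g y e d * Υ y d) * g y b p
          - (∑ d, schoutenUp g y b d * Υ y d) * g y e p)
        - (Υ y e * schouten g y b p - Υ y b * schouten g y e p) := by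
    have k1 : ∀ e, Υ y e = ∑ d, kd e d * Υ y d := by intro e; simp [kd]
    conv_rhs => rw [k1 e, k1 b]
    simp only [Finset.sum_mul]
    simp only [← Finset.sum_sub_distrib]
    refine Finset.sum_congr rfl fun d _ => ?_
    simp only [weyl]
    ring
  -- the exterior covariant derivative of the metric vanishes
  have hgg : pd b (fun z => g z e p) y - pd e (fun z => g z b p) y
      = ∑ d, g y e d * Γ d b p - ∑ d, g y b d * Γ d e p := by
    rw [hg.pd_metric hy, hg.pd_metric hy]
    simp only [← hΓ, show ∀ x, Γ x b e = Γ x e b from fun x => hg.christoffel_symm hy x b e]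
    ring
  have tor : ∑ d, Γ d b e * schouten g y d p = ∑ d, Γ d e b * schouten g y d p :=
    Finset.sum_congr rfl fun d _ => by
      rw [show Γ d b e = Γ d e b from hg.christoffel_symm hy d b e]
  have hb := hL y hy b p
  have he := hL y hy e p
  have hσy : σ y = κ / (2 * ((D : ℝ) - 1)) * w y + 1 / 2 * normSq g Υ y := rfl
  have hκ : κ / ((D : ℝ) - 1) = 2 * (κ / (2 * ((D : ℝ) - 1))) := by field_simp
  simp only [cotton, schoutenCov, ← hΓ, Finset.sum_add_distrib]
  rw [tor, pL, pL, gL, gL, hC, hR, hLU, hLU, hb, he, hcomm, hcl y hy b e, pσ, pσ]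
  simp only [covDeriv, ← hΓ, Finset.sum_add_distrib]
  rw [hκ]
  linear_combination (1 / 2 * σ y) * hgg
    + (g y e p * Υ y b - g y b p * Υ y e) * hσy

end MetricOn

theorem sum_swap_pairs {ι : Type*} [Fintype ι] (f : ι → ι → ι → ι → ℝ) :
    ∑ a, ∑ b, ∑ c, ∑ d, f a b c d = ∑ c, ∑ d, ∑ a, ∑ b, f a b c d := by
  calc ∑ a, ∑ b, ∑ c, ∑ d, f a b c d = ∑ a, ∑ c, ∑ b, ∑ d, f a b c d :=
        Finset.sum_congr rfl fun _ _ => Finset.sum_comm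
    _ = ∑ c, ∑ a, ∑ b, ∑ d, f a b c d := Finset.sum_comm
    _ = ∑ c, ∑ a, ∑ d, ∑ b, f a b c d :=
        Finset.sum_congr rfl fun _ _ => Finset.sum_congr rfl fun _ _ => Finset.sum_comm
    _ = ∑ c, ∑ d, ∑ a, ∑ b, f a b c d := Finset.sum_congr rfl fun _ _ => Finset.sum_comm

/-- The contraction `C_{bep}{}^d Υ_d g^{pr}` is `C^{rd}{}_{be} Υ_d`, by the pair symmetry of the Weyl
tensor. -/
theorem MetricOn.sum_weyl_mul_inv (hg : MetricOn S g) (hy : y ∈ S) (b e r : Fin D)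
    (v : Fin D → ℝ) :
    ∑ p, (∑ d, weyl g y b e p d * v d) * (g y)⁻¹ p r = ∑ n, weylUp g y r n b e * v n := by
  have hwd : ∀ p n, weyl g y b e p n = ∑ l, (g y)⁻¹ n l * weylLow g y b e p l := by
    intro p n
    have h2 : (g y)⁻¹ *ᵥ (g y *ᵥ weyl g y b e p) = weyl g y b e p := by
      rw [Matrix.mulVec_mulVec, hg.inv_mul hy, Matrix.one_mulVec]
    rw [← congrFun h2 n, Matrix.mulVec, dotProduct]
    refine Finset.sum_congr rfl fun l _ => ?_
    congr 1
    rw [Matrix.mulVec, dotProduct, weylLow]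
    exact Finset.sum_congr rfl fun k _ => by rw [hg.symm' hy k l, mul_comm]
  simp only [Finset.sum_mul]
  rw [Finset.sum_comm]
  refine Finset.sum_congr rfl fun n _ => ?_
  rw [weylUp_eq, Finset.sum_mul]
  refine Finset.sum_congr rfl fun p _ => ?_
  rw [hwd, Finset.sum_mul, Finset.sum_mul, Finset.sum_mul]
  refine Finset.sum_congr rfl fun l _ => ?_
  rw [hg.inv_symm hy r p, hg.weylLow_pair hy p l b e]
  ring

/-- Contraction of `-δ^p{}_{[m} Υ_{n]}` with a tensor that is skew in `m`, `n`. -/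
theorem sum_skew_mul_delta (K : Fin D → Fin D → Fin D → ℝ) (hK : ∀ p m n, K p m n = -K p n m)
    (v : Fin D → ℝ) :
    ∑ p, ∑ m, ∑ n, K p m n * (-(1 / 2) * (kd p m * v n - kd p n * v m))
      = -∑ p, ∑ n, K p p n * v n := by
  rw [← Finset.sum_neg_distrib]
  refine Finset.sum_congr rfl fun p _ => ?_
  have h1 : ∑ m, ∑ n, K p m n * (kd p m * v n) = ∑ n, K p p n * v n := by
    rw [Finset.sum_comm]; simp [kd]
  have h2 : ∑ m, ∑ n, K p m n * (kd p n * v m) = -∑ n, K p p n * v n := by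
    rw [← h1, Finset.sum_comm, ← Finset.sum_neg_distrib]
    refine Finset.sum_congr rfl fun m _ => ?_
    rw [← Finset.sum_neg_distrib]
    exact Finset.sum_congr rfl fun n _ => by rw [hK]; ring
  have e : ∀ m n, K p m n * (-(1 / 2) * (kd p m * v n - kd p n * v m))
      = -(1 / 2) * (K p m n * (kd p m * v n)) + 1 / 2 * (K p m n * (kd p n * v m)) := by
    intro m n; ring
  simp only [e, Finset.sum_add_distrib, ← Finset.mul_sum]
  rw [h1, h2]
  ring

/-- If `Ω⁻² g` is Einstein and `Υ = d log Ω`, then `Λ^ξ = Υ` for `ξ^p{}_{mn} = -δ^p{}_{[m} Υ_{n]}`: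
the contribution of the Cotton tensor cancels the one of `C W⁺`.  No property of the pseudo-inverse
enters. -/
theorem MetricOn.lambdaComp_of_einstein (hD : 3 ≤ D) (hg : MetricOn S g) (hy : y ∈ S)
    (hΥ : ∀ i, ContDiffOn ℝ ∞ (fun z => Υ z i) S)
    (hcl : ∀ z ∈ S, ∀ i j, pd i (fun z => Υ z j) z = pd j (fun z => Υ z i) z)
    (hw : ContDiffOn ℝ ∞ w S) (hwΥ : ∀ z ∈ S, ∀ a, pd a w z = -2 * w z * Υ z a)
    (hE : ∀ z ∈ S, ricci (cConn g Υ) z = (κ * w z) • g z)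
    (H : E D → Fin D → Fin D → Fin D → Fin D → ℝ) (ξ : E D → Fin D → Fin D → Fin D → ℝ)
    (hξ : ∀ p m n, ξ y p m n = -(1 / 2) * (kd p m * Υ y n - kd p n * Υ y m)) (q : Fin D) :
    lambdaComp g H ξ y q = Υ y q := by
  have hD3 : (3 : ℝ) ≤ D := by exact_mod_cast hD
  have h1 : (1 : ℝ) - D ≠ 0 := by linarith
  set W := weylPinv g H y with hWdef
  -- the scalar `C^{rd}{}_{be} (W⁺)^{be}{}_{rq} Υ_d`
  set Z := ∑ m, ∑ n, (∑ r, ∑ s, weylUp g y m n r s * W r s m q) * Υ y n with hZ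
  have first : ∑ b, ∑ e, ∑ p, ∑ r, cotton g y b e p * (g y)⁻¹ p r * W b e r q = -(1 / 2) * Z := by
    have step : ∀ b e, ∑ p, ∑ r, cotton g y b e p * (g y)⁻¹ p r * W b e r q
        = ∑ r, ∑ n, -(1 / 2) * (weylUp g y r n b e * W b e r q * Υ y n) := by
      intro b e
      rw [Finset.sum_comm]
      refine Finset.sum_congr rfl fun r _ => ?_
      rw [← Finset.sum_mul]
      have hcw : ∑ p, cotton g y b e p * (g y)⁻¹ p r
          = -(1 / 2) * ∑ n, weylUp g y r n b e * Υ y n := by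
        rw [← hg.sum_weyl_mul_inv hy, Finset.mul_sum]
        refine Finset.sum_congr rfl fun p _ => ?_
        rw [hg.cotton_of_einstein hD hy hΥ hcl hw hwΥ hE]
        ring
      rw [hcw, mul_assoc, Finset.sum_mul, Finset.mul_sum]
      exact Finset.sum_congr rfl fun n _ => by ring
    simp only [step]
    rw [sum_swap_pairs]
    simp only [hZ, Finset.mul_sum, Finset.sum_mul]
  have second : ∑ p, ∑ m, ∑ n, (1 / 2 * (kd m p * kd n q - kd m q * kd n p)
      - ∑ r, ∑ s, weylUp g y m n r s * W r s p q) * ξ y p m n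
      = -(((D : ℝ) - 1) / 2) * Υ y q + Z := by
    have hskew : ∀ p m n, (1 / 2 * (kd m p * kd n q - kd m q * kd n p)
        - ∑ r, ∑ s, weylUp g y m n r s * W r s p q)
        = -(1 / 2 * (kd n p * kd m q - kd n q * kd m p)
        - ∑ r, ∑ s, weylUp g y n m r s * W r s p q) := by
      intro p m n
      simp only [weylUp_antisymm g y m n, neg_mul, Finset.sum_neg_distrib]
      ring
    simp only [hξ]
    rw [sum_skew_mul_delta _ hskew]
    simp only [sub_mul, Finset.sum_sub_distrib]
    rw [← hZ]
    have h1 : ∑ p : Fin D, ∑ n, 1 / 2 * (kd p p * kd n q - kd p q * kd n p) * Υ y n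
        = ((D : ℝ) - 1) / 2 * Υ y q := by
      have h2 : ∑ p : Fin D, ∑ n, kd p p * kd n q * Υ y n = D * Υ y q := by simp [kd]
      have h3 : ∑ p : Fin D, ∑ n, kd p q * kd n p * Υ y n = Υ y q := by simp [kd]
      have e : ∀ p n : Fin D, 1 / 2 * (kd p p * kd n q - kd p q * kd n p) * Υ y n
          = 1 / 2 * (kd p p * kd n q * Υ y n) - 1 / 2 * (kd p q * kd n p * Υ y n) := by
        intro p n; ring
      simp only [e, Finset.sum_sub_distrib, ← Finset.mul_sum]
      rw [h2, h3]
      ring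
    rw [h1]
    ring
  simp only [lambdaComp, ← hWdef]
  rw [first, second]
  field_simp
  ring

end EinsteinScale

/-! ### Schur's lemma -/

section Schur

variable {D : ℕ} {S : Set (E D)} {y : E D} {g : Comp₂ D} {ρ : E D → ℝ}

theorem sum_symm_mul_skew {ι : Type*} [Fintype ι] (s t : ι → ι → ℝ) (hs : ∀ i j, s i j = s j i)
    (ht : ∀ i j, t i j = -t j i) : ∑ i, ∑ j, s i j * t i j = 0 := by
  have h : ∑ i, ∑ j, s i j * t i j = -∑ i, ∑ j, s i j * t i j := by
    conv_lhs => rw [Finset.sum_comm]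
    rw [← Finset.sum_neg_distrib]
    refine Finset.sum_congr rfl fun i _ => ?_
    rw [← Finset.sum_neg_distrib]
    refine Finset.sum_congr rfl fun j _ => ?_
    rw [hs j i, ht j i]
    ring
  linarith

namespace MetricOn

/-- `F_{ab} g⁻¹` is a skew matrix. -/
theorem curv_mul_inv_skew (hg : MetricOn S g) (hy : y ∈ S) (a b i j : Fin D) :
    ∑ c, lcCurv g a b y i c * (g y)⁻¹ c j = -∑ c, lcCurv g a b y j c * (g y)⁻¹ c i := by
  have h := hg.curv_skew_metric hy a b
  have h2 : (g y)⁻¹ * ((lcCurv g a b y)ᵀ * g y + g y * lcCurv g a b y) * (g y)⁻¹ = 0 := by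
    rw [h, mul_zero, zero_mul]
  rw [mul_add, add_mul, ← Matrix.mul_assoc (g y)⁻¹ (g y), hg.inv_mul hy, one_mul,
    ← Matrix.mul_assoc (g y)⁻¹, Matrix.mul_assoc _ (g y), hg.mul_inv hy, mul_one] at h2
  have h3 : (g y)⁻¹ * (lcCurv g a b y)ᵀ = (lcCurv g a b y * (g y)⁻¹)ᵀ := by
    rw [Matrix.transpose_mul, hg.inv_transpose hy]
  rw [h3] at h2
  have h4 := congrFun (congrFun h2 i) j
  rw [Matrix.add_apply, Matrix.transpose_apply, Matrix.mul_apply, Matrix.mul_apply,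
    Matrix.zero_apply] at h4
  linarith

theorem curv_trace (hy : ricci (christoffel g) y = ρ y • g y) (a c : Fin D) :
    ∑ b, lcCurv g b a y b c = ρ y * g y a c := by
  have h := congrFun (congrFun hy a) c
  simp only [ricci, Matrix.of_apply, riemann_eq_curvMat] at h
  exact h

theorem curv_trace' (hy : ricci (christoffel g) y = ρ y • g y) (a c : Fin D) :
    ∑ b, lcCurv g a b y b c = -(ρ y * g y a c) := by
  rw [← curv_trace hy, ← Finset.sum_neg_distrib]
  refine Finset.sum_congr rfl fun b _ => ?_
  rw [lcCurv, curvMat_skew, Matrix.neg_apply]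

/-- The contraction of the curvature on the pair of lower indices `a`, `c` is again the Ricci tensor,
by the skew symmetries. -/
theorem curv_trace_inv (hg : MetricOn S g) (hy : y ∈ S)
    (h : ricci (christoffel g) y = ρ y • g y) (b k : Fin D) :
    ∑ a, ∑ c, (g y)⁻¹ a c * lcCurv g b a y k c = ρ y * kd b k := by
  have hR : ∀ a c, lcCurv g b a y k c = ∑ d, (g y)⁻¹ k d * riemLow g y b a d c := by
    intro a c
    have h1 := riemann_eq_curvMat (christoffel g) y a b c k
    rw [lcCurv, ← h1, hg.riemann_eq_riemLow hy]
    refine Finset.sum_congr rfl fun d _ => ?_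
    rw [riemLow_skew_left, hg.riemLow_skew_right hy, neg_neg]
  have hb : ∀ d, ∑ a, ∑ c, (g y)⁻¹ a c * riemLow g y b a d c = ρ y * g y b d := by
    intro d
    rw [← hg.ricci_eq_riemLow hy, h]
    rfl
  calc ∑ a, ∑ c, (g y)⁻¹ a c * lcCurv g b a y k c
      = ∑ a, ∑ d, ∑ c, (g y)⁻¹ k d * ((g y)⁻¹ a c * riemLow g y b a d c) := by
        refine Finset.sum_congr rfl fun a _ => ?_
        rw [Finset.sum_comm]
        refine Finset.sum_congr rfl fun c _ => ?_
        rw [hR, Finset.mul_sum]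
        exact Finset.sum_congr rfl fun d _ => by ring
    _ = ∑ d, (g y)⁻¹ k d * (ρ y * g y b d) := by
        rw [Finset.sum_comm]
        refine Finset.sum_congr rfl fun d _ => ?_
        simp only [← Finset.mul_sum, hb]
    _ = ρ y * kd b k := by
        rw [← hg.sum_mul_inv hy b k, Finset.mul_sum]
        refine Finset.sum_congr rfl fun d _ => ?_
        rw [hg.inv_symm hy d k]
        ring

/-- Schur's lemma: if `Ric = ρ g` then `(D - 2) dρ = 0`, by contracting the second Bianchi identity
twice. -/
theorem schur (hg : MetricOn S g) (hρ : ContDiffOn ℝ ∞ ρ S)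
    (hE : ∀ z ∈ S, ricci (christoffel g) z = ρ z • g z) (hy : y ∈ S) (e : Fin D) :
    ((D : ℝ) - 2) * pd e ρ y = 0 := by
  have hSo := hg.isOpen
  have dρ := differentiableAt_of_contDiffOn hSo hρ hy
  have dg := fun i j => hg.smooth.differentiableAt hSo hy i j
  have di := fun i j => hg.smooth_inv.differentiableAt hSo hy i j
  have dF : ∀ a b i j, DifferentiableAt ℝ (fun z => lcCurv g a b z i j) y := fun a b i j =>
    (smoothMat_curvMat hSo hg.smooth_christoffel a b).differentiableAt hSo hy i j
  set A : Fin D → Matrix (Fin D) (Fin D) ℝ := fun a => connMat (christoffel g) a y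
  set gi := (g y)⁻¹ with hgi
  set F : Fin D → Fin D → Matrix (Fin D) (Fin D) ℝ := fun a b => lcCurv g a b y with hF
  set t := ∑ k, A e k k with ht
  have Asym : ∀ a b k, A a k b = A b k a := fun a b k => hg.christoffel_symm hy k a b
  have bianchi : ∀ a b c,
      (pd e (fun z => lcCurv g b a z b c) y + (∑ k, A e b k * F b a k c - ∑ k, F b a b k * A e k c))
      + (pd b (fun z => lcCurv g a e z b c) y
        + (∑ k, A b b k * F a e k c - ∑ k, F a e b k * A b k c))
      + (pd a (fun z => lcCurv g e b z b c) y
        + (∑ k, A a b k * F e b k c - ∑ k, F e b b k * A a k c)) = 0 := by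
    intro a b c
    have h := congrFun (congrFun (bianchi_differential hSo hg.smooth_christoffel hy e a b) b) c
    simp only [Matrix.add_apply, Matrix.sub_apply, Matrix.mul_apply, pdMat_apply,
      Matrix.zero_apply] at h
    exact h
  -- `g^{ac} g_{ak} Γ^k_{ec} = Γ^k_{ek}`
  have gA : ∀ e, ∑ a, ∑ c, gi a c * ∑ k, g y a k * A e k c = ∑ k, A e k k := by
    intro e
    have : ∀ c, ∑ a, gi a c * ∑ k, g y a k * A e k c = A e c c := by
      intro c
      have h2 : gi *ᵥ (g y *ᵥ fun k => A e k c) = fun k => A e k c := by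
        rw [Matrix.mulVec_mulVec, hg.inv_mul hy, Matrix.one_mulVec]
      rw [← congrFun h2 c, Matrix.mulVec, dotProduct]
      exact Finset.sum_congr rfl fun a _ => by rw [hgi, hg.inv_symm hy a c]; rfl
    rw [Finset.sum_comm]
    simp only [this]
  have pdg : ∀ e b c, pd e (fun z => g z b c) y
      = ∑ k, g y c k * A e k b + ∑ k, g y b k * A e k c := by
    intro e b c
    rw [hg.pd_metric hy]
    congr 1
    exact Finset.sum_congr rfl fun k _ => by rw [hg.symm' hy k c, mul_comm]; rfl
  have tA : ∑ b, A b b e = t := Finset.sum_congr rfl fun b _ => Asym b e b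
  have pull : ∀ (M : Fin D → Fin D → ℝ) (f : Fin D → Fin D → Fin D → Fin D → ℝ),
      ∑ a, ∑ b, ∑ c, gi a c * ∑ k, M b k * f a b k c
        = ∑ b, ∑ k, M b k * ∑ a, ∑ c, gi a c * f a b k c := by
    intro M f
    rw [Finset.sum_comm]
    refine Finset.sum_congr rfl fun b _ => ?_
    simp only [Finset.mul_sum]
    calc ∑ a, ∑ c, ∑ k, gi a c * (M b k * f a b k c)
        = ∑ a, ∑ k, ∑ c, gi a c * (M b k * f a b k c) :=
          Finset.sum_congr rfl fun _ _ => Finset.sum_comm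
      _ = ∑ k, ∑ a, ∑ c, gi a c * (M b k * f a b k c) := Finset.sum_comm
      _ = _ := Finset.sum_congr rfl fun _ _ => Finset.sum_congr rfl fun _ _ =>
          Finset.sum_congr rfl fun _ _ => by ring
  have dist : ∀ X Y Z : Fin D → Fin D → Fin D → ℝ,
      ∑ a, ∑ b, ∑ c, gi a c * (X a b c + (Y a b c - Z a b c))
        = ∑ a, ∑ b, ∑ c, gi a c * X a b c + (∑ a, ∑ b, ∑ c, gi a c * Y a b c
          - ∑ a, ∑ b, ∑ c, gi a c * Z a b c) := by
    intro X Y Z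
    simp only [mul_add, mul_sub, Finset.sum_add_distrib, Finset.sum_sub_distrib]
  have inner : ∀ (P : Fin D → Fin D → Fin D → ℝ), ∑ a, ∑ b, ∑ c, gi a c * P a b c
      = ∑ a, ∑ c, gi a c * ∑ b, P a b c := by
    intro P
    refine Finset.sum_congr rfl fun a _ => ?_
    rw [Finset.sum_comm]
    simp only [Finset.mul_sum]
  -- The three terms of the Bianchi identity, contracted with `g^{ac}` and over `b`.  Each is `D`, `-1`,
  -- `-1` times `∂_e ρ` up to a multiple of the trace `t`, and these multiples add up to zero.
  have t1 : ∑ a, ∑ b, ∑ c, gi a c * (pd e (fun z => lcCurv g b a z b c) y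
      + (∑ k, A e b k * F b a k c - ∑ k, F b a b k * A e k c)) = D * pd e ρ y + 2 * ρ y * t := by
    have hP : ∑ a, ∑ b, ∑ c, gi a c * pd e (fun z => lcCurv g b a z b c) y
        = D * pd e ρ y + 2 * ρ y * t := by
      have h1 : ∀ a c, ∑ b, pd e (fun z => lcCurv g b a z b c) y
          = pd e ρ y * g y a c + ρ y * (∑ k, g y c k * A e k a + ∑ k, g y a k * A e k c) := by
        intro a c
        rw [← pd_sum fun b _ => dF b a b c, pd_congr hSo hy fun z hz => curv_trace (hE z hz) a c,
          pd_mul dρ (dg a c), pdg]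
      have h2 : ∑ a, ∑ c, gi a c * ∑ k, g y c k * A e k a = t := by
        rw [Finset.sum_comm, ht, ← gA e]
        exact Finset.sum_congr rfl fun a _ => Finset.sum_congr rfl fun c _ => by
          rw [hgi, hg.inv_symm hy a c]
      rw [inner]
      simp only [h1]
      have h3 : ∀ a c, gi a c * (pd e ρ y * g y a c
          + ρ y * (∑ k, g y c k * A e k a + ∑ k, g y a k * A e k c))
          = pd e ρ y * (gi a c * g y a c) + (ρ y * (gi a c * ∑ k, g y c k * A e k a)
            + ρ y * (gi a c * ∑ k, g y a k * A e k c)) := by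
        intro a c; ring
      simp only [h3, Finset.sum_add_distrib, ← Finset.mul_sum]
      rw [h2, gA, hg.sum_inv_metric hy]
      ring
    have hX : ∑ a, ∑ b, ∑ c, gi a c * ∑ k, A e b k * F b a k c = ρ y * t := by
      rw [pull (fun b k => A e b k) (fun a b k c => F b a k c)]
      simp only [hF, hgi, hg.curv_trace_inv hy (hE y hy)]
      simp [kd, ht, Finset.mul_sum, mul_comm]
    have hY : ∑ a, ∑ b, ∑ c, gi a c * ∑ k, F b a b k * A e k c = ρ y * t := by
      rw [inner]
      have h1 : ∀ a c, ∑ b, ∑ k, F b a b k * A e k c = ρ y * ∑ k, g y a k * A e k c := by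
        intro a c
        rw [Finset.sum_comm, Finset.mul_sum]
        refine Finset.sum_congr rfl fun k _ => ?_
        rw [← Finset.sum_mul]
        simp only [hF, curv_trace (hE y hy)]
        ring
      simp only [h1, mul_left_comm (gi _ _), ← Finset.mul_sum]
      rw [gA]
    rw [dist, hP, hX, hY]
    ring
  have t2 : ∑ a, ∑ b, ∑ c, gi a c * (pd b (fun z => lcCurv g a e z b c) y
      + (∑ k, A b b k * F a e k c - ∑ k, F a e b k * A b k c)) = -pd e ρ y - ρ y * t := by
    have hQ : ∀ z ∈ S, ∀ k, ∑ a, ∑ c, (g z)⁻¹ a c * lcCurv g a e z k c = -(ρ z * kd e k) := by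
      intro z hz k
      rw [← hg.curv_trace_inv hz (hE z hz), ← Finset.sum_neg_distrib]
      refine Finset.sum_congr rfl fun a _ => ?_
      rw [← Finset.sum_neg_distrib]
      refine Finset.sum_congr rfl fun c _ => ?_
      rw [lcCurv, curvMat_skew, Matrix.neg_apply]
      ring
    have pgi : ∀ b a c, pd b (fun z => (g z)⁻¹ a c) y
        = -(∑ k, A b a k * gi k c + ∑ k, gi a k * A b c k) := by
      intro b a c
      have h := congrFun (congrFun (hg.pdMat_inv hy b) a) c
      rw [Matrix.neg_apply, Matrix.add_apply, Matrix.mul_apply, Matrix.mul_apply] at h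
      exact h
    -- `Γ^a_{bk}` is symmetric in `b`, `k`, whereas `F_{ae}{}^b{}_c g^{ck}` is skew
    have hskew : ∑ a, ∑ b, ∑ c, (∑ k, A b a k * gi k c) * F a e b c = 0 := by
      refine Finset.sum_eq_zero fun a _ => ?_
      have h1 : ∀ b, ∑ c, (∑ k, A b a k * gi k c) * F a e b c
          = ∑ k, A b a k * ∑ c, F a e b c * gi c k := by
        intro b
        simp only [Finset.sum_mul, Finset.mul_sum]
        rw [Finset.sum_comm]
        refine Finset.sum_congr rfl fun k _ => Finset.sum_congr rfl fun c _ => ?_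
        rw [hgi, hg.inv_symm hy k c]
        ring
      simp only [h1]
      exact sum_symm_mul_skew (fun b k => A b a k) (fun b k => ∑ c, F a e b c * gi c k)
        (fun b k => Asym b k a) (fun b k => hg.curv_mul_inv_skew hy a e b k)
    have hP : ∑ a, ∑ b, ∑ c, gi a c * pd b (fun z => lcCurv g a e z b c) y
        = -pd e ρ y + ∑ a, ∑ b, ∑ c, (∑ k, gi a k * A b c k) * F a e b c := by
      have h1 : ∀ b, ∑ a, ∑ c, (pd b (fun z => (g z)⁻¹ a c) y * F a e b c
          + gi a c * pd b (fun z => lcCurv g a e z b c) y) = -(pd b ρ y * kd e b) := by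
        intro b
        have h := pd_congr hSo hy (fun z hz => hQ z hz b) b
        rw [pd_neg, pd_mul dρ (differentiableAt_const _), pd_const, mul_zero, add_zero,
          pd_sum fun a _ => DifferentiableAt.fun_sum fun c _ => (di a c).fun_mul (dF a e b c)] at h
        rw [← h]
        refine Finset.sum_congr rfl fun a _ => ?_
        rw [pd_sum fun c _ => (di a c).fun_mul (dF a e b c)]
        exact Finset.sum_congr rfl fun c _ => (pd_mul (di a c) (dF a e b c) b).symm
      have h2 : ∑ b, ∑ a, ∑ c, (pd b (fun z => (g z)⁻¹ a c) y * F a e b c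
          + gi a c * pd b (fun z => lcCurv g a e z b c) y) = -pd e ρ y := by
        simp only [h1]
        simp [kd]
      rw [Finset.sum_comm] at h2
      simp only [pgi, neg_mul, add_mul, Finset.sum_add_distrib, Finset.sum_neg_distrib] at h2
      rw [hskew] at h2
      linarith
    have hX : ∑ a, ∑ b, ∑ c, gi a c * ∑ k, A b b k * F a e k c = -(ρ y * t) := by
      rw [pull (fun b k => A b b k) (fun a b k c => F a e k c)]
      simp only [hF, hgi, hQ y hy]
      simp [kd, ← tA, Finset.mul_sum, mul_comm]
    have hY : ∑ a, ∑ b, ∑ c, gi a c * ∑ k, F a e b k * A b k c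
        = ∑ a, ∑ b, ∑ c, (∑ k, gi a k * A b c k) * F a e b c := by
      refine Finset.sum_congr rfl fun a _ => Finset.sum_congr rfl fun b _ => ?_
      simp only [Finset.mul_sum, Finset.sum_mul]
      rw [Finset.sum_comm]
      exact Finset.sum_congr rfl fun _ _ => Finset.sum_congr rfl fun _ _ => by ring
    rw [dist, hP, hX, hY]
    ring
  have t3 : ∑ a, ∑ b, ∑ c, gi a c * (pd a (fun z => lcCurv g e b z b c) y
      + (∑ k, A a b k * F e b k c - ∑ k, F e b b k * A a k c)) = -pd e ρ y - ρ y * t := by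
    have hP : ∑ a, ∑ b, ∑ c, gi a c * pd a (fun z => lcCurv g e b z b c) y
        = -pd e ρ y - ρ y * t - ρ y * ∑ a, ∑ c, gi a c * ∑ k, g y e k * A a k c := by
      have h1 : ∀ a c, ∑ b, pd a (fun z => lcCurv g e b z b c) y
          = -(pd a ρ y * g y e c + ρ y * (∑ k, g y c k * A a k e + ∑ k, g y e k * A a k c)) := by
        intro a c
        rw [← pd_sum fun b _ => dF e b b c, pd_congr hSo hy fun z hz => curv_trace' (hE z hz) e c,
          pd_neg, pd_mul dρ (dg e c), pdg]
      have h2 : ∑ a, ∑ c, gi a c * ∑ k, g y c k * A a k e = t := by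
        rw [← tA]
        refine Finset.sum_congr rfl fun a _ => ?_
        have h2 : gi *ᵥ (g y *ᵥ fun k => A a k e) = fun k => A a k e := by
          rw [Matrix.mulVec_mulVec, hg.inv_mul hy, Matrix.one_mulVec]
        exact congrFun h2 a
      have h4 : ∑ a, ∑ c, pd a ρ y * (gi a c * g y e c) = pd e ρ y := by
        simp only [← Finset.mul_sum, hg.symm' hy e, hgi, hg.sum_inv_mul hy]
        simp [kd]
      rw [inner]
      simp only [h1]
      have h3 : ∀ a c, gi a c * -(pd a ρ y * g y e c
          + ρ y * (∑ k, g y c k * A a k e + ∑ k, g y e k * A a k c))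
          = -(pd a ρ y * (gi a c * g y e c)) - (ρ y * (gi a c * ∑ k, g y c k * A a k e)
            + ρ y * (gi a c * ∑ k, g y e k * A a k c)) := by
        intro a c; ring
      simp only [h3, Finset.sum_add_distrib, Finset.sum_sub_distrib, Finset.sum_neg_distrib, h4]
      simp only [← Finset.mul_sum]
      rw [h2]
      ring
    have hX : ∑ a, ∑ b, ∑ c, gi a c * ∑ k, A a b k * F e b k c = 0 := by
      rw [Finset.sum_comm]
      refine Finset.sum_eq_zero fun b _ => ?_
      have h1 : ∀ a, ∑ c, gi a c * ∑ k, A a b k * F e b k c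
          = ∑ k, A a b k * ∑ c, F e b k c * gi c a := by
        intro a
        simp only [Finset.mul_sum]
        rw [Finset.sum_comm]
        refine Finset.sum_congr rfl fun k _ => Finset.sum_congr rfl fun c _ => ?_
        rw [hgi, hg.inv_symm hy a c]
        ring
      simp only [h1]
      exact sum_symm_mul_skew (fun a k => A a b k) (fun a k => ∑ c, F e b k c * gi c a)
        (fun a k => Asym a k b) (fun a k => hg.curv_mul_inv_skew hy e b k a)
    have hY : ∑ a, ∑ b, ∑ c, gi a c * ∑ k, F e b b k * A a k c
        = -(ρ y * ∑ a, ∑ c, gi a c * ∑ k, g y e k * A a k c) := by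
      rw [inner]
      have h1 : ∀ a c, ∑ b, ∑ k, F e b b k * A a k c = -(ρ y * ∑ k, g y e k * A a k c) := by
        intro a c
        rw [Finset.sum_comm, Finset.mul_sum, ← Finset.sum_neg_distrib]
        refine Finset.sum_congr rfl fun k _ => ?_
        rw [← Finset.sum_mul]
        simp only [hF, curv_trace' (hE y hy)]
        ring
      simp only [h1, mul_neg, mul_left_comm (gi _ _), Finset.sum_neg_distrib, ← Finset.mul_sum]
    rw [dist, hP, hX, hY]
    ring
  have total : ∑ a, ∑ b, ∑ c, gi a c * (
      (pd e (fun z => lcCurv g b a z b c) y + (∑ k, A e b k * F b a k c - ∑ k, F b a b k * A e k c))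
      + (pd b (fun z => lcCurv g a e z b c) y
        + (∑ k, A b b k * F a e k c - ∑ k, F a e b k * A b k c))
      + (pd a (fun z => lcCurv g e b z b c) y
        + (∑ k, A a b k * F e b k c - ∑ k, F e b b k * A a k c))) = 0 :=
    Finset.sum_eq_zero fun a _ => Finset.sum_eq_zero fun b _ => Finset.sum_eq_zero fun c _ => by
      rw [bianchi, mul_zero]
  have split : ∀ X Y Z : Fin D → Fin D → Fin D → ℝ,
      ∑ a, ∑ b, ∑ c, gi a c * (X a b c + Y a b c + Z a b c)
        = ∑ a, ∑ b, ∑ c, gi a c * X a b c + ∑ a, ∑ b, ∑ c, gi a c * Y a b c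
          + ∑ a, ∑ b, ∑ c, gi a c * Z a b c := by
    intro X Y Z
    simp only [mul_add, Finset.sum_add_distrib]
  rw [split, t1, t2, t3] at total
  linarith

end MetricOn

end Schur

/-! ### Change of coordinates -/

section Pullback

variable {D : ℕ} {V S : Set (E D)} {y : E D}

theorem smoothMat_smul {c : E D → ℝ} {N : E D → Matrix (Fin D) (Fin D) ℝ}
    (hc : ContDiffOn ℝ ∞ c V) (hN : SmoothMat V N) : SmoothMat V (fun z => c z • N z) :=
  fun i j => hc.mul (hN i j)

theorem smoothMat_sum {ι : Type*} {s : Finset ι} {N : ι → E D → Matrix (Fin D) (Fin D) ℝ}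
    (hN : ∀ k ∈ s, SmoothMat V (N k)) : SmoothMat V (fun z => ∑ k ∈ s, N k z) := by
  intro i j
  simp only [Matrix.sum_apply]
  exact ContDiffOn.sum fun k hk => hN k hk i j

theorem pdMat_smul {c : E D → ℝ} {N : E D → Matrix (Fin D) (Fin D) ℝ} (hV : IsOpen V)
    (hc : ContDiffOn ℝ ∞ c V) (hN : SmoothMat V N) (hy : y ∈ V) (a : Fin D) :
    pdMat a (fun z => c z • N z) y = pd a c y • N y + c y • pdMat a N y := by
  ext i j
  exact pd_mul (differentiableAt_of_contDiffOn hV hc hy) (hN.differentiableAt hV hy i j) a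

theorem pdMat_sum {ι : Type*} {s : Finset ι} {N : ι → E D → Matrix (Fin D) (Fin D) ℝ}
    (hV : IsOpen V) (hN : ∀ k ∈ s, SmoothMat V (N k)) (hy : y ∈ V) (a : Fin D) :
    pdMat a (fun z => ∑ k ∈ s, N k z) y = ∑ k ∈ s, pdMat a (N k) y := by
  ext i j
  simp only [pdMat_apply, Matrix.sum_apply]
  exact pd_sum (fun k hk => (hN k hk).differentiableAt hV hy i j) a

/-- The Jacobian matrix `J^k{}_a = ∂_a φ^k`. -/
noncomputable def jac (φ : E D → E D) (y : E D) : Matrix (Fin D) (Fin D) ℝ :=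
  Matrix.of fun k a => pd a (fun z => φ z k) y

/-- The pullback `φ^* A` of a matrix-valued one-form. -/
noncomputable def pullMat (φ : E D → E D) (A : Fin D → E D → Matrix (Fin D) (Fin D) ℝ) (a : Fin D)
    (y : E D) : Matrix (Fin D) (Fin D) ℝ :=
  ∑ l, jac φ y l a • A l (φ y)

variable {φ : E D → E D} {A : Fin D → E D → Matrix (Fin D) (Fin D) ℝ}

theorem contDiffOn_coord (hφ : ContDiffOn ℝ ∞ φ V) (k : Fin D) :
    ContDiffOn ℝ ∞ (fun z => φ z k) V :=
  (EuclideanSpace.proj k : E D →L[ℝ] ℝ).contDiff.comp_contDiffOn hφ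

theorem smoothMat_jac (hV : IsOpen V) (hφ : ContDiffOn ℝ ∞ φ V) : SmoothMat V (jac φ) :=
  fun k a => contDiffOn_pd hV a (contDiffOn_coord hφ k)

theorem SmoothMat.comp {N : E D → Matrix (Fin D) (Fin D) ℝ} (hN : SmoothMat S N)
    (hφ : ContDiffOn ℝ ∞ φ V) (hm : Set.MapsTo φ V S) : SmoothMat V (fun z => N (φ z)) :=
  fun i j => (hN i j).comp hφ hm

theorem pdMat_comp {N : E D → Matrix (Fin D) (Fin D) ℝ} (hV : IsOpen V) (hS : IsOpen S)
    (hφ : ContDiffOn ℝ ∞ φ V) (hm : Set.MapsTo φ V S) (hN : SmoothMat S N) (hy : y ∈ V)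
    (a : Fin D) : pdMat a (fun z => N (φ z)) y = pullMat φ (fun l => pdMat l N) a y := by
  ext i j
  have hφd : DifferentiableAt ℝ φ y :=
    (hφ.contDiffAt (hV.mem_nhds hy)).differentiableAt (by simp)
  simp only [pullMat, pdMat_apply, Matrix.sum_apply, Matrix.smul_apply, smul_eq_mul]
  rw [pd_comp (hN.differentiableAt hS (hm hy) i j) hφd]
  exact Finset.sum_congr rfl fun k _ => mul_comm _ _

/-- The Jacobian matrix is a closed vector-valued one-form. -/
theorem pd_jac_comm (hV : IsOpen V) (hφ : ContDiffOn ℝ ∞ φ V) (hy : y ∈ V) (k a b : Fin D) :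
    pd a (fun z => jac φ z k b) y = pd b (fun z => jac φ z k a) y :=
  pd_comm hV (contDiffOn_coord hφ k) hy a b

theorem smoothMat_pullMat (hV : IsOpen V) (hφ : ContDiffOn ℝ ∞ φ V) (hm : Set.MapsTo φ V S)
    (hA : ∀ a, SmoothMat S (A a)) (a : Fin D) : SmoothMat V (pullMat φ A a) :=
  smoothMat_sum fun l _ => smoothMat_smul (smoothMat_jac hV hφ l a) ((hA l).comp hφ hm)

/-- The curvature of a pulled back connection is the pulled back curvature. -/
theorem curvMat_pullMat (hV : IsOpen V) (hS : IsOpen S) (hφ : ContDiffOn ℝ ∞ φ V)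
    (hm : Set.MapsTo φ V S) (hA : ∀ a, SmoothMat S (A a)) (hy : y ∈ V) (a b : Fin D) :
    curvMat (pullMat φ A) a b y
      = ∑ k, ∑ l, (jac φ y k a * jac φ y l b) • curvMat A k l (φ y) := by
  have hd : ∀ a b, pdMat a (pullMat φ A b) y = ∑ l, pd a (fun z => jac φ z l b) y • A l (φ y)
      + ∑ k, ∑ l, (jac φ y k a * jac φ y l b) • pdMat k (A l) (φ y) := by
    intro a b
    have h1 : pdMat a (pullMat φ A b) y = ∑ l, pdMat a (fun z => jac φ z l b • A l (φ z)) y :=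
      pdMat_sum hV (fun l _ => smoothMat_smul (smoothMat_jac hV hφ l b) ((hA l).comp hφ hm)) hy a
    rw [h1, Finset.sum_comm, ← Finset.sum_add_distrib]
    refine Finset.sum_congr rfl fun l _ => ?_
    rw [pdMat_smul hV (smoothMat_jac hV hφ l b) ((hA l).comp hφ hm) hy,
      pdMat_comp hV hS hφ hm (hA l) hy, pullMat, Finset.smul_sum]
    congr 1
    refine Finset.sum_congr rfl fun k _ => ?_
    rw [smul_smul, mul_comm]
  have hm2 : ∀ a b, pullMat φ A a y * pullMat φ A b y
      = ∑ k, ∑ l, (jac φ y k a * jac φ y l b) • (A k (φ y) * A l (φ y)) := by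
    intro a b
    simp only [pullMat]
    rw [Finset.sum_mul_sum]
    exact Finset.sum_congr rfl fun k _ => Finset.sum_congr rfl fun l _ => smul_mul_smul_comm _ _ _ _
  have hsw : ∀ N : Fin D → Fin D → Matrix (Fin D) (Fin D) ℝ,
      ∑ k, ∑ l, (jac φ y k b * jac φ y l a) • N k l
        = ∑ k, ∑ l, (jac φ y k a * jac φ y l b) • N l k := by
    intro N
    rw [Finset.sum_comm]
    exact Finset.sum_congr rfl fun k _ => Finset.sum_congr rfl fun l _ => by rw [mul_comm]
  rw [curvMat, hd, hd, hm2, hm2, hsw, hsw]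
  simp only [pd_jac_comm hV hφ hy _ b a]
  simp only [curvMat, smul_add, smul_sub, Finset.sum_add_distrib, Finset.sum_sub_distrib]
  abel

/-- Behaviour of the curvature under the gauge transformation `J A' = A J + ∂J`. -/
theorem curvMat_gauge {A' : Fin D → E D → Matrix (Fin D) (Fin D) ℝ}
    {J : E D → Matrix (Fin D) (Fin D) ℝ} (hV : IsOpen V) (hJ : SmoothMat V J)
    (hA : ∀ a, SmoothMat V (A a)) (hA' : ∀ a, SmoothMat V (A' a))
    (h : ∀ z ∈ V, ∀ a, J z * A' a z = A a z * J z + pdMat a J z) (hy : y ∈ V) (a b : Fin D) :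
    J y * curvMat A' a b y = curvMat A a b y * J y := by
  have hd : ∀ a b, J y * pdMat a (A' b) y = pdMat a (A b) y * J y + A b y * pdMat a J y
      + pdMat a (pdMat b J) y - pdMat a J y * A' b y := by
    intro a b
    have h1 := pdMat_congr hV hy (fun z hz => h z hz b) a
    rw [pdMat_mul hJ (hA' b) hV hy, pdMat_add ((hA b).mul hJ) (hJ.pdMat hV b) hV hy,
      pdMat_mul (hA b) hJ hV hy] at h1
    rw [← h1]
    abel
  have hm : ∀ a b, J y * (A' a y * A' b y) = A a y * (A b y * J y + pdMat b J y)
      + pdMat a J y * A' b y := by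
    intro a b
    rw [← h y hy b, ← Matrix.mul_assoc, h y hy a]
    noncomm_ring
  simp only [curvMat, mul_add, mul_sub, hd, hm]
  rw [pdMat_comm hV hJ hy b a]
  noncomm_ring

theorem sum_rotate {ι : Type*} [Fintype ι] (f : ι → ι → ι → ℝ) :
    ∑ m, ∑ k, ∑ l, f m k l = ∑ l, ∑ k, ∑ m, f m k l := by
  calc ∑ m, ∑ k, ∑ l, f m k l = ∑ m, ∑ l, ∑ k, f m k l :=
        Finset.sum_congr rfl fun _ _ => Finset.sum_comm
    _ = ∑ l, ∑ m, ∑ k, f m k l := Finset.sum_comm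
    _ = ∑ l, ∑ k, ∑ m, f m k l := Finset.sum_congr rfl fun _ _ => Finset.sum_comm

variable {g g' : Comp₂ D}

/-- Naturality of the Ricci tensor: if `g' = φ^* g`, then `Ric(g') = φ^* Ric(g)`. -/
theorem ricci_pullback (hg : MetricOn S g) (hg' : MetricOn V g') (hφ : ContDiffOn ℝ ∞ φ V)
    (hm : Set.MapsTo φ V S) (hgg : ∀ z ∈ V, g' z = (jac φ z)ᵀ * g (φ z) * jac φ z) (hy : y ∈ V) :
    ricci (christoffel g') y = (jac φ y)ᵀ * ricci (christoffel g) (φ y) * jac φ y := by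
  have hV := hg'.isOpen
  have hS := hg.isOpen
  have hdet : ∀ z ∈ V, (jac φ z).det ≠ 0 := by
    intro z hz h0
    apply hg'.det_ne z hz
    rw [hgg z hz, Matrix.det_mul, h0, mul_zero]
  have hJ := smoothMat_jac hV hφ
  have hA := hg.smooth_christoffel
  set A := connMat (christoffel g) with hAdef
  have hP := smoothMat_pullMat hV hφ hm hA
  -- the Levi-Civita connection of `g'`: the gauge transform by `J` of the pulled back connection
  set A' : Fin D → E D → Matrix (Fin D) (Fin D) ℝ := fun a z =>
    (jac φ z)⁻¹ * (pullMat φ A a z * jac φ z + pdMat a (jac φ) z) with hA'def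
  have hJJ : ∀ z ∈ V, jac φ z * (jac φ z)⁻¹ = 1 := fun z hz =>
    Matrix.mul_nonsing_inv _ (hdet z hz).isUnit
  have hJJ' : ∀ z ∈ V, (jac φ z)⁻¹ * jac φ z = 1 := fun z hz =>
    Matrix.nonsing_inv_mul _ (hdet z hz).isUnit
  have hgauge : ∀ z ∈ V, ∀ a, jac φ z * A' a z
      = pullMat φ A a z * jac φ z + pdMat a (jac φ) z := by
    intro z hz a
    rw [hA'def]
    simp only
    rw [← Matrix.mul_assoc, hJJ z hz, one_mul]
  have hA' : ∀ a, SmoothMat V (A' a) := fun a =>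
    (hJ.inv hdet).mul (((hP a).mul hJ).add (hJ.pdMat hV a))
  set G : ConnCoeff D := fun z c a b => A' a z c b with hG
  have hconn : connMat G = A' := rfl
  have hLC : IsLeviCivitaOn V g' G := by
    refine ⟨?_, ?_⟩
    · intro z hz c a b
      have hs : ∀ k, (pullMat φ A a z * jac φ z + pdMat a (jac φ) z) k b
          = (pullMat φ A b z * jac φ z + pdMat b (jac φ) z) k a := by
        intro k
        rw [Matrix.add_apply, Matrix.add_apply, pdMat_apply, pdMat_apply,
          pd_jac_comm hV hφ hz k a b, Matrix.mul_apply, Matrix.mul_apply]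
        congr 1
        simp only [pullMat, Matrix.sum_apply, Matrix.smul_apply, smul_eq_mul, Finset.sum_mul]
        rw [Finset.sum_comm]
        refine Finset.sum_congr rfl fun l _ => Finset.sum_congr rfl fun m _ => ?_
        rw [show A l (φ z) k m = A m (φ z) k l from hg.christoffel_symm (hm hz) k l m]
        ring
      simp only [hG, hA'def]
      rw [Matrix.mul_apply, Matrix.mul_apply]
      exact Finset.sum_congr rfl fun k _ => by rw [hs]
    · intro z hz a
      have h1 := hgauge z hz a
      have hcomp : pdMat a (fun x => g (φ x)) z
          = (pullMat φ A a z)ᵀ * g (φ z) + g (φ z) * pullMat φ A a z := by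
        rw [pdMat_comp hV hS hφ hm hg.smooth hz]
        simp only [pullMat, hg.isLeviCivitaOn_christoffel.compat (φ z) (hm hz), ← hAdef,
          smul_add, Finset.sum_add_distrib, Matrix.transpose_sum, Matrix.transpose_smul,
          Finset.sum_mul, Finset.mul_sum, Matrix.smul_mul, Matrix.mul_smul]
      rw [hconn, pdMat_congr hV hz hgg,
        pdMat_mul (hJ.transpose.mul (hg.smooth.comp hφ hm)) hJ hV hz,
        pdMat_mul hJ.transpose (hg.smooth.comp hφ hm) hV hz, pdMat_transpose, hcomp, hgg z hz]
      have h2 : (A' a z)ᵀ * ((jac φ z)ᵀ * g (φ z) * jac φ z)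
          = (jac φ z * A' a z)ᵀ * g (φ z) * jac φ z := by
        generalize A' a z = X
        rw [Matrix.transpose_mul]
        noncomm_ring
      have h3 : (jac φ z)ᵀ * g (φ z) * jac φ z * A' a z
          = (jac φ z)ᵀ * g (φ z) * (jac φ z * A' a z) := by
        noncomm_ring
      rw [h2, h3, h1, Matrix.transpose_add, Matrix.transpose_mul]
      noncomm_ring
  have hric : ricci (christoffel g') y = ricci G y :=
    (ricci_congr hV hy fun z hz c a b => hLC.eq_christoffel hg' hz c a b).symm
  have hcurv : ∀ a b, curvMat A' a b y = (jac φ y)⁻¹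
      * (∑ k, ∑ l, (jac φ y k a * jac φ y l b) • curvMat A k l (φ y)) * jac φ y := by
    intro a b
    rw [← curvMat_pullMat hV hS hφ hm hA hy, Matrix.mul_assoc,
      ← curvMat_gauge hV hJ hP hA' hgauge hy, ← Matrix.mul_assoc, hJJ' y hy, one_mul]
  rw [hric]
  ext a c
  have hδ : ∀ k m, ∑ b, jac φ y k b * (jac φ y)⁻¹ b m = kd k m := by
    intro k m
    rw [← Matrix.mul_apply, hJJ y hy]
    simp [Matrix.one_apply, kd]
  have hR : ∀ l n, ricci (christoffel g) (φ y) l n = ∑ k, curvMat A k l (φ y) k n := by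
    intro l n
    simp only [ricci, Matrix.of_apply, riemann_eq_curvMat, ← hAdef]
  have hlhs : ricci G y a c = ∑ b, curvMat A' b a y b c := by
    simp only [ricci, Matrix.of_apply, riemann_eq_curvMat, hconn]
  have hterm : ∀ b, curvMat A' b a y b c = ∑ n, ∑ l, ∑ k, ∑ m,
      jac φ y k b * (jac φ y)⁻¹ b m * (curvMat A k l (φ y) m n * jac φ y l a * jac φ y n c) := by
    intro b
    rw [hcurv, Matrix.mul_apply]
    refine Finset.sum_congr rfl fun n _ => ?_
    rw [Matrix.mul_apply]
    simp only [Matrix.sum_apply, Matrix.smul_apply, smul_eq_mul, Finset.sum_mul, Finset.mul_sum]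
    rw [sum_rotate]
    exact Finset.sum_congr rfl fun _ _ => Finset.sum_congr rfl fun _ _ =>
      Finset.sum_congr rfl fun _ _ => by ring
  rw [hlhs, Matrix.mul_apply]
  simp only [hterm]
  rw [Finset.sum_comm]
  refine Finset.sum_congr rfl fun n _ => ?_
  rw [Matrix.mul_apply, Finset.sum_mul, Finset.sum_comm]
  refine Finset.sum_congr rfl fun l _ => ?_
  rw [Matrix.transpose_apply, hR, Finset.mul_sum, Finset.sum_mul, Finset.sum_comm]
  refine Finset.sum_congr rfl fun k _ => ?_
  rw [Finset.sum_comm]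
  simp only [← Finset.sum_mul, hδ, kd, ite_mul, one_mul, zero_mul, Finset.sum_ite_eq,
    Finset.mem_univ, if_true]
  ring

end Pullback

/-! ### Coordinate frames on a manifold -/

section Frames

variable {D : ℕ} {M : Type*} [TopologicalSpace M] [ChartedSpace (E D) M]
  {e e₀ : OpenPartialHomeomorph M (E D)} {y : E D}

theorem mdifferentiableAt_symm (he : e ∈ charts D M) (hy : y ∈ e.target) :
    MDifferentiableAt 𝓘(ℝ, E D) 𝓘(ℝ, E D) e.symm y :=
  ((contMDiffOn_symm_of_mem_maximalAtlas he).contMDiffAt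
    (e.open_target.mem_nhds hy)).mdifferentiableAt (by simp)

theorem mdifferentiableAt_chart (he : e ∈ charts D M) {x : M} (hx : x ∈ e.source) :
    MDifferentiableAt 𝓘(ℝ, E D) 𝓘(ℝ, E D) e x :=
  ((contMDiffOn_of_mem_maximalAtlas he).contMDiffAt
    (e.open_source.mem_nhds hx)).mdifferentiableAt (by simp)

/-- The derivative at `y` of the inverse of a chart, as an endomorphism of the model space. -/
noncomputable def symmDeriv (e : OpenPartialHomeomorph M (E D)) (y : E D) : E D →L[ℝ] E D :=
  mfderiv 𝓘(ℝ, E D) 𝓘(ℝ, E D) e.symm y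

/-- The derivative at `x` of a chart, as an endomorphism of the model space. -/
noncomputable def chartDeriv (e : OpenPartialHomeomorph M (E D)) (x : M) : E D →L[ℝ] E D :=
  mfderiv 𝓘(ℝ, E D) 𝓘(ℝ, E D) e x

/-- The derivative at `x` of a function, as a linear form on the model space, to which every tangent
space is definitionally equal. -/
noncomputable def funDeriv (f : M → ℝ) (x : M) : E D →L[ℝ] ℝ :=
  mfderiv 𝓘(ℝ, E D) 𝓘(ℝ) f x

/-- The coordinate vector `∂_i`, as a vector of the model space; definitionally equal to
`coordVec e y i`. -/
noncomputable def frame (e : OpenPartialHomeomorph M (E D)) (y : E D) (i : Fin D) : E D :=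
  symmDeriv e y (EuclideanSpace.single i 1)

theorem chartDeriv_comp_symmDeriv (he : e ∈ charts D M) (hy : y ∈ e.target) :
    (chartDeriv e (e.symm y)).comp (symmDeriv e y) = ContinuousLinearMap.id ℝ (E D) := by
  have h1 := (mdifferentiableAt_symm he hy).hasMFDerivAt
  have h2 := (mdifferentiableAt_chart he (e.map_target hy)).hasMFDerivAt
  have h3 : HasFDerivAt (e ∘ e.symm) ((chartDeriv e (e.symm y)).comp (symmDeriv e y)) y :=
    (HasMFDerivAt.comp y h2 h1).hasFDerivAt
  have h4 : HasFDerivAt (e ∘ e.symm) (ContinuousLinearMap.id ℝ (E D)) y :=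
    (hasFDerivAt_id y).congr_of_eventuallyEq
      (Filter.eventuallyEq_of_mem (e.open_target.mem_nhds hy) fun z hz => e.right_inv hz)
  exact h3.unique h4

theorem chartDeriv_symmDeriv (he : e ∈ charts D M) (hy : y ∈ e.target) (v : E D) :
    chartDeriv e (e.symm y) (symmDeriv e y v) = v :=
  DFunLike.congr_fun (chartDeriv_comp_symmDeriv he hy) v

theorem symmDeriv_chartDeriv (he : e ∈ charts D M) (hy : y ∈ e.target) (v : E D) :
    symmDeriv e y (chartDeriv e (e.symm y) v) = v := by
  have h : (chartDeriv e (e.symm y)).toLinearMap * (symmDeriv e y).toLinearMap = 1 :=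
    LinearMap.ext fun v => chartDeriv_symmDeriv he hy v
  exact LinearMap.congr_fun (mul_eq_one_comm.1 h) v

theorem coordCovec_coordVec (he : e ∈ charts D M) (hy : y ∈ e.target) (k i : Fin D) :
    coordCovec e (e.symm y) k (coordVec e y i) = kd k i := by
  have h2 : coordCovec e (e.symm y) k (coordVec e y i)
      = chartDeriv e (e.symm y) (symmDeriv e y (EuclideanSpace.single i 1)) k := rfl
  rw [h2, chartDeriv_symmDeriv he hy]
  simp [kd]

theorem sum_smul_single (v : E D) : ∑ k, v k • EuclideanSpace.single k (1 : ℝ) = v := by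
  ext j
  simp [Finset.sum_apply, Pi.single_apply]

theorem clm_eq_sum {F : Type*} [AddCommGroup F] [Module ℝ F] [TopologicalSpace F]
    (L : E D →L[ℝ] F) (v : E D) : L v = ∑ k, v k • L (EuclideanSpace.single k 1) := by
  conv_lhs => rw [← sum_smul_single v]
  rw [map_sum]
  simp only [map_smul]

/-- Expansion of a tangent vector in the coordinate frame. -/
theorem eq_sum_frame (he : e ∈ charts D M) (hy : y ∈ e.target) (v : E D) :
    v = ∑ k, chartDeriv e (e.symm y) v k • frame e y k := by
  conv_lhs => rw [← symmDeriv_chartDeriv he hy v, clm_eq_sum (symmDeriv e y)]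
  rfl

theorem bilin_sum (B : E D →L[ℝ] E D →L[ℝ] ℝ) (c d : Fin D → ℝ) (u v : Fin D → E D) :
    B (∑ k, c k • u k) (∑ l, d l • v l) = ∑ k, ∑ l, c k * d l * B (u k) (v l) := by
  simp only [map_sum, map_smul, _root_.sum_apply, _root_.smul_apply, smul_eq_mul, Finset.mul_sum]
  rw [Finset.sum_comm]
  exact Finset.sum_congr rfl fun _ _ => Finset.sum_congr rfl fun _ _ => by ring

theorem pd_comp_symm (he : e ∈ charts D M) (hy : y ∈ e.target) {f : M → ℝ}
    (hf : MDifferentiableAt 𝓘(ℝ, E D) 𝓘(ℝ) f (e.symm y)) (i : Fin D) :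
    pd i (fun z => f (e.symm z)) y = funDeriv f (e.symm y) (frame e y i) := by
  have h1 := (mdifferentiableAt_symm he hy).hasMFDerivAt
  have h3 : HasFDerivAt (fun z => f (e.symm z))
      ((funDeriv f (e.symm y)).comp (symmDeriv e y)) y :=
    (HasMFDerivAt.comp y hf.hasMFDerivAt h1).hasFDerivAt
  rw [pd, h3.fderiv]
  rfl

/-- The transition map between two charts is smooth. -/
theorem contDiffOn_transition (he : e ∈ charts D M) (he₀ : e₀ ∈ charts D M) {V : Set (E D)}
    (hV : V ⊆ e.target) (hVs : ∀ z ∈ V, e.symm z ∈ e₀.source) :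
    ContDiffOn ℝ ∞ (fun z => e₀ (e.symm z)) V := by
  rw [← contMDiffOn_iff_contDiffOn]
  exact (contMDiffOn_of_mem_maximalAtlas he₀).comp
    ((contMDiffOn_symm_of_mem_maximalAtlas he).mono hV) hVs

theorem frame_transition (he : e ∈ charts D M) (he₀ : e₀ ∈ charts D M) {V : Set (E D)}
    (hVo : IsOpen V) (hV : V ⊆ e.target) (hVs : ∀ z ∈ V, e.symm z ∈ e₀.source) (hy : y ∈ V)
    (a : Fin D) : frame e y a
      = ∑ k, jac (fun z => e₀ (e.symm z)) y k a • frame e₀ (e₀ (e.symm y)) k := by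
  set φ : E D → E D := fun z => e₀ (e.symm z)
  have hd : DifferentiableAt ℝ φ y :=
    ((contDiffOn_transition he he₀ hV hVs).contDiffAt (hVo.mem_nhds hy)).differentiableAt (by simp)
  have hφt : φ y ∈ e₀.target := e₀.map_source (hVs y hy)
  have h1 := (mdifferentiableAt_symm he₀ hφt).hasMFDerivAt
  have h3 := HasMFDerivAt.comp y h1 hd.hasFDerivAt.hasMFDerivAt
  have heq : (e.symm : E D → M) =ᶠ[𝓝 y] e₀.symm ∘ φ :=
    Filter.eventuallyEq_of_mem (hVo.mem_nhds hy) fun z hz => (e₀.left_inv (hVs z hz)).symm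
  have h4 : symmDeriv e y = (symmDeriv e₀ (φ y)).comp (fderiv ℝ φ y) :=
    (h3.congr_of_eventuallyEq heq).mfderiv
  have h5 : ∀ k, jac φ y k a = fderiv ℝ φ y (EuclideanSpace.single a 1) k := by
    intro k
    have : fderiv ℝ (fun z => φ z k) y
        = (EuclideanSpace.proj k : E D →L[ℝ] ℝ).comp (fderiv ℝ φ y) :=
      ((EuclideanSpace.proj k : E D →L[ℝ] ℝ).hasFDerivAt.comp y hd.hasFDerivAt).fderiv
    simp [jac, pd, this]
  rw [frame, h4, ContinuousLinearMap.comp_apply, clm_eq_sum (symmDeriv e₀ (φ y))]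
  simp only [h5]
  rfl

/-- The transformation law of the components of a covariant two-tensor. -/
theorem comp₂_transition (T : Field₂ D M) (he : e ∈ charts D M) (he₀ : e₀ ∈ charts D M)
    {V : Set (E D)} (hVo : IsOpen V) (hV : V ⊆ e.target) (hVs : ∀ z ∈ V, e.symm z ∈ e₀.source)
    (hy : y ∈ V) :
    comp₂ T e y = (jac (fun z => e₀ (e.symm z)) y)ᵀ * comp₂ T e₀ (e₀ (e.symm y))
      * jac (fun z => e₀ (e.symm z)) y := by
  -- transport along the propositional equality `e₀.symm (e₀ x) = x`
  have hT : ∀ x' x : M, x' = x → ∀ u v : E D, (T x' u v : ℝ) = T x u v := by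
    rintro x' x rfl u v
    rfl
  have hc := frame_transition he he₀ hVo hV hVs hy
  let B : E D →L[ℝ] E D →L[ℝ] ℝ := T (e.symm y)
  have h1 : ∀ k l, comp₂ T e₀ (e₀ (e.symm y)) k l
      = B (frame e₀ (e₀ (e.symm y)) k) (frame e₀ (e₀ (e.symm y)) l) := fun k l =>
    hT _ _ (e₀.left_inv (hVs y hy)) _ _
  ext a b
  have h2 : comp₂ T e y a b = B (frame e y a) (frame e y b) := rfl
  rw [h2, hc a, hc b, bilin_sum B, Matrix.mul_apply, Finset.sum_comm]
  refine Finset.sum_congr rfl fun l _ => ?_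
  rw [Matrix.mul_apply, Finset.sum_mul]
  refine Finset.sum_congr rfl fun k _ => ?_
  rw [h1, Matrix.transpose_apply]
  ring

theorem comp₂_smul (T : Field₂ D M) (c : M → ℝ) (e : OpenPartialHomeomorph M (E D)) :
    comp₂ (fun x => c x • T x) e = fun z => c (e.symm z) • comp₂ T e z := by
  ext z i j
  rfl

theorem metricOn_comp₂ (g : PseudoRiemannianMetric D M) (he : e ∈ charts D M) :
    MetricOn e.target (comp₂ g.val e) where
  isOpen := e.open_target
  smooth i j := g.smooth e he i j
  symm z _ := by
    ext i j
    exact g.symm _ _ _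
  det_ne z hz := by
    intro h0
    obtain ⟨v, hv0, hv⟩ := Matrix.exists_mulVec_eq_zero_iff.2 h0
    apply hv0
    let B : E D →L[ℝ] E D →L[ℝ] ℝ := g.val (e.symm z)
    have hu : symmDeriv e z (WithLp.toLp 2 v) = 0 := by
      refine g.nondegenerate (e.symm z) _ ?_
      suffices ∀ w : E D, B (symmDeriv e z (WithLp.toLp 2 v)) w = 0 from this
      intro w
      rw [clm_eq_sum (symmDeriv e z), eq_sum_frame he hz w, bilin_sum, Finset.sum_comm]
      refine Finset.sum_eq_zero fun i _ => ?_
      have h := congrFun hv i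
      simp only [Matrix.mulVec, dotProduct, Pi.zero_apply] at h
      rw [← mul_zero (chartDeriv e (e.symm z) w i), ← h, Finset.mul_sum]
      refine Finset.sum_congr rfl fun j _ => ?_
      have h1 : comp₂ g.val e z i j
          = B (symmDeriv e z (EuclideanSpace.single j 1)) (frame e z i) :=
        g.symm (e.symm z) _ _
      rw [h1]
      ring
    have h := chartDeriv_symmDeriv he hz (WithLp.toLp 2 v)
    rw [hu, map_zero] at h
    ext k
    exact (congrArg (fun x : E D => x k) h).symm

end Frames

/-! ### Conformal scales in a chart -/

section Scales

variable {D : ℕ} {V : Set (E D)} {y : E D} {g : Comp₂ D} {Υ : Comp₁ D} {w : E D → ℝ}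

/-- `Υ = d log Ω` and `w = Ω⁻²` for some smooth positive function `Ω`, on the open set `V`. -/
structure ScaleOn (V : Set (E D)) (Υ : Comp₁ D) (w : E D → ℝ) : Prop where
  smooth_form : ∀ i, ContDiffOn ℝ ∞ (fun z => Υ z i) V
  closed : ∀ z ∈ V, ∀ i j, pd i (fun z => Υ z j) z = pd j (fun z => Υ z i) z
  smooth_factor : ContDiffOn ℝ ∞ w V
  factor_ne : ∀ z ∈ V, w z ≠ 0
  pd_factor : ∀ z ∈ V, ∀ a, pd a w z = -2 * w z * Υ z a

theorem scaleOn_of_log {f : E D → ℝ} (hV : IsOpen V) (hf : ContDiffOn ℝ ∞ f V)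
    (hΥ : ∀ z ∈ V, ∀ i, Υ z i = pd i f z) (hw : ∀ z ∈ V, w z = (Real.exp (f z) ^ 2)⁻¹) :
    ScaleOn V Υ w where
  smooth_form i := (contDiffOn_pd hV i hf).congr fun z hz => hΥ z hz i
  closed z hz i j := by
    rw [pd_congr hV hz fun x hx => hΥ x hx j, pd_congr hV hz fun x hx => hΥ x hx i]
    exact pd_comm hV hf hz i j
  smooth_factor :=
    ((hf.exp.pow 2).inv fun z _ => pow_ne_zero _ (Real.exp_ne_zero _)).congr hw
  factor_ne z hz := by
    rw [hw z hz]
    exact inv_ne_zero (pow_ne_zero _ (Real.exp_ne_zero _))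
  pd_factor z hz a := by
    have hw' : ∀ x ∈ V, w x = Real.exp (-2 * f x) := by
      intro x hx
      rw [hw x hx, ← Real.exp_nat_mul, ← Real.exp_neg]
      norm_num
    have hd := differentiableAt_of_contDiffOn hV hf hz
    rw [pd_congr hV hz hw', hw' z hz, hΥ z hz, pd, fderiv_exp (hd.const_mul _),
      fderiv_const_mul hd]
    simp [pd]
    ring

theorem MetricOn.contDiffOn_ricci (hg : MetricOn V g) (a c : Fin D) :
    ContDiffOn ℝ ∞ (fun z => ricci (christoffel g) z a c) V := by
  simp only [ricci, Matrix.of_apply, riemann_eq_curvMat]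
  exact ContDiffOn.sum fun b _ => smoothMat_curvMat hg.isOpen hg.smooth_christoffel b a b c

/-- Schur's lemma on a connected open set: if the Ricci tensor is pointwise proportional to the
metric, then the factor is constant. -/
theorem MetricOn.exists_einstein_const (hD : 3 ≤ D) (hg : MetricOn V g) (hV : IsPreconnected V)
    {ρ : E D → ℝ} (hρ : ContDiffOn ℝ ∞ ρ V)
    (hE : ∀ z ∈ V, ricci (christoffel g) z = ρ z • g z) :
    ∃ κ : ℝ, ∀ z ∈ V, ricci (christoffel g) z = κ • g z := by
  have hD3 : (3 : ℝ) ≤ D := by exact_mod_cast hD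
  have h0 : V.EqOn (fderiv ℝ ρ) 0 := by
    intro z hz
    ext v
    rw [clm_eq_sum]
    refine Finset.sum_eq_zero fun k _ => ?_
    have h := hg.schur hρ hE hz k
    have h1 : pd k ρ z = 0 := by
      rcases mul_eq_zero.1 h with h | h
      · linarith
      · exact h
    rw [show fderiv ℝ ρ z (EuclideanSpace.single k 1) = pd k ρ z from rfl, h1, smul_zero]
  obtain ⟨κ, hκ⟩ := hg.isOpen.exists_is_const_of_fderiv_eq_zero hV
    (hρ.differentiableOn (by simp)) h0
  exact ⟨κ, fun z hz => by rw [hE z hz, hκ z hz]⟩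

/-- The closed form `η` has a smooth primitive on a ball. -/
theorem exists_primitive {η : Comp₁ D} {x : E D} {r : ℝ}
    (hη : ∀ i, ContDiffOn ℝ ∞ (fun z => η z i) (Metric.ball x r))
    (hcl : ∀ z ∈ Metric.ball x r, ∀ i j, pd i (fun z => η z j) z = pd j (fun z => η z i) z) :
    ∃ f : E D → ℝ, ContDiffOn ℝ ∞ f (Metric.ball x r) ∧
      ∀ z ∈ Metric.ball x r, ∀ i, pd i f z = η z i := by
  set B := Metric.ball x r
  have hB : IsOpen B := Metric.isOpen_ball
  set α : E D → E D →L[ℝ] ℝ := fun z => ∑ i, η z i • (EuclideanSpace.proj i : E D →L[ℝ] ℝ) with hα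
  have hαs : ContDiffOn ℝ ∞ α B :=
    ContDiffOn.sum fun i _ => (hη i).smul contDiffOn_const
  have hαi : ∀ z i, α z (EuclideanSpace.single i 1) = η z i := by
    intro z i
    simp [hα]
  have hd : ∀ z ∈ B, ∀ i j, fderiv ℝ α z (EuclideanSpace.single i 1) (EuclideanSpace.single j 1)
      = pd i (fun z => η z j) z := by
    intro z hz i j
    have hdz : DifferentiableAt ℝ α z :=
      (hαs.contDiffAt (hB.mem_nhds hz)).differentiableAt (by simp)
    have h1 : (fun z => η z j) = fun z => α z (EuclideanSpace.single j 1) := by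
      ext z; rw [hαi]
    rw [pd, h1, fderiv_clm_apply hdz (differentiableAt_const _)]
    simp
  obtain ⟨f, hf⟩ := (convex_ball x r).exists_forall_hasFDerivAt_of_fderiv_symmetric hB
    (hαs.differentiableOn (by simp)) (by
      intro z hz u v
      rw [← sum_smul_single u, ← sum_smul_single v]
      simp only [map_sum, map_smul, _root_.sum_apply, _root_.smul_apply, hd z hz, smul_eq_mul,
        Finset.mul_sum]
      rw [Finset.sum_comm]
      refine Finset.sum_congr rfl fun i _ => Finset.sum_congr rfl fun j _ => ?_
      rw [hcl z hz i j]
      ring)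
  refine ⟨f, ?_, ?_⟩
  · refine (contDiffOn_infty_iff_fderiv_of_isOpen hB).2
      ⟨fun z hz => (hf z hz).differentiableAt.differentiableWithinAt, ?_⟩
    exact hαs.congr fun z hz => (hf z hz).fderiv
  · intro z hz i
    rw [pd, (hf z hz).fderiv, hαi]

end Scales

/-! ### Einstein scales on a manifold -/

section Global

variable {D : ℕ} {M : Type*} [TopologicalSpace M] [ChartedSpace (E D) M]
  {e e₀ : OpenPartialHomeomorph M (E D)} {y : E D} {g : PseudoRiemannianMetric D M}
  {U : Set M} {f Ω : M → ℝ} {Λ : Field₁ D M}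

theorem isOpen_chart_preimage {D : ℕ} {M : Type*} [TopologicalSpace M] {U : Set M}
    (e : OpenPartialHomeomorph M (E D)) (hU : IsOpen U) : IsOpen (e.target ∩ e.symm ⁻¹' U) :=
  e.symm.isOpen_inter_preimage hU

theorem mdifferentiableAt_of_contMDiffOn (hU : IsOpen U)
    (hf : ContMDiffOn 𝓘(ℝ, E D) 𝓘(ℝ) ∞ f U) {x : M} (hx : x ∈ U) :
    MDifferentiableAt 𝓘(ℝ, E D) 𝓘(ℝ) f x :=
  (hf.contMDiffAt (hU.mem_nhds hx)).mdifferentiableAt (by simp)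

theorem contDiffOn_comp_symm (he : e ∈ charts D M) (hf : ContMDiffOn 𝓘(ℝ, E D) 𝓘(ℝ) ∞ f U) :
    ContDiffOn ℝ ∞ (fun z => f (e.symm z)) (e.target ∩ e.symm ⁻¹' U) := by
  rw [← contMDiffOn_iff_contDiffOn]
  exact hf.comp ((contMDiffOn_symm_of_mem_maximalAtlas he).mono Set.inter_subset_left)
    fun z hz => hz.2

/-- If `Λ = df` and `Ω = exp f` on `U`, then `Λ` and `Ω⁻²` form a scale in every chart. -/
theorem scaleOn_chart (he : e ∈ charts D M) (hU : IsOpen U)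
    (hf : ContMDiffOn 𝓘(ℝ, E D) 𝓘(ℝ) ∞ f U) (hΛ : ∀ x ∈ U, ∀ v : E D, Λ x v = funDeriv f x v)
    (hΩ : ∀ x ∈ U, Ω x = Real.exp (f x)) :
    ScaleOn (e.target ∩ e.symm ⁻¹' U) (comp₁ Λ e) (fun z => (Ω (e.symm z) ^ 2)⁻¹) := by
  refine scaleOn_of_log (isOpen_chart_preimage e hU) (contDiffOn_comp_symm he hf) ?_ ?_
  · intro z hz i
    rw [pd_comp_symm he hz.1 (mdifferentiableAt_of_contMDiffOn hU hf hz.2)]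
    exact hΛ _ hz.2 _
  · intro z hz
    rw [hΩ _ hz.2]

theorem metricOn_chart (he : e ∈ charts D M) (hU : IsOpen U) (g : PseudoRiemannianMetric D M) :
    MetricOn (e.target ∩ e.symm ⁻¹' U) (comp₂ g.val e) :=
  (metricOn_comp₂ g he).mono (isOpen_chart_preimage e hU) Set.inter_subset_left

/-- If `Λ = df` near `x` and the Ricci tensor of the `𝒞`-connection of `Λ` is symmetric and
trace-free, then `exp (-2 f) g` is Einstein near `x`. -/
theorem exists_einstein_nhds [IsManifold 𝓘(ℝ, E D) ∞ M] (hD : 3 ≤ D) (hU : IsOpen U)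
    (hf : ContMDiffOn 𝓘(ℝ, E D) 𝓘(ℝ) ∞ f U) (hΛ : ∀ x ∈ U, ∀ v : E D, Λ x v = funDeriv f x v)
    (hΩ : ∀ x ∈ U, Ω x = Real.exp (f x)) (hR : CRicciSymmTraceFree g Λ) {x : M} (hx : x ∈ U) :
    ∃ U' ⊆ U, IsOpen U' ∧ x ∈ U' ∧ ∃ κ : ℝ, ∀ e ∈ charts D M, ∀ y ∈ e.target, e.symm y ∈ U' →
      ricci (christoffel (comp₂ (fun x => (Ω x ^ 2)⁻¹ • g.val x) e)) y
        = κ • comp₂ (fun x => (Ω x ^ 2)⁻¹ • g.val x) e y := by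
  set T : Field₂ D M := fun x => (Ω x ^ 2)⁻¹ • g.val x with hT
  have hmet : ∀ e ∈ charts D M, MetricOn (e.target ∩ e.symm ⁻¹' U) (comp₂ T e) := by
    intro e he
    have hs := scaleOn_chart he hU hf hΛ hΩ
    rw [hT, comp₂_smul]
    exact (metricOn_chart he hU g).smul hs.smooth_factor hs.factor_ne
  set e₀ := chartAt (E D) x
  have he₀ : e₀ ∈ charts D M := IsManifold.chart_mem_maximalAtlas x
  have hs := scaleOn_chart he₀ hU hf hΛ hΩ
  set V₀ := e₀.target ∩ e₀.symm ⁻¹' U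
  set w : E D → ℝ := fun z => (Ω (e₀.symm z) ^ 2)⁻¹
  set G := comp₂ g.val e₀
  have hgV : MetricOn V₀ G := metricOn_chart he₀ hU g
  have hTe : comp₂ T e₀ = fun z => w z • G z := comp₂_smul _ _ _
  have hV₀o : IsOpen V₀ := isOpen_chart_preimage e₀ hU
  have hxs : x ∈ e₀.source := mem_chart_source (E D) x
  have hxV : e₀ x ∈ V₀ := ⟨e₀.map_source hxs, by simpa [e₀.left_inv hxs] using hx⟩
  obtain ⟨r, hr, hball⟩ := Metric.isOpen_iff.1 hV₀o _ hxV
  have hgB : MetricOn (Metric.ball (e₀ x) r) (comp₂ T e₀) :=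
    (hmet e₀ he₀).mono Metric.isOpen_ball hball
  -- in the preferred chart the Ricci tensor is proportional to the metric
  obtain ⟨κ, hκ⟩ := hgB.exists_einstein_const hD (convex_ball _ _).isPreconnected
    (ρ := fun z => 1 / (D : ℝ) * traceWith G (ricci (christoffel (comp₂ T e₀))) z * (w z)⁻¹)
    (by
      refine ContDiffOn.mono ?_ hball
      refine (contDiffOn_const.mul ?_).mul (hs.smooth_factor.inv hs.factor_ne)
      exact ContDiffOn.sum fun a _ => ContDiffOn.sum fun b _ =>
        (hgV.smooth_inv a b).mul ((hmet e₀ he₀).contDiffOn_ricci a b))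
    (by
      intro z hz
      have hzV := hball hz
      have hric : ricci (christoffel (comp₂ T e₀)) z = ricci (cConn G (comp₁ Λ e₀)) z := by
        rw [hTe]
        exact hgV.ricci_conformal hzV hs.smooth_factor hs.factor_ne hs.pd_factor
      have htr : traceWith G (ricci (christoffel (comp₂ T e₀))) z
          = traceWith G (ricci (cConn G (comp₁ Λ e₀))) z := by
        simp only [traceWith, hric]
      ext a b
      obtain ⟨h1, h2⟩ := hR e₀ he₀ z hzV.1 a b
      have hw0 := hs.factor_ne z hzV
      rw [Matrix.smul_apply, smul_eq_mul, htr, hric, hTe]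
      simp only [Matrix.smul_apply, smul_eq_mul]
      rw [show (1 / (D : ℝ) * traceWith G (ricci (cConn G (comp₁ Λ e₀))) z * (w z)⁻¹)
          * (w z * G z a b) = 1 / (D : ℝ) * G z a b
            * traceWith G (ricci (cConn G (comp₁ Λ e₀))) z by field_simp]
      linarith)
  have hU'o : IsOpen (e₀.source ∩ e₀ ⁻¹' Metric.ball (e₀ x) r) :=
    e₀.isOpen_inter_preimage Metric.isOpen_ball
  refine ⟨e₀.source ∩ e₀ ⁻¹' Metric.ball (e₀ x) r, ?_, hU'o,
    ⟨hxs, Metric.mem_ball_self hr⟩, κ, ?_⟩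
  · rintro z ⟨hz1, hz2⟩
    have h := (hball hz2).2
    rwa [Set.mem_preimage, e₀.left_inv hz1] at h
  -- in any other chart, pull back along the transition map
  · intro e he y hy hyU
    have hVo := isOpen_chart_preimage e hU'o
    have hsub : e.target ∩ e.symm ⁻¹' (e₀.source ∩ e₀ ⁻¹' Metric.ball (e₀ x) r)
        ⊆ e.target ∩ e.symm ⁻¹' U := by
      rintro z ⟨hz1, hz2, hz3⟩
      have h := (hball hz3).2
      rw [Set.mem_preimage, e₀.left_inv hz2] at h
      exact ⟨hz1, h⟩
    have hVs : ∀ z ∈ e.target ∩ e.symm ⁻¹' (e₀.source ∩ e₀ ⁻¹' Metric.ball (e₀ x) r),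
        e.symm z ∈ e₀.source := fun z hz => hz.2.1
    have htrans := fun z hz =>
      comp₂_transition T he he₀ hVo Set.inter_subset_left hVs (y := z) hz
    rw [ricci_pullback hgB ((hmet e he).mono hVo hsub)
      (contDiffOn_transition he he₀ Set.inter_subset_left hVs) (fun z hz => hz.2.2) htrans
      ⟨hy, hyU⟩, hκ _ hyU.2, htrans y ⟨hy, hyU⟩]
    simp only [Matrix.mul_smul, Matrix.smul_mul]

/-- The vector-valued two-form `(u, v) ↦ -½ (l(v) u - l(u) v)`, with components
`-δ^p{}_{[m} l_{n]}`. -/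
noncomputable def deltaWedge (l : E D →L[ℝ] ℝ) : E D →L[ℝ] E D →L[ℝ] E D :=
  (-(1 / 2 : ℝ)) • (ContinuousLinearMap.smulRightL ℝ (E D) (E D) l
    - (ContinuousLinearMap.smulRightL ℝ (E D) (E D) l).flip)

theorem deltaWedge_apply (l : E D →L[ℝ] ℝ) (u v : E D) :
    deltaWedge l u v = (-(1 / 2 : ℝ)) • (l v • u - l u • v) := by
  simp [deltaWedge]

theorem deltaWedge_skew (l : E D →L[ℝ] ℝ) (u v : E D) : deltaWedge l u v = -deltaWedge l v u := by
  rw [deltaWedge_apply, deltaWedge_apply, ← smul_neg, neg_sub]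

theorem deltaWedge_comp (he : e ∈ charts D M) (hy : y ∈ e.target) (l : E D →L[ℝ] ℝ)
    (p m n : Fin D) :
    chartDeriv e (e.symm y) (deltaWedge l (frame e y m) (frame e y n)) p
      = -(1 / 2) * (kd p m * l (frame e y n) - kd p n * l (frame e y m)) := by
  have h : ∀ i, chartDeriv e (e.symm y) (frame e y i) p = kd p i := fun i =>
    coordCovec_coordVec he hy p i
  rw [deltaWedge_apply, map_smul, map_sub, map_smul, map_smul]
  simp only [PiLp.smul_apply, PiLp.sub_apply, h, smul_eq_mul]
  ring

/-- The vector-valued two-form `-δ^p{}_{[m} Λ_{n]}` of a smooth one-form `Λ`. -/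
noncomputable def deltaForm (Λ : Field₁ D M) (hΛ : SmoothForm Λ) : VectorTwoForm D M where
  val x := deltaWedge (Λ x)
  skew x u v := deltaWedge_skew (Λ x) u v
  smooth e he p m n := by
    have h : ContDiffOn ℝ ∞ (fun y => -(1 / 2) * (kd p m * comp₁ Λ e y n
        - kd p n * comp₁ Λ e y m)) e.target :=
      contDiffOn_const.mul ((contDiffOn_const.mul (hΛ e he n)).sub
        (contDiffOn_const.mul (hΛ e he m)))
    exact h.congr fun y hy => deltaWedge_comp he hy (Λ (e.symm y)) p m n

theorem sum_smul_clm_apply (c : Fin D → ℝ) (η : Fin D → E D →L[ℝ] ℝ) (v : E D) :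
    (∑ q, c q • η q) v = ∑ q, c q * η q v := by
  simp

/-- If `Ω⁻² g` is Einstein, then `ξ^p{}_{mn} = -δ^p{}_{[m} Λ_{n]}` with `Λ = d log Ω` satisfies the
condition, because `Λ^ξ = Λ`. -/
theorem exists_xiCondition [IsManifold 𝓘(ℝ, E D) ∞ M] (hD : 3 ≤ D) (h : BivectorMetric D M)
    (hE : ConformallyEinstein g) : ∃ ξ : VectorTwoForm D M, XiCondition g h ξ := by
  have hD3 : (3 : ℝ) ≤ D := by exact_mod_cast hD
  obtain ⟨Ω, hΩs, hΩpos, κ, hκ⟩ := hE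
  set f : M → ℝ := fun x => Real.log (Ω x)
  have hfs : ContMDiffOn 𝓘(ℝ, E D) 𝓘(ℝ) ∞ f Set.univ := by
    intro x hx
    exact ContMDiffAt.comp_contMDiffWithinAt x
      (Real.contDiffAt_log.2 (hΩpos x hx).ne').contMDiffAt (hΩs x hx)
  let Λ : Field₁ D M := fun x => funDeriv f x
  have hΩexp : ∀ x ∈ (Set.univ : Set M), Ω x = Real.exp (f x) := fun x hx =>
    (Real.exp_log (hΩpos x hx)).symm
  have hscale : ∀ e ∈ charts D M, ScaleOn e.target (comp₁ Λ e)
      (fun z => (Ω (e.symm z) ^ 2)⁻¹) := by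
    intro e he
    have hs := scaleOn_chart (Λ := Λ) he isOpen_univ hfs (fun _ _ _ => rfl) hΩexp
    rwa [Set.preimage_univ, Set.inter_univ] at hs
  have hric : ∀ e ∈ charts D M, ∀ y ∈ e.target,
      ricci (cConn (comp₂ g.val e) (comp₁ Λ e)) y
        = (κ * (Ω (e.symm y) ^ 2)⁻¹) • comp₂ g.val e y := by
    intro e he y hy
    have hs := hscale e he
    rw [← (metricOn_comp₂ g he).ricci_conformal hy hs.smooth_factor hs.factor_ne hs.pd_factor]
    have h1 := hκ e he y hy (Set.mem_univ _)
    rw [comp₂_smul] at h1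
    rw [h1, smul_smul]
  have hΛs : SmoothForm Λ := fun e he => (hscale e he).smooth_form
  set ξ := deltaForm Λ hΛs
  -- `Λ^ξ = Λ`
  have hlam : lambdaXi g h ξ = Λ := by
    funext x
    set e := chartAt (E D) x
    have he : e ∈ charts D M := IsManifold.chart_mem_maximalAtlas x
    have hxs : x ∈ e.source := mem_chart_source (E D) x
    have hy : e x ∈ e.target := e.map_source hxs
    have hs := hscale e he
    have hcomp : ∀ q, lambdaComp (comp₂ g.val e) (h.comp e) (ξ.comp e) (e x) q
        = comp₁ Λ e (e x) q :=
      (metricOn_comp₂ g he).lambdaComp_of_einstein hD hy hs.smooth_form hs.closed hs.smooth_factor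
        hs.pd_factor (hric e he) (h.comp e) (ξ.comp e)
        (fun p m n => deltaWedge_comp he hy (Λ (e.symm (e x))) p m n)
    -- transport along the propositional equality `e.symm (e x) = x`
    have hinv : ∀ x', x' = x → ∀ (v : E D) (q : Fin D), chartDeriv e x' v q = chartDeriv e x v q ∧
        (Λ x' v : ℝ) = Λ x v := by
      rintro x' rfl v q
      exact ⟨rfl, rfl⟩
    refine ContinuousLinearMap.ext fun v => ?_
    let l : E D →L[ℝ] ℝ := Λ (e.symm (e x))
    have h1 : (lambdaXi g h ξ x v : ℝ) = ∑ q, comp₁ Λ e (e x) q * chartDeriv e x v q := by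
      have h2 : (lambdaXi g h ξ x v : ℝ) = ∑ q, lambdaComp (comp₂ g.val e) (h.comp e) (ξ.comp e)
          (e x) q * chartDeriv e x v q := sum_smul_clm_apply _ (fun q => coordCovec e x q) v
      rw [h2]
      exact Finset.sum_congr rfl fun q _ => by rw [hcomp]
    have h3 : l v = ∑ q, comp₁ Λ e (e x) q * chartDeriv e x v q := by
      conv_lhs => rw [eq_sum_frame he hy v, map_sum]
      refine Finset.sum_congr rfl fun q _ => ?_
      rw [map_smul, smul_eq_mul, mul_comm, (hinv _ (e.left_inv hxs) v q).1]
      rfl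
    rw [h1, ← h3]
    exact (hinv _ (e.left_inv hxs) v ⟨0, by omega⟩).2
  refine ⟨ξ, ?_, ?_, ?_⟩
  · rw [hlam]
    exact hΛs
  · rw [hlam]
    exact fun e he => (hscale e he).closed
  · rw [hlam]
    intro e he y hy a b
    have hg := metricOn_comp₂ g he
    have htr : traceWith (comp₂ g.val e) (ricci (cConn (comp₂ g.val e) (comp₁ Λ e))) y
        = κ * (Ω (e.symm y) ^ 2)⁻¹ * D := by
      simp only [traceWith, hric e he y hy, Matrix.smul_apply, smul_eq_mul]
      rw [← hg.sum_inv_metric hy, Finset.mul_sum]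
      refine Finset.sum_congr rfl fun a _ => ?_
      rw [Finset.mul_sum]
      exact Finset.sum_congr rfl fun b _ => by ring
    rw [htr, hric e he y hy]
    simp only [Matrix.smul_apply, smul_eq_mul, hg.symm' hy b a]
    refine ⟨by ring, ?_⟩
    field_simp
    ring

/-- The Poincaré lemma on a manifold: a smooth closed one-form has local primitives. -/
theorem exists_local_primitive [IsManifold 𝓘(ℝ, E D) ∞ M] (hs : SmoothForm Λ)
    (hc : ClosedForm Λ) (x : M) :
    ∃ U : Set M, IsOpen U ∧ x ∈ U ∧ ∃ f : M → ℝ, ContMDiffOn 𝓘(ℝ, E D) 𝓘(ℝ) ∞ f U ∧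
      ∀ z ∈ U, ∀ v : E D, Λ z v = funDeriv f z v := by
  set e := chartAt (E D) x
  have he : e ∈ charts D M := IsManifold.chart_mem_maximalAtlas x
  have hxs : x ∈ e.source := mem_chart_source (E D) x
  obtain ⟨r, hr, hball⟩ := Metric.isOpen_iff.1 e.open_target _ (e.map_source hxs)
  obtain ⟨f, hfs, hf⟩ := exists_primitive (η := comp₁ Λ e) (x := e x) (r := r)
    (fun i => (hs e he i).mono hball) (fun z hz => hc e he z (hball hz))
  have hUo : IsOpen (e.source ∩ e ⁻¹' Metric.ball (e x) r) :=
    e.isOpen_inter_preimage Metric.isOpen_ball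
  have hFs : ContMDiffOn 𝓘(ℝ, E D) 𝓘(ℝ) ∞ (fun z => f (e z))
      (e.source ∩ e ⁻¹' Metric.ball (e x) r) :=
    hfs.contMDiffOn.comp ((contMDiffOn_of_mem_maximalAtlas he).mono Set.inter_subset_left)
      fun z hz => hz.2
  refine ⟨_, hUo, ⟨hxs, Metric.mem_ball_self hr⟩, fun z => f (e z), hFs, ?_⟩
  have key : ∀ y ∈ Metric.ball (e x) r, ∀ v : E D,
      Λ (e.symm y) v = funDeriv (fun z => f (e z)) (e.symm y) v := by
    intro y hy v
    have hyt := hball hy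
    let l : E D →L[ℝ] ℝ := Λ (e.symm y)
    change l v = _
    have hmem : e.symm y ∈ e.source ∩ e ⁻¹' Metric.ball (e x) r :=
      ⟨e.map_target hyt, by simpa [e.right_inv hyt] using hy⟩
    rw [eq_sum_frame he hyt v, map_sum, map_sum]
    refine Finset.sum_congr rfl fun k _ => ?_
    rw [map_smul, map_smul]
    congr 1
    rw [← pd_comp_symm he hyt (mdifferentiableAt_of_contMDiffOn hUo hFs hmem),
      pd_congr Metric.isOpen_ball hy (f₂ := f)
        (fun z hz => by simp only [e.right_inv (hball hz)]), hf y hy]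
    rfl
  rintro z ⟨hz1, hz2⟩ v
  have h := key (e z) hz2
  rw [e.left_inv hz1] at h
  exact h v

theorem funDeriv_exp {x : M} (hf : MDifferentiableAt 𝓘(ℝ, E D) 𝓘(ℝ) f x) (v : E D) :
    funDeriv (fun z => Real.exp (f z)) x v = Real.exp (f x) * funDeriv f x v := by
  have h := HasMFDerivAt.comp x (Real.hasDerivAt_exp (f x)).hasFDerivAt.hasMFDerivAt hf.hasMFDerivAt
  have h2 : funDeriv (fun z => Real.exp (f z)) x = _ := h.mfderiv
  rw [h2]
  change ContinuousLinearMap.toSpanSingleton ℝ (Real.exp (f x)) (funDeriv f x v) = _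
  simp [mul_comm]

/-- With a global primitive of `Λ` the local Einstein constants agree, as the manifold is
connected. -/
theorem conformallyEinstein_of_primitive [IsManifold 𝓘(ℝ, E D) ∞ M] [ConnectedSpace M] (hD : 3 ≤ D)
    (hf : ContMDiff 𝓘(ℝ, E D) 𝓘(ℝ) ∞ f) (hΛ : ∀ x, ∀ v : E D, Λ x v = funDeriv f x v)
    (hR : CRicciSymmTraceFree g Λ) : ConformallyEinstein g := by
  set Ω : M → ℝ := fun x => Real.exp (f x)
  have hloc : ∀ x : M, _ := fun x => exists_einstein_nhds (Ω := Ω) hD isOpen_univ hf.contMDiffOn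
    (fun x _ => hΛ x) (fun _ _ => rfl) hR (Set.mem_univ x)
  choose N _ hNo hxN K hK using hloc
  -- two Einstein constants at a common point agree, as the metric does not vanish there
  have hlc : IsLocallyConstant K := by
    refine (IsLocallyConstant.iff_exists_open K).2 fun x => ⟨N x, hNo x, hxN x, fun z hz => ?_⟩
    set e := chartAt (E D) z
    have he : e ∈ charts D M := IsManifold.chart_mem_maximalAtlas z
    have hzs : z ∈ e.source := mem_chart_source (E D) z
    have hy : e z ∈ e.target := e.map_source hzs
    have h1 := hK z e he (e z) hy (by rw [e.left_inv hzs]; exact hxN z)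
    have h2 := hK x e he (e z) hy (by rw [e.left_inv hzs]; exact hz)
    rw [h1] at h2
    have hdet := (metricOn_comp₂ g he).det_ne _ hy
    have hne : comp₂ (fun x => (Ω x ^ 2)⁻¹ • g.val x) e (e z) ≠ 0 := by
      rw [comp₂_smul]
      refine smul_ne_zero (inv_ne_zero (pow_ne_zero _ (Real.exp_ne_zero _))) fun h0 => hdet ?_
      have : Nonempty (Fin D) := ⟨⟨0, by omega⟩⟩
      rw [h0, Matrix.det_zero]
    exact smul_left_injective ℝ hne h2
  obtain ⟨x₀⟩ := (inferInstance : Nonempty M)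
  refine ⟨Ω, (Real.contDiff_exp.contMDiff.comp hf).contMDiffOn, fun x _ => Real.exp_pos _,
    K x₀, fun e he y hy _ => ?_⟩
  rw [hK (e.symm y) e he y hy (hxN _), hlc.apply_eq_of_preconnectedSpace (e.symm y) x₀]

end Global

end ConfEinstein

theorem mainTheorem2 (D : ℕ) (hD : 3 ≤ D) (M : Type*) [TopologicalSpace M] [ConnectedSpace M]
    [ChartedSpace (E D) M] [IsManifold 𝓘(ℝ, E D) ∞ M]
    (g : PseudoRiemannianMetric D M) (h : BivectorMetric D M)
    (hW : ¬ WeylInvertible g) (hC : Compatible g h) :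
    (ConformallyEinstein g → ∃ ξ : VectorTwoForm D M, XiCondition g h ξ) ∧
    (∀ ξ : VectorTwoForm D M, XiCondition g h ξ →
      ∀ x : M, ∃ U : Set M, IsOpen U ∧ x ∈ U ∧ ∃ Ω : M → ℝ, IsEinsteinFactorOn g U Ω ∧
        ∀ z ∈ U, ∀ v, mfderiv 𝓘(ℝ, E D) 𝓘(ℝ) Ω z v = Ω z * lambdaXi g h ξ z v) ∧
    (TrivialH1 D M →
      (ConformallyEinstein g ↔ ∃ ξ : VectorTwoForm D M, XiCondition g h ξ)) := by
  refine ⟨exists_xiCondition hD h, ?_, fun hH => ⟨exists_xiCondition hD h, ?_⟩⟩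
  · rintro ξ ⟨hs, hc, hR⟩ x
    obtain ⟨U, hUo, hxU, f, hf, hΛ⟩ := exists_local_primitive hs hc x
    obtain ⟨U', hU', hU'o, hxU', κ, hκ⟩ :=
      exists_einstein_nhds (Ω := fun x => Real.exp (f x)) hD hUo hf hΛ (fun _ _ => rfl) hR hxU
    refine ⟨U', hU'o, hxU', fun x => Real.exp (f x),
      ⟨Real.contDiff_exp.contMDiff.comp_contMDiffOn (hf.mono hU'), fun x _ => Real.exp_pos _,
        κ, hκ⟩, fun z hz v => ?_⟩
    have h1 := funDeriv_exp (mdifferentiableAt_of_contMDiffOn hUo hf (hU' hz)) v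
    exact h1.trans (congrArg (Real.exp (f z) * ·) (hΛ z (hU' hz) v).symm)
  · rintro ⟨ξ, hs, hc, hR⟩
    obtain ⟨f, hf, hΛ⟩ := hH _ hs hc
    exact conformallyEinstein_of_primitive hD hf hΛ hR
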